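/- **Conventions.** For $0<\omega\le\pi$ let $S_\omega=\{z\in\mathbb C\setminus\{0\} : |\arg z|<\omega\}$, and for $0\le\omega<\pi$ let $\overline{S}_\omega=\{0\}\cup\{z\ne 0: |\arg z|\le\omega\}$ (so $\overline S_0=[0,\infty)$). Powers $w^\alpha$ are taken with the principal branch, with $0^\alpha=0$ for $\operatorname{Re}\alpha>0$ and $0^0=1$. Let $X$ be a complex Banach space. A closed linear operator $A$ on $X$ is *sectorial* if there is $\omega\in[0,\pi)$ such that $\sigma(A)\subseteq\overline S_\omega$ and $\lambda\mapsto\lambda R(\lambda,A)$, $R(\lambda,A)=(\lambda-A)^{-1}$, is bounded on $\mathbb C\setminus\overline S_{\omega'}$ for every $\omega'\in(\omega,\pi)$; the least such $\omega$ is the sectoriality angle $\omega_{\rm se}(A)$. For $\omega\in(\omega_{\rm se}(A),\pi)$ let $\mathcal E(S_\omega)$ be the set of bounded holomorphic functions $f$ on $S_\omega$ with $\int_{\partial S_\delta}|f(z)|\,\frac{|dz|}{|z|}<\infty$ for all $0\le\delta<\omega$, and let $\mathcal E_e(S_\omega)=\mathcal E(S_\omega)\oplus\mathbb C\mathbf 1\oplus\mathbb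 C\frac1{1+z}$. For $e\in\mathcal E(S_\omega)$ and $c,d\in\mathbb C$ put $$\Phi_A\Bigl(e+c+\frac d{1+z}\Bigr)=\frac1{2\pi i}\int_{\partial S_\delta}e(z)R(z,A)\,dz+c\,I+d\,(1+A)^{-1}\qquad(\omega_{\rm se}(A)<\delta<\omega),$$ with $\partial S_\delta$ positively oriented. For $f$ meromorphic on $S_\omega$ let $[f]=\{e\in\mathcal E_e(S_\omega): ef\in\mathcal E_e(S_\omega)\}$. If for every $e\in\mathcal E_e(S_\omega)$ the operators $\Phi_A(e')$, $e'\in[ef]$, have no common kernel vector except $0$, then $f$ is in the domain of $\Phi_A$, and $\Phi_A(f)$ is the closed operator given by $$\Phi_A(f)x=y\iff\Phi_A(ef)x=\Phi_A(e)y\ \text{ for all } e\in[f].$$ The union of these mappings over all $\omega\in(\omega_{\rm se}(A),\pi)$ is the sectorial calculus $\Phi_A$ for $A$. Let $\mathrm H^\infty(S_\omega\cup\{0\})$ be the set of bounded holomorphic functions $f$ on $S_\omega$ for which $f(0):=\lim_{t\searrow0}f(t)$ exists. The *uniform extension* $\Phi_A^{\rm uni}$ of the sectorial calculus is given by $\Phi^{\rm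 uni}_A(f)=T$ whenever, for some $\omega\in(\omega_{\rm se}(A),\pi)$, there are $f,f_n\in\mathrm H^\infty(S_\omega\cup\{0\})$ such that $\Phi_A(f_n)$ is defined and bounded for each $n\in\mathbb N$, $f_n\to f$ uniformly on $S_\omega\cup\{0\}$, and $\Phi_A(f_n)\to T$ in operator norm. For $\lambda\in\mathbb C$ write $e^{-\lambda A}=\Phi_A(e^{-\lambda z})$ and $(\lambda A)^\alpha=\Phi_A((\lambda z)^\alpha)$ whenever these are defined. **Proposition 11.2.** Let $0\le\varphi<\frac\pi2$, let $\mu$ be a complex Borel measure on $\overline S_\varphi$, and let $\alpha\in\mathbb C$ with $\alpha=0$ or $\operatorname{Re}\alpha>0$. Then the function $$f(z)=\int_{\overline S_\varphi}(\lambda z)^\alpha e^{-\lambda z}\,\mu(d\lambda)$$ is well defined (the integral converges absolutely) and holomorphic on $S_{\frac\pi2-\varphi}$, and bounded on each smaller sector $S_\psi$, $\psi<\frac\pi2-\varphi$. If $A$ is any sectorial operator on a complex Banach space $X$ with $\omega_{\rm se}(A)+\varphi<\frac\pi2$, then for each $\lambda\in\overline S_\varphi$ the composition $(\lambda A)^\alpha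 e^{-\lambda A}$ is a bounded, everywhere defined operator, the function $\lambda\mapsto(\lambda A)^\alpha e^{-\lambda A}$ is integrable with respect to $\mu$ in $\mathcal L(X)$, the function $f$ is in the domain of $\Phi_A^{\rm uni}$ (which is single-valued at $f$), and $$\Phi_A^{\rm uni}(f)=\int_{\overline S_\varphi}(\lambda A)^\alpha e^{-\lambda A}\,\mu(d\lambda).$$ -/

import Mathlib

open Real Set Filter Topology MeasureTheory

namespace SectorialCalculus

noncomputable section

/-- The open sector of half-angle `ω` (used for `0 < ω ≤ π`), symmetric about the positive
half-line. -/
def sector (ω : ℝ) : Set ℂ := {z | z ≠ 0 ∧ |z.arg| < ω}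

/-- The closed sector of half-angle `ω` (used for `0 ≤ ω < π`). It contains `0`, because
`Complex.arg 0 = 0`, and for `ω = 0` it is the half-line `[0, ∞)`. -/
def closedSector (ω : ℝ) : Set ℂ := {z | |z.arg| ≤ ω}

/-! ### Integration against complex measures -/

/-- `∫ f dμ` for a complex measure `μ` and a Bochner integrable function `f` with values in a
complex Banach space. -/
def cintegral {S E : Type*} [MeasurableSpace S] [NormedAddCommGroup E] [NormedSpace ℂ E]
    (μ : ComplexMeasure S) (f : S → E) : E :=
  VectorMeasure.integral μ f (ContinuousLinearMap.lsmul ℝ ℂ : ℂ →L[ℝ] E →L[ℝ] E).flip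

/-- The function `f(z) = ∫ (s z)^α e^{-s z} μ(ds)`, with the principal branch of the power. -/
def sectorTransform {φ : ℝ} (μ : ComplexMeasure (closedSector φ)) (α : ℂ) (z : ℂ) : ℂ :=
  cintegral μ (fun s => ((s : ℂ) * z) ^ α * Complex.exp (-((s : ℂ) * z)))

variable {X : Type*} [NormedAddCommGroup X] [NormedSpace ℂ X]

/-! ### Sectorial operators -/

/-- The bounded operator `R` is a two-sided inverse of `z - A`. -/
def IsResolventAt (A : X →ₗ.[ℂ] X) (z : ℂ) (R : X →L[ℂ] X) : Prop :=
  (∀ x : X, ∃ h : R x ∈ A.domain, z • R x - A ⟨R x, h⟩ = x) ∧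
    ∀ x : A.domain, R (z • (x : X) - A x) = x

/-- The spectrum of an unbounded operator. -/
def opSpectrum (A : X →ₗ.[ℂ] X) : Set ℂ := {z | ¬ ∃ R, IsResolventAt A z R}

open Classical in
/-- The resolvent `R(z, A) = (z - A)⁻¹` (and `0` on the spectrum). -/
def opResolvent (A : X →ₗ.[ℂ] X) (z : ℂ) : X →L[ℂ] X :=
  if h : ∃ R, IsResolventAt A z R then h.choose else 0

/-- The spectrum of `A` lies in the closed sector of half-angle `ω`, and `z ↦ z R(z, A)` is
bounded outside every larger sector. -/
def IsSectorialOfAngle (A : X →ₗ.[ℂ] X) (ω : ℝ) : Prop :=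
  0 ≤ ω ∧ ω < π ∧ opSpectrum A ⊆ closedSector ω ∧
    ∀ ω', ω < ω' → ω' < π → ∃ M : ℝ, ∀ z, z ∉ closedSector ω' → ‖z • opResolvent A z‖ ≤ M

/-- Sectorial operators: closed, not necessarily densely defined or injective. -/
def IsSectorial (A : X →ₗ.[ℂ] X) : Prop :=
  A.IsClosed ∧ ∃ ω, IsSectorialOfAngle A ω

/-- The sectoriality angle, the least `ω` such that `A` is sectorial of angle `ω`. -/
def sectAngle (A : X →ₗ.[ℂ] X) : ℝ := sInf {ω | IsSectorialOfAngle A ω}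

/-! ### The elementary functions and the primary calculus -/

/-- Bounded holomorphic functions on the sector. Only the values of `f` on the sector matter. -/
def IsHInfty (ω : ℝ) (f : ℂ → ℂ) : Prop :=
  DifferentiableOn ℂ f (sector ω) ∧ ∃ M : ℝ, ∀ z ∈ sector ω, ‖f z‖ ≤ M

/-- The algebra `E(S_ω)`: bounded holomorphic functions on the sector that are integrable with
respect to `|dz| / |z|` over the boundary of every smaller sector, that is, over every ray
`arg z = θ` with `|θ| < ω`. -/
def IsElementary (ω : ℝ) (f : ℂ → ℂ) : Prop :=
  IsHInfty ω f ∧ ∀ θ : ℝ, |θ| < ω →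
    IntegrableOn (fun t : ℝ => f (t * Complex.exp (θ * Complex.I)) / t) (Ioi 0)

/-- The integral of `f(z) R(z, A) dz` over the ray `arg z = θ`, oriented from `0` to `∞`. -/
def rayIntegral (A : X →ₗ.[ℂ] X) (θ : ℝ) (f : ℂ → ℂ) : X →L[ℂ] X :=
  ∫ t : ℝ in Ioi 0,
    (f (t * Complex.exp (θ * Complex.I)) * Complex.exp (θ * Complex.I)) •
      opResolvent A (t * Complex.exp (θ * Complex.I))

/-- `(2πi)⁻¹ ∫ f(z) R(z, A) dz` over the positively oriented boundary of the sector of half-angle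
`δ` (inwards along `arg z = δ`, outwards along `arg z = -δ`). -/
def cauchyIntegral (A : X →ₗ.[ℂ] X) (δ : ℝ) (f : ℂ → ℂ) : X →L[ℂ] X :=
  (2 * (π : ℂ) * Complex.I)⁻¹ • (rayIntegral A (-δ) f - rayIntegral A δ f)

/-- `f = e + c + d / (1 + z)` on the sector, with `e` elementary. -/
def IsExtDecomp (ω : ℝ) (f e : ℂ → ℂ) (c d : ℂ) : Prop :=
  IsElementary ω e ∧ ∀ z ∈ sector ω, f z = e z + c + d / (1 + z)

/-- The algebra `E_e(S_ω) = E(S_ω) ⊕ ℂ 1 ⊕ ℂ (1 + z)⁻¹`. -/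
def IsExtElementary (ω : ℝ) (f : ℂ → ℂ) : Prop := ∃ e c d, IsExtDecomp ω f e c d

/-- `T` is the value at `f ∈ E_e(S_ω)` of the primary calculus: if `f = e + c + d / (1 + z)` then
`T = (2πi)⁻¹ ∫ e(z) R(z, A) dz + c + d (1 + A)⁻¹`. The contour is the boundary of a sector whose
angle lies between the sectoriality angle and `ω`; by Cauchy's theorem it does not matter which
one. Note that `(1 + A)⁻¹ = -R(-1, A)`. -/
def ExtValue (A : X →ₗ.[ℂ] X) (ω : ℝ) (f : ℂ → ℂ) (T : X →L[ℂ] X) : Prop :=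
  ∃ e c d, IsExtDecomp ω f e c d ∧
    T = cauchyIntegral A ((sectAngle A + ω) / 2) e + c • ContinuousLinearMap.id ℂ X
      + d • (-opResolvent A (-1))

/-! ### The sectorial calculus: algebraic extension inside the meromorphic functions

A meromorphic function on the sector is represented by a function `f : ℂ → ℂ` with
`MeromorphicOn f (sector ω)`; two of them are identified if they agree on the sector outside a
relatively closed discrete subset. -/

/-- `e` and `g` belong to `E_e(S_ω)` and `e f = g` as meromorphic functions on the sector. -/
def Regularizes (ω : ℝ) (f e g : ℂ → ℂ) : Prop :=
  IsExtElementary ω e ∧ IsExtElementary ω g ∧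
    (fun z => e z * f z) =ᶠ[codiscreteWithin (sector ω)] g

/-- The set `[f] = {e ∈ E_e(S_ω) | e f ∈ E_e(S_ω)}`. -/
def regularizers (ω : ℝ) (f : ℂ → ℂ) : Set (ℂ → ℂ) := {e | ∃ g, Regularizes ω f e g}

/-- Anchor sets: non-empty sets of functions in `E_e(S_ω)` such that the kernels of the associated
operators intersect in `{0}`. -/
def IsAnchorSet (A : X →ₗ.[ℂ] X) (ω : ℝ) (M : Set (ℂ → ℂ)) : Prop :=
  M.Nonempty ∧ ∀ x : X, (∀ e ∈ M, ∀ T, ExtValue A ω e T → T x = 0) → x = 0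

/-- The domain of the calculus on the sector of half-angle `ω`: the meromorphic functions `f` such
that `[e f]` is an anchor set for each `e ∈ E_e(S_ω)`. -/
def MemDom (A : X →ₗ.[ℂ] X) (ω : ℝ) (f : ℂ → ℂ) : Prop :=
  MeromorphicOn f (sector ω) ∧
    ∀ e, IsExtElementary ω e → IsAnchorSet A ω (regularizers ω (fun z => e z * f z))

/-- The graph of the sectorial calculus `Φ_A` at `f`: the union (inductive limit) over all sectors
of half-angle `ω` larger than the sectoriality angle of the operators given by
`Φ(f) x = y ↔ ∀ e ∈ [f], Φ(e f) x = Φ(e) y`. -/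
def SectCalc (A : X →ₗ.[ℂ] X) (f : ℂ → ℂ) (x y : X) : Prop :=
  ∃ ω, sectAngle A < ω ∧ ω < π ∧ MemDom A ω f ∧
    ∀ e g, Regularizes ω f e g → ∀ S T, ExtValue A ω e S → ExtValue A ω g T → T x = S y

/-- `f` lies in the domain of the sectorial calculus and `Φ_A(f)` is the bounded operator `T`. -/
def HasBoundedValue (A : X →ₗ.[ℂ] X) (f : ℂ → ℂ) (T : X →L[ℂ] X) : Prop :=
  ∀ x y, SectCalc A f x y ↔ y = T x

/-! ### The uniform extension -/

/-- Bounded holomorphic functions on the sector with a limit at `0` along the positive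
half-line. -/
def IsHInftyZero (ω : ℝ) (f : ℂ → ℂ) : Prop :=
  IsHInfty ω f ∧ ∃ a : ℂ, Tendsto (fun t : ℝ => f t) (𝓝[>] 0) (𝓝 a)

/-- The function `f`, with the value at `0` set to `lim f(t)` as `t ↘ 0`. -/
def extendZero (f : ℂ → ℂ) : ℂ → ℂ :=
  Function.update f 0 (limUnder (𝓝[>] (0 : ℝ)) (fun t : ℝ => f t))

/-- `f` lies in the domain of the uniform extension of the sectorial calculus, and `T` is a value
at `f`: on some sector of half-angle larger than the sectoriality angle, `f` is the uniform limit
(also at `0`) of functions `F n` for which `Φ_A(F n)` is a bounded operator, and these operators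
converge to `T` in operator norm. -/
def UniValue (A : X →ₗ.[ℂ] X) (f : ℂ → ℂ) (T : X →L[ℂ] X) : Prop :=
  ∃ ω, sectAngle A < ω ∧ ω < π ∧ IsHInftyZero ω f ∧
    ∃ (F : ℕ → ℂ → ℂ) (S : ℕ → X →L[ℂ] X),
      (∀ n, IsHInftyZero ω (F n) ∧ HasBoundedValue A (F n) (S n)) ∧
      TendstoUniformlyOn (fun n => extendZero (F n)) (extendZero f) atTop (insert 0 (sector ω)) ∧
      Tendsto S atTop (𝓝 T)

/-! ### The operators `(sA)^α e^{-sA}` -/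

/-- The graph of the composition of the operators `e^{-sA} = (e^{-sz})(A)` and
`(sA)^α = ((sz)^α)(A)`, both given by the sectorial calculus. -/
def PowExp (A : X →ₗ.[ℂ] X) (α s : ℂ) (x y : X) : Prop :=
  ∃ u, SectCalc A (fun z => Complex.exp (-(s * z))) x u ∧ SectCalc A (fun z => (s * z) ^ α) u y

end

end SectorialCalculus

/-!
The kernel `k(w) = w^α e^{-w}` is bounded and holomorphic on every sector of half-angle less than
`π / 2`, and up to the multiple `0 ^ α * (1 + w)⁻¹` it decays polynomially at `0` and `∞`. Hence,
for `s ≠ 0` in the closed sector of half-angle `φ`, the dilated kernel `k(s z)` belongs to the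
algebra `E_e` on a sector of half-angle `ω` with `ω_se(A) < ω < π / 2 - φ`, and the primary calculus
yields bounded operators `V s` (`kernelOp`). If the splitting is chosen as `k(s z) - 0 ^ α (1 + |s| z)⁻¹`
plus the corresponding resolvent, the estimates are invariant under dilations, so that `V` is
bounded (`exists_norm_kernelOp_le`) and, by dominated convergence, norm continuous away from `s = 0`
(`continuousAt_kernelOp`). Multiplicativity of the calculus identifies `V s` with the composition of
`(sA)^α` and `e^{-sA}` (`powExp_iff`); here `(sz)^α` is regularized by a power of `(1 + z)⁻¹`.

The pairs `(V s, k(s ·))` form a bounded function with values in the Banach space of operators times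
bounded continuous functions on the sector, measurable because it is continuous away from `0`. Its
integral lies in the closure of the subspace of all pairs `(Φ(F), F)` with `F` in `E_e` having a
limit at `0`, because a continuous linear map commutes with the integral
(`cintegral_mem_topologicalClosure`). A sequence in this subspace that converges to the integral is
exactly what the definition of the uniform extension asks for (`uniValue_sectorTransform`). The same
closure argument shows that the transform is holomorphic.

For uniqueness (`UniValue.unique`), let `T` and `T'` be two values at `f`. Multiplication with the
elementary function `z (1 + z)⁻²` turns uniform convergence into convergence of contour integrals,
hence `A (1 + A)⁻² (T - T') = 0`, and `T - T'` has its range in the kernel of `A`. There the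
operators `(1 + t A)⁻¹` are the identity; but if the kernel is not trivial, every bounded
holomorphic function in the domain of the calculus with a limit at `0` approaches this limit in an
integrable way, and therefore `(1 + t A)⁻¹ (T - f(0))` and `(1 + t A)⁻¹ (T' - f(0))` tend to `0` as
`t → ∞`.

The calculus itself rests on `prim_mul`, the multiplicativity of the Cauchy integral
`(2πi)⁻¹ ∫ e(z) R(z, A) dz`. All contour integrals are written with respect to `dz / z` on rays
parametrized by the logarithm of the modulus, which reduces Cauchy's theorem for sectors to strips
(`integral_line_eq`), and the resolvent enters as `H(z) = z R(z, A)`, which is bounded off sectors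
(`IsSectorialFamily`).
-/

namespace SectorialCalculus

/-! ### Rays and sectors -/

/-- The logarithmic parametrization `t ↦ exp (t + i θ)` of the open ray `arg z = θ`. -/
noncomputable def ray (θ t : ℝ) : ℂ := Complex.exp (t + θ * Complex.I)

lemma ray_ne_zero (θ t : ℝ) : ray θ t ≠ 0 := Complex.exp_ne_zero _

lemma norm_ray (θ t : ℝ) : ‖ray θ t‖ = Real.exp t := by
  simp [ray, Complex.norm_exp]

lemma ray_eq_mul (θ t : ℝ) : ray θ t = (Real.exp t : ℝ) * Complex.exp (θ * Complex.I) := by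
  simp [ray, Complex.exp_add]

@[fun_prop]
lemma continuous_ray (θ : ℝ) : Continuous (ray θ) := by
  unfold ray; fun_prop

lemma re_ray (θ t : ℝ) : (ray θ t).re = Real.exp t * Real.cos θ := by
  simp [ray, Complex.exp_re]

lemma cos_abs_arg {z : ℂ} (hz : z ≠ 0) : Real.cos |z.arg| = z.re / ‖z‖ := by
  rw [Real.cos_abs, Complex.cos_arg hz]

lemma abs_arg_lt_iff {z : ℂ} (hz : z ≠ 0) {ω : ℝ} (h0 : 0 ≤ ω) (h1 : ω ≤ π) :
    |z.arg| < ω ↔ ‖z‖ * Real.cos ω < z.re := by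
  have hz' : 0 < ‖z‖ := norm_pos_iff.mpr hz
  rw [← Real.strictAntiOn_cos.lt_iff_gt ⟨h0, h1⟩ ⟨abs_nonneg _, Complex.abs_arg_le_pi z⟩,
    cos_abs_arg hz, lt_div_iff₀ hz', mul_comm]

lemma abs_arg_le_iff {z : ℂ} (hz : z ≠ 0) {ω : ℝ} (h0 : 0 ≤ ω) (h1 : ω ≤ π) :
    |z.arg| ≤ ω ↔ ‖z‖ * Real.cos ω ≤ z.re := by
  have hz' : 0 < ‖z‖ := norm_pos_iff.mpr hz
  rw [← Real.strictAntiOn_cos.le_iff_ge ⟨h0, h1⟩ ⟨abs_nonneg _, Complex.abs_arg_le_pi z⟩,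
    cos_abs_arg hz, le_div_iff₀ hz', mul_comm]

lemma abs_arg_neg {z : ℂ} (hz : z ≠ 0) : |(-z).arg| = π - |z.arg| := by
  apply Real.injOn_cos ⟨abs_nonneg _, Complex.abs_arg_le_pi _⟩
    ⟨by linarith [Complex.abs_arg_le_pi z], by linarith [abs_nonneg z.arg]⟩
  rw [Real.cos_pi_sub, cos_abs_arg hz, cos_abs_arg (neg_ne_zero.mpr hz)]
  simp [neg_div]

lemma abs_arg_ray {θ : ℝ} (h : |θ| ≤ π) (t : ℝ) : |(ray θ t).arg| = |θ| := by
  apply Real.injOn_cos ⟨abs_nonneg _, Complex.abs_arg_le_pi _⟩ ⟨abs_nonneg _, h⟩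
  rw [cos_abs_arg (ray_ne_zero _ _), re_ray, norm_ray, Real.cos_abs]
  field_simp

lemma ray_arg_log {z : ℂ} (hz : z ≠ 0) : ray z.arg (Real.log ‖z‖) = z := by
  rw [ray_eq_mul, Real.exp_log (norm_pos_iff.mpr hz)]
  exact Complex.norm_mul_exp_arg_mul_I z

lemma ray_mem_sector {θ ω : ℝ} (h : |θ| < ω) (hω : ω ≤ π) (t : ℝ) : ray θ t ∈ sector ω :=
  ⟨ray_ne_zero _ _, by rwa [abs_arg_ray (h.le.trans hω)]⟩

lemma ray_notMem_closedSector {θ ω : ℝ} (h : ω < |θ|) (hθ : |θ| ≤ π) (t : ℝ) :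
    ray θ t ∉ closedSector ω := by
  change ¬ |_| ≤ ω
  rw [abs_arg_ray hθ]; exact not_le.mpr h

lemma ne_zero_of_notMem_closedSector {ω : ℝ} (h0 : 0 ≤ ω) {z : ℂ} (hz : z ∉ closedSector ω) :
    z ≠ 0 := by
  rintro rfl; exact hz (by simpa [closedSector] using h0)

lemma neg_ray_of_pos (θ t : ℝ) : -ray θ t = ray (θ - π) t := by
  unfold ray
  push_cast
  rw [sub_mul, ← add_sub_assoc, Complex.exp_sub, Complex.exp_pi_mul_I]
  rw [div_neg, div_one]

lemma neg_ray_of_neg (θ t : ℝ) : -ray θ t = ray (θ + π) t := by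
  unfold ray
  push_cast
  rw [add_mul, ← add_assoc, Complex.exp_add _ (π * Complex.I), Complex.exp_pi_mul_I]
  rw [mul_neg, mul_one]

lemma isOpen_sector {ω : ℝ} (h0 : 0 ≤ ω) (h1 : ω ≤ π) : IsOpen (sector ω) := by
  have : sector ω = {z : ℂ | z ≠ 0} ∩ {z | ‖z‖ * Real.cos ω < z.re} := by
    ext z
    constructor
    · rintro ⟨hz, h⟩; exact ⟨hz, (abs_arg_lt_iff hz h0 h1).mp h⟩
    · rintro ⟨hz, h⟩; exact ⟨hz, (abs_arg_lt_iff hz h0 h1).mpr h⟩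
  rw [this]
  exact isOpen_ne.inter (isOpen_lt (by fun_prop) (by fun_prop))

lemma isClosed_closedSector {ω : ℝ} (h0 : 0 ≤ ω) (h1 : ω ≤ π) : IsClosed (closedSector ω) := by
  have : closedSector ω = {z | ‖z‖ * Real.cos ω ≤ z.re} := by
    ext z
    rcases eq_or_ne z 0 with rfl | hz
    · simp [closedSector, h0]
    · exact abs_arg_le_iff hz h0 h1
  rw [this]
  exact isClosed_le (by fun_prop) (by fun_prop)

lemma sector_mono {ω ω' : ℝ} (h : ω ≤ ω') : sector ω ⊆ sector ω' :=
  fun _ hz => ⟨hz.1, hz.2.trans_le h⟩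

lemma closedSector_mono {ω ω' : ℝ} (h : ω ≤ ω') : closedSector ω ⊆ closedSector ω' :=
  fun _ hz => le_trans (show |_| ≤ ω from hz) h

lemma ofReal_mem_sector {ω : ℝ} (hω : 0 < ω) {t : ℝ} (ht : 0 < t) : (t : ℂ) ∈ sector ω :=
  ⟨by exact_mod_cast ht.ne', by simpa [Complex.arg_ofReal_of_nonneg ht.le] using hω⟩

lemma neg_ofReal_notMem_closedSector {ω : ℝ} (hω : ω < π) {t : ℝ} (ht : 0 < t) :
    -(t : ℂ) ∉ closedSector ω := by
  change ¬ |_| ≤ ω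
  rw [not_le]
  rw [abs_arg_neg (by exact_mod_cast ht.ne'), Complex.arg_ofReal_of_nonneg ht.le]
  simpa using hω

/-- Off the negative half-line, `1 + t z` stays away from `0`, uniformly in `t`. -/
lemma exists_norm_add_le {ω : ℝ} (h0 : 0 ≤ ω) (h1 : ω < π) :
    ∃ c > 0, ∀ z ∈ sector ω, ∀ t : ℝ, 0 ≤ t → c * (1 + t * ‖z‖) ≤ ‖1 + t * z‖ := by
  have hc : -1 < Real.cos ω := by
    rw [← Real.cos_pi]; exact Real.strictAntiOn_cos ⟨h0, h1.le⟩ ⟨pi_pos.le, le_rfl⟩ h1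
  have hc' := Real.cos_le_one ω
  refine ⟨√((1 + Real.cos ω) / 2), by apply Real.sqrt_pos.mpr; linarith, fun z hz t ht => ?_⟩
  have hre := ((abs_arg_lt_iff hz.1 h0 h1.le).mp hz.2).le
  have h2 : ‖1 + t * z‖ ^ 2 = 1 + 2 * t * z.re + t ^ 2 * ‖z‖ ^ 2 := by
    rw [Complex.sq_norm, Complex.sq_norm, Complex.normSq_apply, Complex.normSq_apply]
    simp; ring
  apply le_of_sq_le_sq _ (norm_nonneg _)
  rw [mul_pow, Real.sq_sqrt (by linarith), h2]
  have h3 : t * (‖z‖ * Real.cos ω) ≤ t * z.re := mul_le_mul_of_nonneg_left hre ht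
  nlinarith [mul_nonneg (sub_nonneg.mpr hc') (sq_nonneg (1 - t * ‖z‖))]

lemma one_add_mul_ne_zero {ω : ℝ} (h1 : ω ≤ π) {z : ℂ} (hz : z ∈ sector ω) {t : ℝ} (ht : 0 ≤ t) :
    1 + t * z ≠ 0 := by
  intro h
  rcases ht.eq_or_lt with rfl | ht
  · simp at h
  have h4 : z = -((t⁻¹ : ℝ) : ℂ) := by
    have : (t : ℂ) ≠ 0 := by exact_mod_cast ht.ne'
    push_cast; field_simp; linear_combination h
  have := hz.2
  rw [h4, abs_arg_neg (by exact_mod_cast (inv_pos.mpr ht).ne'),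
    Complex.arg_ofReal_of_nonneg (inv_pos.mpr ht).le] at this
  simp at this; linarith

/-! ### Cauchy's theorem for strips and sectors -/

section Cauchy

variable {E : Type*} [NormedAddCommGroup E] [NormedSpace ℂ E]

lemma norm_exp_neg_mul_sq (ε : ℝ) (x y : ℝ) :
    ‖Complex.exp (-ε * ((x : ℂ) + y * Complex.I) ^ 2)‖ = Real.exp (-ε * (x ^ 2 - y ^ 2)) := by
  rw [Complex.norm_exp]
  congr 1
  simp [pow_two]

/-- Cauchy's theorem for a strip under the additional assumption that the function is dominated by
a Gaussian. -/
lemma integral_line_eq_of_gaussian_bound {g : ℂ → E} {a b : ℝ} (hab : a ≤ b)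
    (hd : ∀ ζ : ℂ, ζ.im ∈ Icc a b → DifferentiableAt ℂ g ζ) {C ε : ℝ} (hε : 0 < ε)
    (hM : ∀ x y : ℝ, y ∈ Icc a b → ‖g (x + y * Complex.I)‖ ≤ C * Real.exp (-ε * x ^ 2))
    (ha : Integrable fun t : ℝ => g (t + a * Complex.I))
    (hb : Integrable fun t : ℝ => g (t + b * Complex.I)) :
    ∫ t : ℝ, g (t + a * Complex.I) = ∫ t : ℝ, g (t + b * Complex.I) := by
  have hrect : ∀ T : ℝ, (∫ x in (-T)..T, g (x + a * Complex.I)) -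
      (∫ x in (-T)..T, g (x + b * Complex.I)) =
      Complex.I • (∫ y in a..b, g (((-T : ℝ) : ℂ) + y * Complex.I)) -
      Complex.I • (∫ y in a..b, g ((T : ℂ) + y * Complex.I)) := by
    intro T
    have := Complex.integral_boundary_rect_eq_zero_of_differentiableOn g
      ⟨-T, a⟩ ⟨T, b⟩ (fun ζ hζ => (hd ζ ?_).differentiableWithinAt)
    · simp only at this
      rw [sub_eq_zero] at this
      rw [← this]; abel
    · have := hζ.2
      simpa [uIcc_of_le hab] using this
  have hside : ∀ T : ℝ, ‖∫ y in a..b, g ((T : ℂ) + y * Complex.I)‖ ≤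
      C * Real.exp (-ε * T ^ 2) * |b - a| := by
    intro T
    apply intervalIntegral.norm_integral_le_of_norm_le_const
    intro y hy
    rw [uIoc_of_le hab] at hy
    exact hM T y ⟨hy.1.le, hy.2⟩
  have hlim0 : Tendsto (fun T : ℝ => C * Real.exp (-ε * T ^ 2) * |b - a|) atTop (𝓝 0) := by
    have : Tendsto (fun T : ℝ => Real.exp (-ε * T ^ 2)) atTop (𝓝 0) := by
      apply Real.tendsto_exp_atBot.comp
      exact (tendsto_pow_atTop two_ne_zero).const_mul_atTop_of_neg (by linarith)
    simpa using (this.const_mul C).mul_const |b - a|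
  have h1 : Tendsto (fun T : ℝ => ∫ y in a..b, g ((T : ℂ) + y * Complex.I)) atTop (𝓝 0) :=
    squeeze_zero_norm hside hlim0
  have h2 : Tendsto (fun T : ℝ => ∫ y in a..b, g (((-T : ℝ) : ℂ) + y * Complex.I)) atTop (𝓝 0) :=
    squeeze_zero_norm (fun T => by simpa using hside (-T)) hlim0
  have h3 := (intervalIntegral_tendsto_integral ha tendsto_neg_atTop_atBot tendsto_id).sub
    (intervalIntegral_tendsto_integral hb tendsto_neg_atTop_atBot tendsto_id)
  have h4 : Tendsto (fun T : ℝ => (∫ x in (-T)..T, g (x + a * Complex.I)) -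
      (∫ x in (-T)..T, g (x + b * Complex.I))) atTop (𝓝 0) := by
    simp_rw [hrect]
    simpa using (h2.const_smul Complex.I).sub (h1.const_smul Complex.I)
  exact sub_eq_zero.mp (tendsto_nhds_unique h3 h4)

/-- Cauchy's theorem for a strip: the integral of a bounded holomorphic function takes the same
value on both boundary lines as soon as it converges absolutely there. No decay in the interior of
the strip is needed, since one can multiply by `exp (-ε ζ²)` and let `ε → 0`. -/
theorem integral_line_eq {h : ℂ → E} {a b : ℝ} (hab : a ≤ b)
    (hd : ∀ ζ : ℂ, ζ.im ∈ Icc a b → DifferentiableAt ℂ h ζ) {M : ℝ}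
    (hM : ∀ ζ : ℂ, ζ.im ∈ Icc a b → ‖h ζ‖ ≤ M)
    (ha : Integrable fun t : ℝ => h (t + a * Complex.I))
    (hb : Integrable fun t : ℝ => h (t + b * Complex.I)) :
    ∫ t : ℝ, h (t + a * Complex.I) = ∫ t : ℝ, h (t + b * Complex.I) := by
  set c : ℝ := max (a ^ 2) (b ^ 2)
  have hc : ∀ y ∈ Icc a b, y ^ 2 ≤ c := by
    intro y hy
    rcases le_total 0 y with h0 | h0
    · exact le_max_of_le_right (pow_le_pow_left₀ h0 hy.2 2)
    · exact le_max_of_le_left (by nlinarith [hy.1])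
  have hc0 : 0 ≤ c := le_max_of_le_left (sq_nonneg a)
  let ε : ℕ → ℝ := fun n => 1 / ((n : ℝ) + 1)
  have hε0 : ∀ n, 0 < ε n := fun n => by positivity
  have hε1 : ∀ n, ε n ≤ 1 := fun n => by
    rw [div_le_one (by positivity)]; linarith [n.cast_nonneg (α := ℝ)]
  let g : ℕ → ℂ → E := fun n ζ => Complex.exp (-(ε n : ℝ) * ζ ^ 2) • h ζ
  have hexp : ∀ n (x y : ℝ), y ∈ Icc a b →
      ‖Complex.exp (-(ε n : ℝ) * ((x : ℂ) + y * Complex.I) ^ 2)‖ ≤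
        Real.exp c * Real.exp (-ε n * x ^ 2) := by
    intro n x y hy
    rw [norm_exp_neg_mul_sq, ← Real.exp_add]
    apply Real.exp_le_exp.mpr
    have := hc y hy
    nlinarith [hε0 n, hε1 n, mul_le_mul_of_nonneg_left this (hε0 n).le,
      mul_le_mul_of_nonneg_right (hε1 n) hc0]
  have hexp' : ∀ n (x y : ℝ), y ∈ Icc a b →
      ‖Complex.exp (-(ε n : ℝ) * ((x : ℂ) + y * Complex.I) ^ 2)‖ ≤ Real.exp c := by
    intro n x y hy
    refine (hexp n x y hy).trans (mul_le_of_le_one_right (Real.exp_pos _).le ?_)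
    rw [Real.exp_le_one_iff]
    nlinarith [hε0 n, mul_nonneg (hε0 n).le (sq_nonneg x)]
  have hint : ∀ n, ∀ y ∈ Icc a b, Integrable (fun t : ℝ => h (t + y * Complex.I)) →
      Integrable fun t : ℝ => g n (t + y * Complex.I) := by
    intro n y hy hi
    refine hi.bdd_smul (Real.exp c) ?_ (Eventually.of_forall fun t => hexp' n t y hy)
    exact Continuous.aestronglyMeasurable (by fun_prop)
  have hlim : ∀ y ∈ Icc a b, Integrable (fun t : ℝ => h (t + y * Complex.I)) →
      Tendsto (fun n => ∫ t : ℝ, g n (t + y * Complex.I)) atTop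
        (𝓝 (∫ t : ℝ, h (t + y * Complex.I))) := by
    intro y hy hi
    refine tendsto_integral_of_dominated_convergence
      (fun t => Real.exp c * ‖h (t + y * Complex.I)‖) (fun n => (hint n y hy hi).1)
      (hi.norm.const_mul _) (fun n => Eventually.of_forall fun t => ?_)
      (Eventually.of_forall fun t => ?_)
    · rw [norm_smul]
      exact mul_le_mul_of_nonneg_right (hexp' n t y hy) (norm_nonneg _)
    · have h0 : Tendsto ε atTop (𝓝 0) := tendsto_one_div_add_atTop_nhds_zero_nat
      have hcont : Continuous fun e : ℝ =>
          Complex.exp (-(e : ℂ) * ((t : ℂ) + y * Complex.I) ^ 2) • h (t + y * Complex.I) := by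
        fun_prop
      have h1 := (hcont.tendsto 0).comp h0
      simp only [Complex.ofReal_zero, neg_zero, zero_mul, Complex.exp_zero, one_smul] at h1
      exact h1
  have heq : ∀ n, ∫ t : ℝ, g n (t + a * Complex.I) = ∫ t : ℝ, g n (t + b * Complex.I) := by
    intro n
    refine integral_line_eq_of_gaussian_bound hab (fun ζ hζ => ?_) (C := Real.exp c * M) (hε0 n)
      (fun x y hy => ?_) (hint n a ⟨le_rfl, hab⟩ ha) (hint n b ⟨hab, le_rfl⟩ hb)
    · exact DifferentiableAt.smul (by fun_prop) (hd ζ hζ)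
    · have hh : ‖h (x + y * Complex.I)‖ ≤ M := hM _ (by simpa using hy)
      rw [norm_smul]
      calc _ ≤ (Real.exp c * Real.exp (-ε n * x ^ 2)) * M :=
            mul_le_mul (hexp n x y hy) hh (norm_nonneg _) (by positivity)
        _ = _ := by ring
  have h1 := hlim a ⟨le_rfl, hab⟩ ha
  simp_rw [heq] at h1
  exact tendsto_nhds_unique h1 (hlim b ⟨hab, le_rfl⟩ hb)

/-- Cauchy's theorem for a sector: rotation of a ray of integration, with respect to `dz / z`. -/
theorem integral_ray_eq {h : ℂ → E} {θ₁ θ₂ : ℝ} (h12 : θ₁ ≤ θ₂)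
    (hd : ∀ θ ∈ Icc θ₁ θ₂, ∀ t, DifferentiableAt ℂ h (ray θ t)) {M : ℝ}
    (hM : ∀ θ ∈ Icc θ₁ θ₂, ∀ t, ‖h (ray θ t)‖ ≤ M)
    (h1 : Integrable fun t => h (ray θ₁ t)) (h2 : Integrable fun t => h (ray θ₂ t)) :
    ∫ t, h (ray θ₁ t) = ∫ t, h (ray θ₂ t) := by
  refine integral_line_eq (h := fun ζ => h (Complex.exp ζ)) h12 (fun ζ hζ => ?_) (M := M)
    (fun ζ hζ => ?_) h1 h2
  · have := hd ζ.im hζ ζ.re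
    rw [ray, Complex.re_add_im] at this
    exact this.comp ζ Complex.differentiableAt_exp
  · have := hM ζ.im hζ ζ.re
    rwa [ray, Complex.re_add_im] at this

/-- `(2πi)⁻¹ ∫ h(z) dz / z` over the positively oriented boundary of the sector of half-angle
`δ`. In the parametrization of the rays by `ray`, the form `dz / z` becomes `dt`. -/
noncomputable def bdry (δ : ℝ) (h : ℂ → E) : E :=
  (2 * (π : ℂ) * Complex.I)⁻¹ • ((∫ t, h (ray (-δ) t)) - ∫ t, h (ray δ t))

lemma bdry_eq_zero {h : ℂ → E} {δ : ℝ} (hδ : 0 ≤ δ)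
    (hd : ∀ θ, |θ| ≤ δ → ∀ t, DifferentiableAt ℂ h (ray θ t)) {M : ℝ}
    (hM : ∀ θ, |θ| ≤ δ → ∀ t, ‖h (ray θ t)‖ ≤ M)
    (h1 : Integrable fun t => h (ray (-δ) t)) (h2 : Integrable fun t => h (ray δ t)) :
    bdry δ h = 0 := by
  rw [bdry, integral_ray_eq (by linarith) (fun θ hθ => hd θ (abs_le.mpr hθ))
    (fun θ hθ => hM θ (abs_le.mpr hθ)) h1 h2, sub_self, smul_zero]

/-- The contour may be moved. -/
lemma bdry_eq_bdry {h : ℂ → E} {δ δ' : ℝ} (h0 : 0 ≤ δ) (hδ : δ ≤ δ')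
    (hd : ∀ θ, δ ≤ |θ| → |θ| ≤ δ' → ∀ t, DifferentiableAt ℂ h (ray θ t)) {M : ℝ}
    (hM : ∀ θ, δ ≤ |θ| → |θ| ≤ δ' → ∀ t, ‖h (ray θ t)‖ ≤ M)
    (h1 : Integrable fun t => h (ray (-δ) t)) (h2 : Integrable fun t => h (ray δ t))
    (h3 : Integrable fun t => h (ray (-δ') t)) (h4 : Integrable fun t => h (ray δ' t)) :
    bdry δ h = bdry δ' h := by
  have key : ∀ θ ∈ Icc δ δ', δ ≤ |θ| ∧ |θ| ≤ δ' := fun θ hθ => by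
    rw [abs_of_nonneg (h0.trans hθ.1)]; exact hθ
  have key' : ∀ θ ∈ Icc (-δ') (-δ), δ ≤ |θ| ∧ |θ| ≤ δ' := fun θ hθ => by
    rw [abs_of_nonpos (by linarith [hθ.2])]; constructor <;> linarith [hθ.1, hθ.2]
  rw [bdry, bdry, integral_ray_eq hδ (fun θ hθ => hd θ (key θ hθ).1 (key θ hθ).2)
    (fun θ hθ => hM θ (key θ hθ).1 (key θ hθ).2) h2 h4,
    integral_ray_eq (by linarith) (fun θ hθ => hd θ (key' θ hθ).1 (key' θ hθ).2)
    (fun θ hθ => hM θ (key' θ hθ).1 (key' θ hθ).2) h3 h1]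

end Cauchy

/-! ### The Cauchy kernel on rays -/

lemma integrable_exp_neg_mul_abs {a : ℝ} (ha : 0 < a) :
    Integrable fun t : ℝ => Real.exp (-a * |t|) := by
  have h1 : IntegrableOn (fun t : ℝ => Real.exp (-a * |t|)) (Ioi 0) :=
    (exp_neg_integrableOn_Ioi 0 ha).congr_fun
      (fun t ht => by simp only [abs_of_pos (show (0 : ℝ) < t from ht)]) measurableSet_Ioi
  have h2 : IntegrableOn (fun t : ℝ => Real.exp (-a * |t|)) (Iic 0) :=
    (integrableOn_exp_mul_Iic ha 0).congr_fun
      (fun t ht => by simp only [abs_of_nonpos (show t ≤ (0 : ℝ) from ht)]; ring_nf)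
      measurableSet_Iic
  rw [← integrableOn_univ, ← Iic_union_Ioi (a := (0 : ℝ))]
  exact h2.union h1

section Kernel

lemma integrable_of_norm_le_exp {E : Type*} [NormedAddCommGroup E] {g : ℝ → E}
    (hg : Continuous g) {C a : ℝ} (ha : 0 < a)
    (h : ∀ t, ‖g t‖ ≤ C * Real.exp (-a * |t|)) : Integrable g :=
  ((integrable_exp_neg_mul_abs ha).const_mul C).mono' hg.aestronglyMeasurable
    (Eventually.of_forall h)

/-- Points on different rays are far apart. -/
lemma norm_ray_sub_ray_ge (θ η t s : ℝ) :
    |Real.sin ((θ - η) / 2)| * (Real.exp t + Real.exp s) ≤ ‖ray θ t - ray η s‖ := by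
  apply le_of_sq_le_sq _ (norm_nonneg _)
  have h1 : ‖ray θ t - ray η s‖ ^ 2 =
      Real.exp t ^ 2 + Real.exp s ^ 2 - 2 * Real.exp t * Real.exp s * Real.cos (θ - η) := by
    rw [Complex.sq_norm, Complex.normSq_apply, Real.cos_sub]
    simp only [ray, Complex.sub_re, Complex.sub_im, Complex.exp_re, Complex.exp_im]
    simp only [Complex.add_re, Complex.ofReal_re, Complex.mul_re, Complex.I_re, mul_zero,
      Complex.ofReal_im, Complex.I_im, mul_one, sub_self, add_zero, Complex.add_im, Complex.mul_im,
      zero_add]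
    linear_combination Real.exp t ^ 2 * Real.sin_sq_add_cos_sq θ +
      Real.exp s ^ 2 * Real.sin_sq_add_cos_sq η
  rw [h1, mul_pow, sq_abs, Real.sin_sq_eq_half_sub]
  rw [show 2 * ((θ - η) / 2) = θ - η by ring]
  nlinarith [mul_nonneg (show 0 ≤ 1 + Real.cos (θ - η) by linarith [Real.neg_one_le_cos (θ - η)])
    (sq_nonneg (Real.exp t - Real.exp s))]

lemma abs_sin_half_pos {x : ℝ} (h0 : x ≠ 0) (h1 : |x| < 2 * π) : 0 < |Real.sin (x / 2)| := by
  rw [abs_pos]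
  intro h
  rw [Real.sin_eq_zero_iff_of_lt_of_lt (by linarith [(abs_lt.mp h1).1])
    (by linarith [(abs_lt.mp h1).2])] at h
  exact h0 (by linarith)

/-- The distance from `w` to the points of a ray that does not contain `w`. -/
lemma exists_norm_ray_sub_ge {θ : ℝ} (hθ : |θ| ≤ π) {w : ℂ} (hw : w ≠ 0) (h : |w.arg| ≠ |θ|) :
    ∃ c > 0, ∀ t, c * (Real.exp t + ‖w‖) ≤ ‖ray θ t - w‖ := by
  have hw' := Complex.abs_arg_le_pi w
  refine ⟨|Real.sin ((θ - w.arg) / 2)|, abs_sin_half_pos (fun h0 => h ?_) ?_, fun t => ?_⟩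
  · rw [sub_eq_zero.mp h0]
  · have h2 : |θ - w.arg| ≤ |θ| + |w.arg| := abs_sub _ _
    refine lt_of_le_of_ne (by linarith) fun h3 => h ?_
    linarith
  · have := norm_ray_sub_ray_ge θ w.arg t (Real.log ‖w‖)
    rwa [ray_arg_log hw, Real.exp_log (norm_pos_iff.mpr hw)] at this

lemma exp_div_le_exp_neg_abs {r : ℝ} (hr : 0 < r) (t : ℝ) :
    Real.exp t / ((Real.exp t + r) * (Real.exp t + 1)) ≤ max 1 r⁻¹ * Real.exp (-1 * |t|) := by
  have he := Real.exp_pos t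
  rcases le_total 0 t with ht | ht
  · rw [abs_of_nonneg ht, div_le_iff₀ (by positivity), neg_one_mul, Real.exp_neg]
    have h1 : Real.exp t ≤ (Real.exp t)⁻¹ * ((Real.exp t + r) * (Real.exp t + 1)) := by
      rw [le_inv_mul_iff₀ he]; nlinarith
    calc _ ≤ 1 * ((Real.exp t)⁻¹ * ((Real.exp t + r) * (Real.exp t + 1))) := by rwa [one_mul]
      _ ≤ max 1 r⁻¹ * ((Real.exp t)⁻¹ * ((Real.exp t + r) * (Real.exp t + 1))) := by
        gcongr; exact le_max_left _ _
      _ = _ := by ring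
  · rw [abs_of_nonpos ht, div_le_iff₀ (by positivity), neg_one_mul, neg_neg]
    have h1 : 1 ≤ r⁻¹ * ((Real.exp t + r) * (Real.exp t + 1)) := by
      rw [le_inv_mul_iff₀ hr]; nlinarith
    calc Real.exp t ≤ Real.exp t * (r⁻¹ * ((Real.exp t + r) * (Real.exp t + 1))) :=
          le_mul_of_one_le_right he.le h1
      _ ≤ Real.exp t * (max 1 r⁻¹ * ((Real.exp t + r) * (Real.exp t + 1))) := by
        gcongr; exact le_max_right _ _
      _ = _ := by ring

lemma integrable_kernel {θ : ℝ} (hθ : |θ| < π) {w : ℂ} (hw : w ≠ 0) (h : |w.arg| ≠ |θ|) :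
    Integrable fun t => ray θ t / (ray θ t - w) - ray θ t / (ray θ t + 1) := by
  obtain ⟨c, hc, h1⟩ := exists_norm_ray_sub_ge hθ.le hw h
  obtain ⟨d, hd, h2⟩ := exists_norm_ray_sub_ge hθ.le (w := -1) (by simp)
    (by rw [abs_arg_neg one_ne_zero]; simpa using hθ.ne')
  simp only [norm_neg, norm_one, sub_neg_eq_add] at h2
  have hw' : 0 < ‖w‖ := norm_pos_iff.mpr hw
  have p1 : ∀ t, 0 < ‖ray θ t - w‖ := fun t =>
    lt_of_lt_of_le (by have := Real.exp_pos t; positivity) (h1 t)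
  have p2 : ∀ t, 0 < ‖ray θ t + 1‖ := fun t =>
    lt_of_lt_of_le (by have := Real.exp_pos t; positivity) (h2 t)
  have q1 : ∀ t, ray θ t - w ≠ 0 := fun t => norm_pos_iff.mp (p1 t)
  have q2 : ∀ t, ray θ t + 1 ≠ 0 := fun t => norm_pos_iff.mp (p2 t)
  have hr := continuous_ray θ
  refine integrable_of_norm_le_exp (C := ‖1 + w‖ / (c * d) * max 1 ‖w‖⁻¹) (a := 1) ?_ one_pos
    fun t => ?_
  · exact (hr.div (by fun_prop) q1).sub (hr.div (by fun_prop) q2)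
  · have : ray θ t / (ray θ t - w) - ray θ t / (ray θ t + 1) =
        (1 + w) * ray θ t / ((ray θ t - w) * (ray θ t + 1)) := by
      have := q1 t; have := q2 t
      field_simp; ring
    rw [this, norm_div, norm_mul, norm_mul, norm_ray]
    have he := Real.exp_pos t
    calc ‖1 + w‖ * Real.exp t / (‖ray θ t - w‖ * ‖ray θ t + 1‖)
        ≤ ‖1 + w‖ * Real.exp t / ((c * (Real.exp t + ‖w‖)) * (d * (Real.exp t + 1))) := by
          gcongr
          · exact h1 t
          · exact h2 t
      _ = ‖1 + w‖ / (c * d) * (Real.exp t / ((Real.exp t + ‖w‖) * (Real.exp t + 1))) := by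
          field_simp
      _ ≤ ‖1 + w‖ / (c * d) * (max 1 ‖w‖⁻¹ * Real.exp (-1 * |t|)) := by
          gcongr; exact exp_div_le_exp_neg_abs hw' t
      _ = _ := by ring

lemma add_real_mem_slitPlane {u : ℂ} (hu : u ∈ Complex.slitPlane) {x : ℝ} (hx : 0 ≤ x) :
    (x : ℂ) + u ∈ Complex.slitPlane := by
  rw [Complex.mem_slitPlane_iff] at hu ⊢
  simp only [Complex.add_re, Complex.ofReal_re, Complex.add_im, Complex.ofReal_im, zero_add]
  rcases hu with h | h
  · left; linarith
  · exact Or.inr h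

lemma hasDerivAt_exp_ofReal (t : ℝ) :
    HasDerivAt (fun t : ℝ => ((Real.exp t : ℝ) : ℂ)) ((Real.exp t : ℝ) : ℂ) t :=
  (Real.hasDerivAt_exp t).ofReal_comp

/-- The value comes from the antiderivative `log (eᵗ + u) - log (eᵗ + v)`. -/
lemma integral_log_kernel {u v : ℂ} (hu : u ∈ Complex.slitPlane) (hv : v ∈ Complex.slitPlane)
    (hint : Integrable fun t : ℝ => ((Real.exp t : ℝ) : ℂ) / ((Real.exp t : ℝ) + u) -
      ((Real.exp t : ℝ) : ℂ) / ((Real.exp t : ℝ) + v)) :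
    ∫ t : ℝ, (((Real.exp t : ℝ) : ℂ) / ((Real.exp t : ℝ) + u) -
      ((Real.exp t : ℝ) : ℂ) / ((Real.exp t : ℝ) + v)) = Complex.log v - Complex.log u := by
  have hmem : ∀ {u : ℂ}, u ∈ Complex.slitPlane → ∀ t : ℝ,
      ((Real.exp t : ℝ) : ℂ) + u ∈ Complex.slitPlane :=
    fun hu t => add_real_mem_slitPlane hu (Real.exp_pos t).le
  have hderiv : ∀ {u : ℂ}, u ∈ Complex.slitPlane → ∀ t : ℝ,
      HasDerivAt (fun t : ℝ => Complex.log ((Real.exp t : ℝ) + u))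
        (((Real.exp t : ℝ) : ℂ) / ((Real.exp t : ℝ) + u)) t :=
    fun hu t => ((hasDerivAt_exp_ofReal t).add_const _).clog_real (hmem hu t)
  have hbot : ∀ {u : ℂ}, u ∈ Complex.slitPlane →
      Tendsto (fun t : ℝ => Complex.log ((Real.exp t : ℝ) + u)) atBot (𝓝 (Complex.log u)) := by
    intro u hu
    have h1 : Tendsto (fun t : ℝ => ((Real.exp t : ℝ) : ℂ) + u) atBot (𝓝 u) := by
      have := (Complex.continuous_ofReal.tendsto 0).comp Real.tendsto_exp_atBot
      simpa using this.add_const u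
    exact ((continuousAt_clog hu).tendsto).comp h1
  have htop : Tendsto (fun t : ℝ => Complex.log ((Real.exp t : ℝ) + u) -
      Complex.log ((Real.exp t : ℝ) + v)) atTop (𝓝 0) := by
    have hone : ∀ {u : ℂ}, u ∈ Complex.slitPlane → Tendsto (fun t : ℝ =>
        Complex.log (1 + u * (Real.exp (-t) : ℝ))) atTop (𝓝 0) := by
      intro u _
      have h1 : Tendsto (fun t : ℝ => 1 + u * (Real.exp (-t) : ℝ)) atTop (𝓝 1) := by
        have := (Complex.continuous_ofReal.tendsto 0).comp Real.tendsto_exp_neg_atTop_nhds_zero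
        simpa using (this.const_mul u).const_add 1
      have h2 := ((continuousAt_clog Complex.one_mem_slitPlane).tendsto).comp h1
      rwa [Complex.log_one] at h2
    have heq : ∀ {u : ℂ}, u ∈ Complex.slitPlane → ∀ t : ℝ, Complex.log ((Real.exp t : ℝ) + u) =
        Real.log (Real.exp t) + Complex.log (1 + u * (Real.exp (-t) : ℝ)) := by
      intro u hu t
      have h1 : ((Real.exp t : ℝ) : ℂ) + u =
          (Real.exp t : ℝ) * (1 + u * (Real.exp (-t) : ℝ)) := by
        rw [Real.exp_neg]; push_cast
        have := Complex.exp_ne_zero t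
        field_simp
      have h2 : 1 + u * (Real.exp (-t) : ℝ) ≠ 0 := by
        intro h
        rw [h, mul_zero] at h1
        exact Complex.slitPlane_ne_zero (hmem hu t) h1
      rw [h1, Complex.log_ofReal_mul (Real.exp_pos t) h2]
    have := (hone hu).sub (hone hv)
    rw [sub_zero] at this
    refine this.congr fun t => ?_
    rw [heq hu, heq hv]; ring
  rw [integral_of_hasDerivAt_of_tendsto (fun t => (hderiv hu t).sub (hderiv hv t)) hint
    ((hbot hu).sub (hbot hv)) htop]
  ring

lemma ray_mem_slitPlane {θ : ℝ} (h : |θ| < π) (s : ℝ) : ray θ s ∈ Complex.slitPlane := by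
  rw [Complex.mem_slitPlane_iff_arg]
  refine ⟨fun h1 => ?_, ray_ne_zero _ _⟩
  have := abs_arg_ray h.le s
  rw [h1, abs_of_pos pi_pos] at this
  linarith

lemma log_ray {θ : ℝ} (h : |θ| < π) (s : ℝ) : Complex.log (ray θ s) = s + θ * Complex.I := by
  rw [ray, Complex.log_exp]
  · simpa using (abs_lt.mp h).1
  · simpa using (abs_lt.mp h).2.le

/-- The integral of `1 / (z - w) - 1 / (z + 1)` over the boundary of a sector containing `w`. -/
lemma bdry_kernel {δ : ℝ} (hδ : 0 < δ) (hδ' : δ < π) {w : ℂ} (hw : w ∈ sector δ) :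
    bdry δ (fun z => z / (z - w) - z / (z + 1)) = 1 := by
  obtain ⟨hw0, hwδ⟩ := hw
  set s := Real.log ‖w‖
  set η := w.arg
  have hη := abs_lt.mp hwδ
  have hwray : w = ray η s := (ray_arg_log hw0).symm
  have hmulray : ∀ a b s t : ℝ, ray a s * ray b t = ray (a + b) (s + t) := by
    intro a b s t
    rw [ray, ray, ray, ← Complex.exp_add]; push_cast; ring_nf
  -- after a rotation of the ray `arg z = θ` to the positive half-line, the poles are `-u`, `-v`
  -- with `u = ray ψ s` and `v = ray (-θ) 0`; both have to be given by principal arguments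
  have key : ∀ θ ψ : ℝ, |θ| < π → |η| ≠ |θ| → |ψ| < π → -ray (η - θ) s = ray ψ s →
      ∫ t, (ray θ t / (ray θ t - w) - ray θ t / (ray θ t + 1)) =
        -(θ : ℂ) * Complex.I - (s + ψ * Complex.I) := by
    intro θ ψ hθ hne hψ hψs
    have hconv : ∀ t, ray θ t / (ray θ t - w) - ray θ t / (ray θ t + 1) =
        ((Real.exp t : ℝ) : ℂ) / ((Real.exp t : ℝ) + ray ψ s) -
      ((Real.exp t : ℝ) : ℂ) / ((Real.exp t : ℝ) + ray (-θ) 0) := by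
      intro t
      have e0 : ray 0 t = ((Real.exp t : ℝ) : ℂ) := by rw [ray]; push_cast; simp
      have e1 : ray θ t = ray θ 0 * (Real.exp t : ℝ) := by rw [← e0, hmulray]; simp
      have e2 : w = ray θ 0 * ray (η - θ) s := by rw [hmulray, hwray]; congr 1 <;> ring
      have e3 : (1 : ℂ) = ray θ 0 * ray (-θ) 0 := by rw [hmulray]; simp [ray]
      have hz := ray_ne_zero θ 0
      rw [← hψs]
      congr 1
      · rw [e1, e2, ← mul_sub, mul_div_mul_left _ _ hz, ← sub_eq_add_neg]
      · rw [e1]; nth_rewrite 1 [e3]; rw [← mul_add, mul_div_mul_left _ _ hz]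
    have hint := integrable_kernel hθ hw0 hne
    simp_rw [hconv] at hint ⊢
    have hθ' : |-θ| < π := by rwa [abs_neg]
    rw [integral_log_kernel (ray_mem_slitPlane hψ s) (ray_mem_slitPlane hθ' 0) hint,
      log_ray hψ, log_ray hθ']
    push_cast; ring
  have hne : |η| ≠ |δ| := by rw [abs_of_pos hδ]; exact hwδ.ne
  have h1 := key δ (η - δ + π) (by rwa [abs_of_pos hδ]) hne
    (by rw [abs_lt]; constructor <;> linarith) (neg_ray_of_neg _ _)
  have h2 := key (-δ) (η + δ - π) (by rwa [abs_neg, abs_of_pos hδ]) (by rwa [abs_neg])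
    (by rw [abs_lt]; constructor <;> linarith) (by rw [neg_ray_of_pos]; congr 1; ring)
  rw [bdry, h1, h2]
  have : (π : ℂ) ≠ 0 := by exact_mod_cast pi_ne_zero
  have := Complex.I_ne_zero
  push_cast
  rw [smul_eq_mul]
  field_simp
  ring

end Kernel

/-! ### Cauchy's integral formula for sectors -/

section Formula

variable {E F : Type*} [NormedAddCommGroup E] [NormedSpace ℂ E]
  [NormedAddCommGroup F] [NormedSpace ℂ F]

/-- Absolute convergence of `∫ h(z) dz / z` over the boundary of the sector of half-angle `δ`. -/
def RayIntegrable (δ : ℝ) (h : ℂ → E) : Prop :=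
  (Integrable fun t => h (ray (-δ) t)) ∧ Integrable fun t => h (ray δ t)

namespace RayIntegrable

variable {δ : ℝ} {h k : ℂ → E}

omit [NormedSpace ℂ E] in
lemma sub (hh : RayIntegrable δ h) (hk : RayIntegrable δ k) :
    RayIntegrable δ fun z => h z - k z := ⟨hh.1.sub hk.1, hh.2.sub hk.2⟩

lemma smul_const {g : ℂ → ℂ} (hg : RayIntegrable δ g) (v : E) :
    RayIntegrable δ fun z => g z • v :=
  ⟨hg.1.smul_const v, hg.2.smul_const v⟩

omit [NormedSpace ℂ E] in
lemma congr (hh : RayIntegrable δ h) (h1 : ∀ θ, |θ| = |δ| → ∀ t, h (ray θ t) = k (ray θ t)) :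
    RayIntegrable δ k :=
  ⟨hh.1.congr (Eventually.of_forall fun t => h1 _ (abs_neg δ) t),
    hh.2.congr (Eventually.of_forall fun t => h1 _ rfl t)⟩

omit [NormedSpace ℂ E] in
lemma intro (h0 : 0 ≤ δ) (h1 : ∀ θ, |θ| = δ → Integrable fun t => h (ray θ t)) :
    RayIntegrable δ h :=
  ⟨h1 _ (by rw [abs_neg, abs_of_nonneg h0]), h1 _ (abs_of_nonneg h0)⟩

omit [NormedSpace ℂ E] in
lemma integrable (hh : RayIntegrable δ h) {θ : ℝ} (hθ : |θ| = δ) :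
    Integrable fun t => h (ray θ t) := by
  rcases eq_or_eq_neg_of_abs_eq hθ with rfl | rfl
  · exact hh.2
  · exact hh.1

end RayIntegrable

lemma bdry_congr {δ : ℝ} {h k : ℂ → E} (h1 : ∀ θ, |θ| = |δ| → ∀ t, h (ray θ t) = k (ray θ t)) :
    bdry δ h = bdry δ k := by
  rw [bdry, bdry, integral_congr_ae (Eventually.of_forall fun t => h1 _ (abs_neg δ) t),
    integral_congr_ae (Eventually.of_forall fun t => h1 _ rfl t)]

lemma bdry_add {δ : ℝ} {h k : ℂ → E} (hh : RayIntegrable δ h) (hk : RayIntegrable δ k) :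
    bdry δ (fun z => h z + k z) = bdry δ h + bdry δ k := by
  rw [bdry, bdry, bdry, integral_add hh.1 hk.1, integral_add hh.2 hk.2, ← smul_add]
  congr 1; abel

lemma bdry_sub {δ : ℝ} {h k : ℂ → E} (hh : RayIntegrable δ h) (hk : RayIntegrable δ k) :
    bdry δ (fun z => h z - k z) = bdry δ h - bdry δ k := by
  rw [bdry, bdry, bdry, integral_sub hh.1 hk.1, integral_sub hh.2 hk.2, ← smul_sub]
  congr 1; abel

lemma bdry_smul {δ : ℝ} {h : ℂ → E} (c : ℂ) : bdry δ (fun z => c • h z) = c • bdry δ h := by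
  rw [bdry, bdry, integral_smul, integral_smul, ← smul_sub, smul_comm]

lemma bdry_clm [CompleteSpace E] [CompleteSpace F] {δ : ℝ} {h : ℂ → E} (hh : RayIntegrable δ h)
    (L : E →L[ℂ] F) : bdry δ (fun z => L (h z)) = L (bdry δ h) := by
  rw [bdry, bdry, L.integral_comp_comm hh.1, L.integral_comp_comm hh.2, map_smul, map_sub]

lemma bdry_smul_const [CompleteSpace E] {δ : ℝ} {g : ℂ → ℂ} (hg : RayIntegrable δ g) (v : E) :
    bdry δ (fun z => g z • v) = bdry δ g • v :=
  bdry_clm hg ((ContinuousLinearMap.id ℂ ℂ).smulRight v)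

lemma norm_bdry_le {δ : ℝ} {h : ℂ → E} {g : ℝ → ℝ} (hg : Integrable g)
    (h1 : ∀ θ, |θ| = |δ| → ∀ t, ‖h (ray θ t)‖ ≤ g t) : ‖bdry δ h‖ ≤ ∫ t, g t := by
  have h2 : ∀ θ, |θ| = |δ| → ‖∫ t, h (ray θ t)‖ ≤ ∫ t, g t := fun θ hθ =>
    norm_integral_le_of_norm_le hg (Eventually.of_forall (h1 θ hθ))
  have h0 : 0 ≤ ∫ t, g t := (norm_nonneg _).trans (h2 δ rfl)
  rw [bdry, norm_smul]
  have h3 : ‖(2 * (π : ℂ) * Complex.I)⁻¹‖ ≤ 1 / 2 := by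
    simp only [norm_inv, norm_mul, Complex.norm_I, mul_one, Complex.norm_real, Complex.norm_ofNat,
      Real.norm_eq_abs, abs_of_pos pi_pos]
    rw [one_div]
    apply inv_anti₀ (by norm_num)
    linarith [pi_gt_three]
  have h4 := norm_sub_le (∫ t, h (ray (-δ) t)) (∫ t, h (ray δ t))
  have h5 := h2 (-δ) (abs_neg δ)
  have h6 := h2 δ rfl
  calc _ ≤ 1 / 2 * ((∫ t, g t) + ∫ t, g t) :=
        mul_le_mul h3 (by linarith) (norm_nonneg _) (by norm_num)
    _ = _ := by ring

/-- **Cauchy's integral formula** for the sector of half-angle `δ`. -/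
theorem bdry_cauchy [CompleteSpace E] {G : ℂ → E} {δ : ℝ} (hδ : 0 < δ) (hδ' : δ < π)
    (hd : ∀ z, z ≠ 0 → |z.arg| ≤ δ → DifferentiableAt ℂ G z) {M : ℝ}
    (hM : ∀ z, z ≠ 0 → |z.arg| ≤ δ → ‖G z‖ ≤ M) {w : ℂ} (hw : w ∈ sector δ)
    (hint : RayIntegrable δ fun z => (z / (z - w)) • G z) :
    bdry δ (fun z => (z / (z - w)) • G z) = G w := by
  have hwθ : ∀ θ, |θ| = δ → |w.arg| ≠ |θ| := fun θ hθ => by rw [hθ]; exact hw.2.ne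
  have hne : ∀ θ, |θ| = δ → ∀ t, ray θ t ≠ w := by
    rintro θ hθ t rfl
    exact hwθ θ hθ (abs_arg_ray (by rw [hθ]; exact hδ'.le) t)
  have hker : RayIntegrable δ fun z => z / (z - w) - z / (z + 1) :=
    RayIntegrable.intro hδ.le fun θ hθ =>
      integrable_kernel (by rw [hθ]; exact hδ') hw.1 (hwθ θ hθ)
  obtain ⟨c, hc, hc1⟩ := exists_norm_add_le (ω := (δ + π) / 2) (by linarith) (by linarith)
  have hmem : ∀ z : ℂ, z ≠ 0 → |z.arg| ≤ δ → z ∈ sector ((δ + π) / 2) :=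
    fun z hz h => ⟨hz, by linarith⟩
  have hq : ∀ z : ℂ, z ≠ 0 → |z.arg| ≤ δ → c * (1 + ‖z‖) ≤ ‖z + 1‖ := fun z hz h => by
    simpa [add_comm] using hc1 z (hmem z hz h) 1 zero_le_one
  have hq0 : ∀ z : ℂ, z ≠ 0 → |z.arg| ≤ δ → z + 1 ≠ 0 := fun z hz h =>
    norm_pos_iff.mp (lt_of_lt_of_le (by positivity) (hq z hz h))
  -- the pole at `w` is removed by the divided difference, the slow decay by the second term
  let D : ℂ → E := fun z => z • dslope G w z + (z / (z + 1)) • G w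
  have hopen := (isOpen_sector hδ.le hδ'.le).mem_nhds hw
  have hsl : DifferentiableOn ℂ (dslope G w) (sector δ) :=
    (Complex.differentiableOn_dslope hopen).mpr
      fun z hz => (hd z hz.1 hz.2.le).differentiableWithinAt
  have hDeq : ∀ z, z ≠ w → D z = (z / (z - w)) • G z - (z / (z - w) - z / (z + 1)) • G w := by
    intro z hz
    simp only [D, dslope_of_ne _ hz, slope_def_module]
    rw [smul_smul, sub_smul, smul_sub, div_eq_mul_inv z (z - w)]
    abel
  have hDdiff : ∀ z : ℂ, z ≠ 0 → |z.arg| ≤ δ → DifferentiableAt ℂ D z := by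
    intro z hz h
    have h1 : DifferentiableAt ℂ (dslope G w) z := by
      rcases eq_or_ne z w with rfl | hzw
      · exact hsl.differentiableAt hopen
      · exact (differentiableAt_dslope_of_ne hzw).mpr (hd z hz h)
    have h2 : DifferentiableAt ℂ (fun z : ℂ => z / (z + 1)) z :=
      differentiableAt_id.div (by fun_prop) (hq0 z hz h)
    exact (differentiableAt_id.smul h1).add (h2.smul_const _)
  obtain ⟨r, hr, hball⟩ := Metric.nhds_basis_closedBall.mem_iff.mp hopen
  obtain ⟨B, hB⟩ := (isCompact_closedBall w r).exists_bound_of_continuousOn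
    (hsl.continuousOn.mono hball)
  have hDbd : ∀ z : ℂ, z ≠ 0 → |z.arg| ≤ δ →
      ‖D z‖ ≤ max ((‖w‖ + r) * B) ((1 + ‖w‖ / r) * (M + M)) + 1 / c * ‖G w‖ := by
    intro z hz h
    refine (norm_add_le _ _).trans (add_le_add ?_ ?_)
    · rcases le_or_gt (dist z w) r with h1 | h1
      · refine le_max_of_le_left ?_
        rw [norm_smul]
        have hzn : ‖z‖ ≤ ‖w‖ + r := by
          rw [dist_eq_norm] at h1; linarith [norm_le_norm_add_norm_sub' z w]
        exact mul_le_mul hzn (hB z h1) (norm_nonneg _) (by positivity)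
      · refine le_max_of_le_right ?_
        have hzw : z ≠ w := by rintro rfl; simp at h1; linarith
        have hp : 0 < ‖z - w‖ := norm_pos_iff.mpr (sub_ne_zero.mpr hzw)
        rw [dist_eq_norm] at h1
        rw [dslope_of_ne _ hzw, slope_def_module, smul_smul, norm_smul]
        refine mul_le_mul ?_ ((norm_sub_le _ _).trans
          (add_le_add (hM z hz h) (hM w hw.1 hw.2.le))) (norm_nonneg _) (by positivity)
        rw [norm_mul, norm_inv, ← div_eq_mul_inv, div_le_iff₀ hp]
        have h3 : ‖w‖ ≤ ‖w‖ / r * ‖z - w‖ := by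
          rw [div_mul_eq_mul_div, le_div_iff₀ hr]; gcongr
        linarith [norm_le_norm_add_norm_sub' z w]
    · rw [norm_smul, norm_div]
      refine mul_le_mul_of_nonneg_right ?_ (norm_nonneg _)
      have hp : 0 < ‖z + 1‖ := norm_pos_iff.mpr (hq0 z hz h)
      rw [div_le_div_iff₀ hp hc]
      nlinarith [hq z hz h]
  have hDint : RayIntegrable δ D :=
    (hint.sub (hker.smul_const (G w))).congr fun θ hθ t =>
      (hDeq _ (hne θ (by rwa [abs_of_pos hδ] at hθ) t)).symm
  have harg : ∀ θ, |θ| ≤ δ → ∀ t, |(ray θ t).arg| ≤ δ := fun θ hθ t => by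
    rwa [abs_arg_ray (hθ.trans hδ'.le)]
  have hzero : bdry δ D = 0 := bdry_eq_zero hδ.le
    (fun θ hθ t => hDdiff _ (ray_ne_zero _ _) (harg θ hθ t))
    (fun θ hθ t => hDbd _ (ray_ne_zero _ _) (harg θ hθ t)) hDint.1 hDint.2
  have h1 : bdry δ (fun z => (z / (z - w)) • G z) =
      bdry δ fun z => D z + (z / (z - w) - z / (z + 1)) • G w :=
    bdry_congr fun θ hθ t => by
      rw [hDeq _ (hne θ (by rwa [abs_of_pos hδ] at hθ) t), sub_add_cancel]
  rw [h1, bdry_add hDint (hker.smul_const _), hzero, bdry_smul_const hker,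
    bdry_kernel hδ hδ' hw, one_smul, zero_add]

/-- Cauchy's integral formula at the point `-1` of the complementary sector, obtained from
`bdry_cauchy` by the substitution `z ↦ -z`. -/
theorem bdry_cauchy_outer [CompleteSpace E] {G : ℂ → E} {δ : ℝ} (hδ : 0 < δ) (hδ' : δ < π)
    (hd : ∀ z, z ≠ 0 → δ ≤ |z.arg| → DifferentiableAt ℂ G z) {M : ℝ}
    (hM : ∀ z, z ≠ 0 → δ ≤ |z.arg| → ‖G z‖ ≤ M)
    (hint : RayIntegrable δ fun z => (z / (z + 1)) • G z) :
    bdry δ (fun z => (z / (z + 1)) • G z) = -G (-1) := by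
  have hfun : ∀ z : ℂ, (z / (z - 1)) • G (-z) = ((-z) / (-z + 1)) • G (-z) := fun z => by
    rw [show -z + 1 = -(z - 1) by ring, neg_div_neg_eq]
  have e1 : ∀ t, (ray (-(π - δ)) t / (ray (-(π - δ)) t - 1)) • G (-ray (-(π - δ)) t) =
      (ray δ t / (ray δ t + 1)) • G (ray δ t) := fun t => by
    rw [hfun, neg_ray_of_neg, show -(π - δ) + π = δ by ring]
  have e2 : ∀ t, (ray (π - δ) t / (ray (π - δ) t - 1)) • G (-ray (π - δ) t) =
      (ray (-δ) t / (ray (-δ) t + 1)) • G (ray (-δ) t) := fun t => by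
    rw [hfun, neg_ray_of_pos, show π - δ - π = -δ by ring]
  have harg : ∀ z : ℂ, z ≠ 0 → |z.arg| ≤ π - δ → δ ≤ |(-z).arg| := fun z hz h => by
    rw [abs_arg_neg hz]; linarith
  have h := bdry_cauchy (G := fun z => G (-z)) (δ := π - δ) (w := 1) (M := M) (by linarith)
    (by linarith)
    (fun z hz h => (hd (-z) (neg_ne_zero.mpr hz) (harg z hz h)).comp z (by fun_prop))
    (fun z hz h => hM (-z) (neg_ne_zero.mpr hz) (harg z hz h))
    ⟨one_ne_zero, by simpa using hδ'⟩
    ⟨hint.2.congr (Eventually.of_forall fun t => (e1 t).symm),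
      hint.1.congr (Eventually.of_forall fun t => (e2 t).symm)⟩
  rw [← h, bdry, bdry, ← smul_neg, neg_sub]
  simp_rw [e1, e2]

end Formula

/-! ### Elementary functions -/

lemma integrableOn_div_iff {E : Type*} [NormedAddCommGroup E] [NormedSpace ℝ E] (g : ℝ → E) :
    IntegrableOn g (Ioi 0) ↔ Integrable fun t : ℝ => Real.exp t • g (Real.exp t) := by
  have h := integrableOn_image_iff_integrableOn_abs_deriv_smul (s := univ) MeasurableSet.univ
    (fun x _ => (Real.hasDerivAt_exp x).hasDerivWithinAt) Real.exp_injective.injOn g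
  rw [image_univ, Real.range_exp, integrableOn_univ] at h
  rw [h]
  simp_rw [Real.abs_exp]

lemma setIntegral_Ioi_eq {E : Type*} [NormedAddCommGroup E] [NormedSpace ℝ E] (g : ℝ → E) :
    ∫ t in Ioi (0 : ℝ), g t = ∫ t : ℝ, Real.exp t • g (Real.exp t) := by
  have h := integral_image_eq_integral_abs_deriv_smul (s := univ) MeasurableSet.univ
    (fun x _ => (Real.hasDerivAt_exp x).hasDerivWithinAt) Real.exp_injective.injOn g
  rw [image_univ, Real.range_exp, setIntegral_univ] at h
  rw [h]
  simp_rw [Real.abs_exp]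

lemma integrableOn_ray_iff (f : ℂ → ℂ) (θ : ℝ) :
    IntegrableOn (fun t : ℝ => f (t * Complex.exp (θ * Complex.I)) / t) (Ioi 0) ↔
      Integrable fun t => f (ray θ t) := by
  rw [integrableOn_div_iff]
  apply integrable_congr
  refine Eventually.of_forall fun t => ?_
  have : ((Real.exp t : ℝ) : ℂ) ≠ 0 := by exact_mod_cast (Real.exp_pos t).ne'
  simp only [ray_eq_mul, Complex.real_smul]
  field_simp

lemma continuous_comp_ray {E : Type*} [TopologicalSpace E] {ω : ℝ} (hω : ω ≤ π) {f : ℂ → E}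
    (hf : ContinuousOn f (sector ω)) {θ : ℝ} (hθ : |θ| < ω) : Continuous fun t => f (ray θ t) :=
  hf.comp_continuous (continuous_ray θ) fun t => ray_mem_sector hθ hω t

namespace IsHInfty

variable {ω : ℝ} {f g : ℂ → ℂ}

lemma const (c : ℂ) : IsHInfty ω fun _ => c :=
  ⟨differentiableOn_const c, ‖c‖, fun _ _ => le_rfl⟩

lemma add (hf : IsHInfty ω f) (hg : IsHInfty ω g) : IsHInfty ω fun z => f z + g z := by
  obtain ⟨hf, M, hM⟩ := hf
  obtain ⟨hg, N, hN⟩ := hg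
  exact ⟨hf.add hg, M + N, fun z hz => (norm_add_le _ _).trans (add_le_add (hM z hz) (hN z hz))⟩

lemma mul (hf : IsHInfty ω f) (hg : IsHInfty ω g) : IsHInfty ω fun z => f z * g z := by
  obtain ⟨hf, M, hM⟩ := hf
  obtain ⟨hg, N, hN⟩ := hg
  refine ⟨hf.mul hg, M * N, fun z hz => ?_⟩
  rw [norm_mul]
  exact mul_le_mul (hM z hz) (hN z hz) (norm_nonneg _) ((norm_nonneg _).trans (hM z hz))

lemma mono {ω' : ℝ} (h : ω' ≤ ω) (hf : IsHInfty ω f) : IsHInfty ω' f :=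
  ⟨hf.1.mono (sector_mono h), hf.2.imp fun _ hM z hz => hM z (sector_mono h hz)⟩

lemma congr (hf : IsHInfty ω f) (h : ∀ z ∈ sector ω, g z = f z) : IsHInfty ω g :=
  ⟨hf.1.congr h, hf.2.imp fun _ hM z hz => by rw [h z hz]; exact hM z hz⟩

lemma inv_one_add (h0 : 0 ≤ ω) (h1 : ω < π) {t : ℝ} (ht : 0 ≤ t) :
    IsHInfty ω fun z => (1 + t * z)⁻¹ := by
  obtain ⟨c, hc, h⟩ := exists_norm_add_le h0 h1
  refine ⟨fun z hz => ?_, c⁻¹, fun z hz => ?_⟩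
  · have h2 : DifferentiableAt ℂ (fun z : ℂ => 1 + t * z) z := by fun_prop
    exact (h2.inv (one_add_mul_ne_zero h1.le hz ht)).differentiableWithinAt
  · rw [norm_inv]
    refine inv_anti₀ hc (le_trans ?_ (h z hz t ht))
    exact le_mul_of_one_le_right hc.le (by linarith [mul_nonneg ht (norm_nonneg z)])

/-- `z / (1 + t z)` is bounded for `t > 0`. -/
lemma id_div_one_add (h0 : 0 ≤ ω) (h1 : ω < π) {t : ℝ} (ht : 0 < t) :
    IsHInfty ω fun z => z / (1 + t * z) := by
  have h2 := ((IsHInfty.const (ω := ω) ((t : ℂ)⁻¹)).add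
    ((IsHInfty.const (ω := ω) (-(t : ℂ)⁻¹)).mul (inv_one_add h0 h1 ht.le)))
  refine h2.congr fun z hz => ?_
  have h3 := one_add_mul_ne_zero h1.le hz ht.le
  have h4 : (t : ℂ) ≠ 0 := by exact_mod_cast ht.ne'
  change z / (1 + t * z) = (t : ℂ)⁻¹ + -(t : ℂ)⁻¹ * (1 + t * z)⁻¹
  rw [div_eq_iff h3, add_mul, mul_assoc, inv_mul_cancel₀ h3]
  field_simp
  ring

end IsHInfty

namespace IsElementary

variable {ω : ℝ} {e e' g : ℂ → ℂ}

lemma integrable (he : IsElementary ω e) {θ : ℝ} (hθ : |θ| < ω) :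
    Integrable fun t => e (ray θ t) := (integrableOn_ray_iff e θ).mp (he.2 θ hθ)

lemma of_integrable (he : IsHInfty ω e)
    (h : ∀ θ, |θ| < ω → Integrable fun t => e (ray θ t)) : IsElementary ω e :=
  ⟨he, fun θ hθ => (integrableOn_ray_iff e θ).mpr (h θ hθ)⟩

/-- Holomorphic functions with polynomial decay at `0` and at `∞` are elementary. -/
lemma of_bound (hω : ω ≤ π) (hd : DifferentiableOn ℂ e (sector ω)) {C a : ℝ} (ha : 0 < a)
    (h : ∀ z ∈ sector ω, ‖e z‖ ≤ C * Real.exp (-a * |Real.log ‖z‖|)) : IsElementary ω e := by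
  refine of_integrable ⟨hd, C, fun z hz => ?_⟩ fun θ hθ => ?_
  · refine (h z hz).trans (mul_le_of_le_one_right ?_ ?_)
    · exact nonneg_of_mul_nonneg_left ((norm_nonneg _).trans (h z hz)) (Real.exp_pos _)
    · rw [Real.exp_le_one_iff, neg_mul]
      exact neg_nonpos.mpr (by positivity)
  · refine integrable_of_norm_le_exp (continuous_comp_ray hω hd.continuousOn hθ) (C := C) ha
      fun t => ?_
    simpa [norm_ray] using h _ (ray_mem_sector hθ hω t)

lemma zero : IsElementary ω fun _ => 0 :=
  of_integrable (IsHInfty.const 0) fun _ _ => integrable_zero _ _ _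

lemma add (he : IsElementary ω e) (he' : IsElementary ω e') :
    IsElementary ω fun z => e z + e' z :=
  of_integrable (he.1.add he'.1) fun _ hθ => (he.integrable hθ).add (he'.integrable hθ)

lemma mul_bounded (hω : ω ≤ π) (he : IsElementary ω e) (hg : IsHInfty ω g) :
    IsElementary ω fun z => e z * g z := by
  refine of_integrable (he.1.mul hg) fun θ hθ => ?_
  obtain ⟨M, hM⟩ := hg.2
  exact (he.integrable hθ).mul_bdd
    (continuous_comp_ray hω hg.1.continuousOn hθ).aestronglyMeasurable
    (Eventually.of_forall fun t => hM _ (ray_mem_sector hθ hω t))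

lemma smul (hω : ω ≤ π) (he : IsElementary ω e) (c : ℂ) : IsElementary ω fun z => e z * c :=
  he.mul_bounded hω (IsHInfty.const c)

lemma mono {ω' : ℝ} (h : ω' ≤ ω) (he : IsElementary ω e) : IsElementary ω' e :=
  ⟨he.1.mono h, fun θ hθ => he.2 θ (hθ.trans_le h)⟩

lemma congr (hω : ω ≤ π) (he : IsElementary ω e) (h : ∀ z ∈ sector ω, g z = e z) :
    IsElementary ω g :=
  of_integrable (he.1.congr h) fun _ hθ => (he.integrable hθ).congr
    (Eventually.of_forall fun t => (h _ (ray_mem_sector hθ hω t)).symm)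

/-- The basic elementary function `z / ((1 + z) (1 + t z))`. -/
lemma basic (h0 : 0 ≤ ω) (h1 : ω < π) {t : ℝ} (ht : 0 < t) :
    IsElementary ω fun z => z / (1 + z) * (1 + t * z)⁻¹ := by
  have hd := (IsHInfty.id_div_one_add h0 h1 one_pos).mul (IsHInfty.inv_one_add h0 h1 ht.le)
  simp only [Complex.ofReal_one, one_mul] at hd
  obtain ⟨c, hc, h⟩ := exists_norm_add_le h0 h1
  refine of_bound h1.le hd.1 (C := 1 / (c * c * t) * max 1 (t⁻¹)⁻¹) (a := 1) one_pos fun z hz => ?_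
  have hz0 : 0 < ‖z‖ := norm_pos_iff.mpr hz.1
  have h2 := h z hz 1 zero_le_one
  have h3 := h z hz t ht.le
  simp only [one_mul, Complex.ofReal_one] at h2
  rw [norm_mul, norm_div, norm_inv, ← div_eq_mul_inv, div_div]
  have h4 := exp_div_le_exp_neg_abs (inv_pos.mpr ht) (Real.log ‖z‖)
  rw [Real.exp_log hz0] at h4
  calc ‖z‖ / (‖1 + z‖ * ‖1 + t * z‖)
      ≤ ‖z‖ / ((c * (1 + ‖z‖)) * (c * (1 + t * ‖z‖))) := by gcongr
    _ = 1 / (c * c * t) * (‖z‖ / ((‖z‖ + t⁻¹) * (‖z‖ + 1))) := by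
      field_simp
      ring
    _ ≤ _ := by
      rw [mul_assoc (1 / (c * c * t))]
      exact mul_le_mul_of_nonneg_left h4 (by positivity)

end IsElementary

/-! ### The primary calculus -/

/-- The properties of `H(z) = z R(z, A)` for a sectorial operator `A` that are used to build the
primary calculus: the resolvent identity, rewritten for `H`, and boundedness outside all larger
sectors. -/
structure IsSectorialFamily {𝔸 : Type*} [NormedRing 𝔸] [NormedAlgebra ℂ 𝔸] (H : ℂ → 𝔸)
    (ω₀ : ℝ) : Prop where
  nonneg : 0 ≤ ω₀
  lt_pi : ω₀ < π
  identity : ∀ z w, z ∉ closedSector ω₀ → w ∉ closedSector ω₀ →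
    (w - z) • (H z * H w) = w • H z - z • H w
  bound : ∀ ω', ω₀ < ω' → ω' < π → ∃ M : ℝ, ∀ z, z ∉ closedSector ω' → ‖H z‖ ≤ M

/-- The integral `(2πi)⁻¹ ∫ e(z) H(z) dz / z` over the boundary of the sector of half-angle
`δ`. -/
noncomputable def prim {𝔸 : Type*} [NormedRing 𝔸] [NormedAlgebra ℂ 𝔸] (H : ℂ → 𝔸) (δ : ℝ)
    (e : ℂ → ℂ) : 𝔸 := bdry δ fun z => e z • H z

namespace IsSectorialFamily

variable {𝔸 : Type*} [NormedRing 𝔸] [NormedAlgebra ℂ 𝔸] {H : ℂ → 𝔸} {ω₀ : ℝ}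

lemma commute (hH : IsSectorialFamily H ω₀) {z w : ℂ} (hz : z ∉ closedSector ω₀)
    (hw : w ∉ closedSector ω₀) : H z * H w = H w * H z := by
  rcases eq_or_ne z w with rfl | hne
  · rfl
  · have h1 := hH.identity z w hz hw
    have h2 := hH.identity w z hw hz
    have h3 : (w - z) • (H z * H w) = (w - z) • (H w * H z) := by
      rw [h1, ← neg_sub z w, neg_smul, h2]; abel
    exact smul_right_injective 𝔸 (sub_ne_zero.mpr hne.symm) h3

lemma exists_nhds_bound (hH : IsSectorialFamily H ω₀) {z : ℂ} (hz : z ∉ closedSector ω₀) :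
    ∃ M : ℝ, ∀ᶠ x in 𝓝 z, x ∉ closedSector ω₀ ∧ ‖H x‖ ≤ M := by
  have hz' : ω₀ < |z.arg| := not_le.mp hz
  obtain ⟨ω', h1, h2⟩ := exists_between hz'
  have h3 := h2.trans_le (Complex.abs_arg_le_pi z)
  obtain ⟨M, hM⟩ := hH.bound ω' h1 h3
  refine ⟨M, ?_⟩
  have hopen := (isClosed_closedSector (hH.nonneg.trans h1.le) h3.le).isOpen_compl
  filter_upwards [hopen.mem_nhds (not_le.mpr h2 : z ∉ closedSector ω')] with x hx
  exact ⟨fun h => hx (closedSector_mono h1.le h), hM x hx⟩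

lemma sub_eq (hH : IsSectorialFamily H ω₀) {x w : ℂ} (hx : x ∉ closedSector ω₀)
    (hw : w ∉ closedSector ω₀) : H x - H w = ((x - w) / w) • (H w - H x * H w) := by
  have hw0 := ne_zero_of_notMem_closedSector hH.nonneg hw
  have h1 := hH.identity x w hx hw
  have h2 : w • (H x - H w) = (x - w) • (H w - H x * H w) := by
    rw [smul_sub (x - w), ← neg_sub w x, neg_smul (w - x) (H x * H w), h1]
    module
  rw [div_eq_inv_mul, mul_smul, ← h2, smul_smul, inv_mul_cancel₀ hw0, one_smul]

lemma differentiableAt (hH : IsSectorialFamily H ω₀) {w : ℂ} (hw : w ∉ closedSector ω₀) :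
    DifferentiableAt ℂ H w := by
  obtain ⟨M, hM⟩ := hH.exists_nhds_bound hw
  have hw0 := ne_zero_of_notMem_closedSector hH.nonneg hw
  have hcont : Tendsto H (𝓝 w) (𝓝 (H w)) := by
    rw [tendsto_iff_norm_sub_tendsto_zero]
    have h0 : Tendsto (fun x => ‖(x - w) / w‖ * (‖H w‖ + M * ‖H w‖)) (𝓝 w) (𝓝 0) := by
      have : Continuous fun x => ‖(x - w) / w‖ * (‖H w‖ + M * ‖H w‖) := by fun_prop
      simpa using this.tendsto w
    refine squeeze_zero' (Eventually.of_forall fun x => norm_nonneg _) ?_ h0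
    filter_upwards [hM] with x hx
    rw [hH.sub_eq hx.1 hw, norm_smul]
    refine mul_le_mul_of_nonneg_left ((norm_sub_le _ _).trans ?_) (norm_nonneg _)
    exact add_le_add le_rfl ((norm_mul_le _ _).trans
      (mul_le_mul_of_nonneg_right hx.2 (norm_nonneg _)))
  refine HasDerivAt.differentiableAt (f' := w⁻¹ • (H w - H w * H w)) ?_
  rw [hasDerivAt_iff_tendsto_slope]
  have h1 : Tendsto (fun x => w⁻¹ • (H w - H x * H w)) (𝓝[≠] w)
      (𝓝 (w⁻¹ • (H w - H w * H w))) :=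
    ((tendsto_const_nhds.sub (hcont.mul_const _)).const_smul _).mono_left nhdsWithin_le_nhds
  refine h1.congr' ?_
  filter_upwards [hM.filter_mono nhdsWithin_le_nhds, self_mem_nhdsWithin] with x hx hne
  have hne' : x - w ≠ 0 := sub_ne_zero.mpr hne
  rw [slope_def_module, hH.sub_eq hx.1 hw, smul_smul]
  congr 1
  field_simp

lemma continuous_comp_ray (hH : IsSectorialFamily H ω₀) {θ : ℝ} (h1 : ω₀ < |θ|) (h2 : |θ| ≤ π) :
    Continuous fun t => H (ray θ t) :=
  continuous_iff_continuousAt.mpr fun t =>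
    (hH.differentiableAt (ray_notMem_closedSector h1 h2 t)).continuousAt.comp
      (continuous_ray θ).continuousAt

lemma exists_bound (hH : IsSectorialFamily H ω₀) {δ : ℝ} (h1 : ω₀ < δ) :
    ∃ M : ℝ, 0 ≤ M ∧ ∀ z : ℂ, δ ≤ |z.arg| → ‖H z‖ ≤ M := by
  obtain ⟨ω', h3, h4⟩ := exists_between (lt_min h1 hH.lt_pi)
  obtain ⟨M, hM⟩ := hH.bound ω' h3 (h4.trans_le (min_le_right _ _))
  exact ⟨max M 0, le_max_right _ _, fun z hz => (hM z (not_le.mpr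
    ((h4.trans_le (min_le_left _ _)).trans_le hz))).trans (le_max_left _ _)⟩

variable {ω δ : ℝ} {e e₁ e₂ : ℂ → ℂ}

lemma rayIntegrable_smul (hH : IsSectorialFamily H ω₀) (h1 : ω₀ < δ) (h2 : δ < π)
    (he : RayIntegrable δ e) : RayIntegrable δ fun z => e z • H z := by
  obtain ⟨M, -, hM⟩ := hH.exists_bound h1
  have h0 := hH.nonneg.trans h1.le
  refine RayIntegrable.intro h0 fun θ hθ => ?_
  refine (he.integrable hθ).smul_bdd M
    (hH.continuous_comp_ray (by rwa [hθ]) (by rw [hθ]; exact h2.le)).aestronglyMeasurable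
    (Eventually.of_forall fun t => hM _ ?_)
  rw [abs_arg_ray (by rw [hθ]; exact h2.le), hθ]

lemma _root_.SectorialCalculus.IsElementary.rayIntegrable (he : IsElementary ω e) (h0 : 0 ≤ δ)
    (h1 : δ < ω) : RayIntegrable δ e :=
  RayIntegrable.intro h0 fun θ hθ => he.integrable (by rwa [hθ])

/-- The contour may be moved within the sector of holomorphy. -/
lemma prim_eq_prim (hH : IsSectorialFamily H ω₀) (hω : ω ≤ π) (he : IsElementary ω e) {δ' : ℝ}
    (h1 : ω₀ < δ) (h2 : δ ≤ δ') (h3 : δ' < ω) : prim H δ e = prim H δ' e := by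
  obtain ⟨M, hM0, hM⟩ := hH.exists_bound h1
  obtain ⟨N, hN⟩ := he.1.2
  have h0 := hH.nonneg.trans h1.le
  have hi := hH.rayIntegrable_smul h1 (by linarith) (he.rayIntegrable h0 (h2.trans_lt h3))
  have hi' := hH.rayIntegrable_smul (h1.trans_le h2) (by linarith)
    (he.rayIntegrable (h0.trans h2) h3)
  refine bdry_eq_bdry h0 h2 (fun θ h4 h5 t => ?_) (M := N * M) (fun θ h4 h5 t => ?_)
    hi.1 hi.2 hi'.1 hi'.2
  · have hmem := ray_mem_sector (h5.trans_lt h3) hω t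
    exact (he.1.1.differentiableAt ((isOpen_sector (by linarith) hω).mem_nhds hmem)).smul
      (hH.differentiableAt (ray_notMem_closedSector (h1.trans_le h4) (by linarith) t))
  · have hmem := ray_mem_sector (h5.trans_lt h3) hω t
    rw [norm_smul]
    refine mul_le_mul (hN _ hmem) (hM _ ?_) (norm_nonneg _) ((norm_nonneg _).trans (hN _ hmem))
    rwa [abs_arg_ray (by linarith)]

lemma bdry_elementary (hω : ω ≤ π) (he : IsElementary ω e) (h0 : 0 ≤ δ) (h1 : δ < ω) :
    bdry δ e = 0 := by
  obtain ⟨N, hN⟩ := he.1.2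
  have hi := he.rayIntegrable h0 h1
  exact bdry_eq_zero h0 (fun θ hθ t => he.1.1.differentiableAt
      ((isOpen_sector (by linarith) hω).mem_nhds (ray_mem_sector (hθ.trans_lt h1) hω t)))
    (fun θ hθ t => hN _ (ray_mem_sector (hθ.trans_lt h1) hω t)) hi.1 hi.2

variable [CompleteSpace 𝔸]

omit [CompleteSpace 𝔸] in
lemma prim_add (hH : IsSectorialFamily H ω₀) (hω : ω ≤ π) (he₁ : IsElementary ω e₁)
    (he₂ : IsElementary ω e₂) (h1 : ω₀ < δ) (h2 : δ < ω) :
    prim H δ (fun z => e₁ z + e₂ z) = prim H δ e₁ + prim H δ e₂ := by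
  have h0 := hH.nonneg.trans h1.le
  simp only [prim, add_smul]
  exact bdry_add (hH.rayIntegrable_smul h1 (by linarith) (he₁.rayIntegrable h0 h2))
    (hH.rayIntegrable_smul h1 (by linarith) (he₂.rayIntegrable h0 h2))

omit [CompleteSpace 𝔸] in
lemma prim_mul_const (c : ℂ) : prim H δ (fun z => e z * c) = c • prim H δ e := by
  simp only [prim, mul_comm _ c, mul_smul]
  exact bdry_smul c

omit [CompleteSpace 𝔸] in
lemma prim_congr (hω : ω ≤ π) (h0 : 0 ≤ δ) (h1 : δ < ω) (h : ∀ z ∈ sector ω, e₁ z = e₂ z) :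
    prim H δ e₁ = prim H δ e₂ :=
  bdry_congr fun θ hθ t => by
    rw [h _ (ray_mem_sector (by rw [hθ, abs_of_nonneg h0]; exact h1) hω t)]

lemma clm_mul_prim (hH : IsSectorialFamily H ω₀) (hω : ω ≤ π) (he : IsElementary ω e)
    (h1 : ω₀ < δ) (h2 : δ < ω) (a : 𝔸) :
    a * prim H δ e = bdry δ fun z => e z • (a * H z) := by
  have h0 := hH.nonneg.trans h1.le
  have h3 := bdry_clm (hH.rayIntegrable_smul h1 (by linarith) (he.rayIntegrable h0 h2))
    (ContinuousLinearMap.mul ℂ 𝔸 a)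
  simp only [ContinuousLinearMap.mul_apply', mul_smul_comm] at h3
  exact h3.symm

lemma prim_mul_clm (hH : IsSectorialFamily H ω₀) (hω : ω ≤ π) (he : IsElementary ω e)
    (h1 : ω₀ < δ) (h2 : δ < ω) (a : 𝔸) :
    prim H δ e * a = bdry δ fun z => e z • (H z * a) := by
  have h0 := hH.nonneg.trans h1.le
  have h3 := bdry_clm (hH.rayIntegrable_smul h1 (by linarith) (he.rayIntegrable h0 h2))
    ((ContinuousLinearMap.mul ℂ 𝔸).flip a)
  simp only [ContinuousLinearMap.flip_apply, ContinuousLinearMap.mul_apply', smul_mul_assoc] at h3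
  exact h3.symm

omit [CompleteSpace 𝔸] in
lemma neg_one_notMem (hH : IsSectorialFamily H ω₀) : (-1 : ℂ) ∉ closedSector ω₀ := by
  simpa using neg_ofReal_notMem_closedSector hH.lt_pi one_pos

omit [CompleteSpace 𝔸] in
lemma neg_inv_notMem (hH : IsSectorialFamily H ω₀) {t : ℝ} (ht : 0 < t) :
    -(t : ℂ)⁻¹ ∉ closedSector ω₀ := by
  simpa using neg_ofReal_notMem_closedSector hH.lt_pi (inv_pos.mpr ht)

omit [CompleteSpace 𝔸] in
/-- The resolvent identity with the second point at `-1 / t`. -/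
lemma mul_neg_inv (hH : IsSectorialFamily H ω₀) {t : ℝ} (ht : 0 < t) {z : ℂ}
    (hz : z ∉ closedSector ω₀) :
    (1 + t * z) • (H z * H (-(t : ℂ)⁻¹)) = H z + (t * z) • H (-(t : ℂ)⁻¹) := by
  have ht' : (t : ℂ) ≠ 0 := by exact_mod_cast ht.ne'
  have h := congrArg (fun x => (-(t : ℂ)) • x) (hH.identity z _ hz (hH.neg_inv_notMem ht))
  simp only [smul_sub, smul_smul] at h
  rw [show -(t : ℂ) * (-(t : ℂ)⁻¹ - z) = 1 + t * z by field_simp; ring,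
    show -(t : ℂ) * -(t : ℂ)⁻¹ = 1 by field_simp] at h
  rw [h]; module

/-- Multiplication with the resolvent at `-1`. -/
lemma prim_mul_neg_one (hH : IsSectorialFamily H ω₀) (hω : ω < π) (he : IsElementary ω e)
    (h1 : ω₀ < δ) (h2 : δ < ω) :
    prim H δ e * H (-1) = prim H δ fun z => e z * (1 + z)⁻¹ := by
  have h0 := hH.nonneg.trans h1.le
  have hω0 := h0.trans h2.le
  have hb1 := IsHInfty.inv_one_add hω0 hω zero_le_one
  have hb2 := IsHInfty.id_div_one_add hω0 hω one_pos
  simp only [Complex.ofReal_one, one_mul] at hb1 hb2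
  have he1 := he.mul_bounded hω.le hb1
  have he2 := he.mul_bounded hω.le hb2
  have hr1 := hH.rayIntegrable_smul h1 (by linarith) (he1.rayIntegrable h0 h2)
  have hr2 := (he2.rayIntegrable h0 h2).smul_const (H (-1))
  rw [hH.prim_mul_clm hω.le he h1 h2]
  have h3 : bdry δ (fun z => e z • (H z * H (-1))) =
      bdry δ fun z => (e z * (1 + z)⁻¹) • H z + (e z * (z / (1 + z))) • H (-1) := by
    refine bdry_congr fun θ hθ t => ?_
    rw [abs_of_nonneg h0] at hθ
    have hz := ray_notMem_closedSector (θ := θ) (by rwa [hθ]) (by rw [hθ]; linarith) t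
    have hzs := ray_mem_sector (θ := θ) (by rwa [hθ]) hω.le t
    have hne := one_add_mul_ne_zero hω.le hzs zero_le_one
    have h4 := hH.mul_neg_inv one_pos hz
    simp only [Complex.ofReal_one, one_mul, inv_one] at h4 hne
    rw [← eq_inv_smul_iff₀ hne] at h4
    rw [h4, smul_add, smul_add, smul_smul, smul_smul, smul_smul]
    congr 2
    rw [div_eq_inv_mul]; ring
  rw [h3, bdry_add hr1 hr2, bdry_smul_const (he2.rayIntegrable h0 h2),
    bdry_elementary hω.le he2 h0 h2, zero_smul, add_zero]
  rfl

lemma prim_commute (hH : IsSectorialFamily H ω₀) (hω : ω ≤ π) (he : IsElementary ω e)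
    (h1 : ω₀ < δ) (h2 : δ < ω) {w : ℂ} (hw : w ∉ closedSector ω₀) :
    H w * prim H δ e = prim H δ e * H w := by
  rw [hH.clm_mul_prim hω he h1 h2, hH.prim_mul_clm hω he h1 h2]
  refine bdry_congr fun θ hθ t => ?_
  rw [abs_of_nonneg (hH.nonneg.trans h1.le)] at hθ
  rw [hH.commute hw (ray_notMem_closedSector (by rwa [hθ]) (by rw [hθ]; linarith) t)]

/-- The value of the primary calculus at the basic elementary function: in operator terms it is
`A (1 + A)⁻¹ (1 + t A)⁻¹`. The proof picks up the residue at `-1`. -/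
lemma prim_basic (hH : IsSectorialFamily H ω₀) (hω : ω < π) (h1 : ω₀ < δ) (h2 : δ < ω) {t : ℝ}
    (ht : 0 < t) : prim H δ (fun z => z / (1 + z) * (1 + t * z)⁻¹) =
      H (-(t : ℂ)⁻¹) - H (-1) * H (-(t : ℂ)⁻¹) := by
  have h0 := hH.nonneg.trans h1.le
  have hω0 := h0.trans h2.le
  have hb := IsElementary.basic hω0 hω ht
  set P := H (-(t : ℂ)⁻¹)
  have ht' : (t : ℂ) ≠ 0 := by exact_mod_cast ht.ne'
  have hi := hH.rayIntegrable_smul h1 (by linarith) (hb.rayIntegrable h0 h2)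
  have hi2 := (hb.rayIntegrable h0 h2).smul_const P
  have hz : ∀ θ, |θ| = |δ| → ∀ s, ray θ s ∉ closedSector ω₀ := fun θ hθ s => by
    rw [abs_of_nonneg h0] at hθ
    exact ray_notMem_closedSector (by rwa [hθ]) (by rw [hθ]; linarith) s
  have hs : ∀ θ, |θ| = |δ| → ∀ s, ray θ s ∈ sector ω := fun θ hθ s => by
    rw [abs_of_nonneg h0] at hθ
    exact ray_mem_sector (by rwa [hθ]) hω.le s
  have heq : ∀ θ, |θ| = |δ| → ∀ s, (ray θ s / (1 + ray θ s) * (1 + t * ray θ s)⁻¹) • H (ray θ s) -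
      (ray θ s / (1 + ray θ s) * (1 + t * ray θ s)⁻¹) • P =
      (ray θ s / (ray θ s + 1)) • (H (ray θ s) * P - P) := by
    intro θ hθ s
    have hne := one_add_mul_ne_zero hω.le (hs θ hθ s) ht.le
    have h4 : (1 + t * ray θ s) • (H (ray θ s) * P) = H (ray θ s) + (t * ray θ s) • P :=
      hH.mul_neg_inv ht (hz θ hθ s)
    rw [← eq_inv_smul_iff₀ hne] at h4
    rw [← smul_sub, mul_smul, add_comm 1 (ray θ s)]
    congr 1
    rw [h4]
    have h5 : P = (1 + t * ray θ s)⁻¹ • ((1 + t * ray θ s) • P) := by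
      rw [smul_smul, inv_mul_cancel₀ hne, one_smul]
    nth_rewrite 3 [h5]
    rw [← smul_sub]
    congr 1
    rw [add_smul, one_smul]
    abel
  obtain ⟨M, hM0, hM⟩ := hH.exists_bound h1
  have hcl : ∀ z : ℂ, δ ≤ |z.arg| → z ∉ closedSector ω₀ := fun z hz =>
    not_le.mpr (h1.trans_le hz)
  have h3 := bdry_cauchy_outer (G := fun z => H z * P - P) (δ := δ) (M := M * ‖P‖ + ‖P‖)
    (hH.nonneg.trans_lt h1) (by linarith)
    (fun z _ hz => ((hH.differentiableAt (hcl z hz)).mul_const P).sub_const P)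
    (fun z _ hz => (norm_sub_le _ _).trans (add_le_add ((norm_mul_le _ _).trans
      (mul_le_mul_of_nonneg_right (hM z hz) (norm_nonneg _))) le_rfl))
    ((hi.sub hi2).congr heq)
  have h4 := bdry_sub hi hi2
  rw [bdry_congr (k := fun z => (z / (z + 1)) • (H z * P - P)) heq, h3,
    bdry_smul_const (hb.rayIntegrable h0 h2),
    bdry_elementary hω.le hb h0 h2, zero_smul, sub_zero] at h4
  rw [prim, ← h4]
  abel

end IsSectorialFamily

/-! ### Multiplicativity of the primary calculus -/

section Swap

variable {E : Type*} [NormedAddCommGroup E] [NormedSpace ℂ E]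

/-- Fubini's theorem for boundary integrals. -/
lemma bdry_swap [CompleteSpace E] {δ δ' : ℝ} (h0 : 0 ≤ δ) (h0' : 0 ≤ δ') {f : ℂ → ℂ → E}
    (hf : ∀ θ θ', |θ| = δ → |θ'| = δ' →
      Integrable (fun p : ℝ × ℝ => f (ray θ p.1) (ray θ' p.2))) :
    bdry δ (fun z => bdry δ' fun w => f z w) = bdry δ' fun w => bdry δ fun z => f z w := by
  have hswap : ∀ θ θ', |θ| = δ → |θ'| = δ' →
      ∫ t, ∫ s, f (ray θ t) (ray θ' s) = ∫ s, ∫ t, f (ray θ t) (ray θ' s) :=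
    fun θ θ' h1 h2 => integral_integral_swap (hf θ θ' h1 h2)
  have hl : ∀ θ θ', |θ| = δ → |θ'| = δ' → Integrable fun t => ∫ s, f (ray θ t) (ray θ' s) :=
    fun θ θ' h1 h2 => (hf θ θ' h1 h2).integral_prod_left
  have hr : ∀ θ θ', |θ| = δ → |θ'| = δ' → Integrable fun s => ∫ t, f (ray θ t) (ray θ' s) :=
    fun θ θ' h1 h2 => (hf θ θ' h1 h2).integral_prod_right
  have a1 : |δ| = δ := abs_of_nonneg h0
  have a2 : |-δ| = δ := by rw [abs_neg, a1]
  have b1 : |δ'| = δ' := abs_of_nonneg h0'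
  have b2 : |-δ'| = δ' := by rw [abs_neg, b1]
  simp only [bdry]
  rw [integral_smul, integral_smul, integral_smul, integral_smul,
    integral_sub (hl _ _ a2 b2) (hl _ _ a2 b1), integral_sub (hl _ _ a1 b2) (hl _ _ a1 b1),
    integral_sub (hr _ _ a2 b2) (hr _ _ a1 b2), integral_sub (hr _ _ a2 b1) (hr _ _ a1 b1),
    hswap _ _ a2 b2, hswap _ _ a2 b1, hswap _ _ a1 b2, hswap _ _ a1 b1]
  module

end Swap

lemma ray_sub_ray_ne_zero {θ θ' : ℝ} (h1 : |θ| < |θ'|) (h2 : |θ'| < π) (t s : ℝ) :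
    ray θ' s - ray θ t ≠ 0 := by
  intro h
  have h3 := congrArg (fun z : ℂ => |z.arg|) (sub_eq_zero.mp h)
  simp only [abs_arg_ray h2.le, abs_arg_ray (h1.trans h2).le] at h3
  linarith

namespace IsSectorialFamily

variable {𝔸 : Type*} [NormedRing 𝔸] [NormedAlgebra ℂ 𝔸] {H : ℂ → 𝔸} {ω₀ : ℝ} [CompleteSpace 𝔸]
  {ω δ : ℝ} {e₁ e₂ : ℂ → ℂ}

/-- `∫ e₁(z) / (w - z) dz` vanishes for `w` outside the contour. -/
lemma bdry_kernel_outside (hω : ω < π) (he : IsElementary ω e₁) (h0 : 0 ≤ δ) (h2 : δ < ω)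
    {w : ℂ} (hw : δ < |w.arg|) : bdry δ (fun z => e₁ z * (z / (w - z))) = 0 := by
  have hw0 : w ≠ 0 := by rintro rfl; simp at hw; linarith
  obtain ⟨ω', h3, h4⟩ := exists_between (lt_min h2 hw)
  have h5 := h4.trans_le (min_le_left _ _)
  have h6 := h4.trans_le (min_le_right _ _)
  -- the sector of half-angle `ω'` contains the contour and stays away from `w`
  obtain ⟨c, hc, hcw⟩ : ∃ c > 0, ∀ z ∈ sector ω', c * (‖z‖ + ‖w‖) ≤ ‖w - z‖ := by
    have hwπ := Complex.abs_arg_le_pi w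
    have h7 : Real.cos |w.arg| < Real.cos ω' :=
      Real.strictAntiOn_cos ⟨by linarith, by linarith⟩ ⟨abs_nonneg _, hwπ⟩ h6
    have h8 : Real.cos (|w.arg| - ω') < 1 := by
      refine lt_of_le_of_ne (Real.cos_le_one _) fun h => ?_
      have := (Real.cos_eq_one_iff_of_lt_of_lt (by linarith [pi_pos]) (by linarith [pi_pos])).mp h
      linarith
    refine ⟨√((1 - Real.cos (|w.arg| - ω')) / 2), Real.sqrt_pos.mpr (by linarith),
      fun z hz => ?_⟩
    apply le_of_sq_le_sq _ (norm_nonneg _)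
    rw [mul_pow, Real.sq_sqrt (by linarith)]
    have e1 : z = ray z.arg (Real.log ‖z‖) := (ray_arg_log hz.1).symm
    have e2 : w = ray w.arg (Real.log ‖w‖) := (ray_arg_log hw0).symm
    have hz0 : 0 < ‖z‖ := norm_pos_iff.mpr hz.1
    have hw0' : 0 < ‖w‖ := norm_pos_iff.mpr hw0
    have h9 := norm_ray_sub_ray_ge w.arg z.arg (Real.log ‖w‖) (Real.log ‖z‖)
    rw [← e1, ← e2, Real.exp_log hz0, Real.exp_log hw0'] at h9
    have h10 := pow_le_pow_left₀ (by positivity) h9 2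
    rw [mul_pow, sq_abs, Real.sin_sq_eq_half_sub,
      show 2 * ((w.arg - z.arg) / 2) = w.arg - z.arg by ring] at h10
    have h11 : Real.cos (w.arg - z.arg) ≤ Real.cos (|w.arg| - ω') := by
      rw [← Real.cos_abs (w.arg - z.arg)]
      have hzz : |z.arg| < ω' := hz.2
      have h12 : |w.arg| - ω' ≤ |w.arg - z.arg| := by
        linarith [abs_sub_abs_le_abs_sub w.arg z.arg]
      rcases le_or_gt |w.arg - z.arg| π with h13 | h13
      · exact Real.cos_le_cos_of_nonneg_of_le_pi (by linarith) h13 h12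
      · rw [← Real.cos_two_pi_sub]
        refine Real.cos_le_cos_of_nonneg_of_le_pi (by linarith) ?_ ?_
        · have := abs_sub w.arg z.arg
          linarith
        · have := abs_sub w.arg z.arg
          linarith
    calc _ ≤ (1 / 2 - Real.cos (w.arg - z.arg) / 2) * (‖w‖ + ‖z‖) ^ 2 := by
          rw [add_comm ‖z‖]
          refine mul_le_mul_of_nonneg_right (by linarith) (sq_nonneg _)
      _ ≤ _ := h10
  have hne : ∀ z ∈ sector ω', w - z ≠ 0 := fun z hz => norm_pos_iff.mp
    (lt_of_lt_of_le (by have := norm_pos_iff.mpr hz.1; positivity) (hcw z hz))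
  have hb : IsHInfty ω' fun z => z / (w - z) := by
    refine ⟨fun z hz => ?_, c⁻¹, fun z hz => ?_⟩
    · exact (differentiableAt_id.div (by fun_prop) (hne z hz)).differentiableWithinAt
    · rw [norm_div, div_le_iff₀ (norm_pos_iff.mpr (hne z hz)), le_inv_mul_iff₀ hc]
      exact (mul_le_mul_of_nonneg_left (by linarith [norm_nonneg w]) hc.le).trans (hcw z hz)
  exact bdry_elementary (h5.le.trans hω.le) ((he.mono h5.le).mul_bounded (h5.le.trans hω.le) hb)
    h0 h3

/-- **Multiplicativity** of the primary calculus, from the resolvent identity, Fubini's theorem and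
Cauchy's integral formula, with the second factor represented on a larger contour. -/
theorem prim_mul (hH : IsSectorialFamily H ω₀) (hω : ω < π) (he₁ : IsElementary ω e₁)
    (he₂ : IsElementary ω e₂) (h1 : ω₀ < δ) (h2 : δ < ω) :
    prim H δ e₁ * prim H δ e₂ = prim H δ fun z => e₁ z * e₂ z := by
  obtain ⟨δ', h3, h4⟩ := exists_between h2
  have h0 := hH.nonneg.trans h1.le
  have h0' : 0 ≤ δ' := h0.trans h3.le
  have h1' := h1.trans h3
  have hδπ : δ < π := h2.trans hω
  have hδπ' : δ' < π := h4.trans hω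
  have he₁₂ : IsElementary ω fun z => e₁ z * e₂ z := he₁.mul_bounded hω.le he₂.1
  obtain ⟨M, hM0, hM⟩ := hH.exists_bound h1'
  have habs : ∀ {d θ : ℝ}, 0 ≤ d → |θ| = |d| → |θ| = d := fun hd h => by
    rwa [abs_of_nonneg hd] at h
  have hz : ∀ θ, |θ| = δ → ∀ t, ray θ t ∉ closedSector ω₀ := fun θ hθ =>
    ray_notMem_closedSector (by rwa [hθ]) (by rw [hθ]; exact hδπ.le)
  have hw : ∀ θ, |θ| = δ' → ∀ t, ray θ t ∉ closedSector ω₀ := fun θ hθ =>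
    ray_notMem_closedSector (by rwa [hθ]) (by rw [hθ]; exact hδπ'.le)
  have hne : ∀ θ θ', |θ| = δ → |θ'| = δ' → ∀ t s, ray θ' s - ray θ t ≠ 0 := fun θ θ' hθ hθ' =>
    ray_sub_ray_ne_zero (by rw [hθ, hθ']; exact h3) (by rw [hθ']; exact hδπ')
  have hc : ∀ θ θ', |θ| = δ → |θ'| = δ' → 0 < |Real.sin ((θ' - θ) / 2)| := by
    intro θ θ' hθ hθ'
    refine abs_sin_half_pos (fun h => ?_) ?_
    · rw [sub_eq_zero.mp h] at hθ'
      linarith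
    · have := abs_sub θ' θ
      linarith
  have hker : ∀ θ θ', |θ| = δ → |θ'| = δ' → ∀ t s,
      ‖ray θ t / (ray θ' s - ray θ t)‖ ≤ |Real.sin ((θ' - θ) / 2)|⁻¹ := by
    intro θ θ' hθ hθ' t s
    have h5 := norm_ray_sub_ray_ge θ' θ s t
    have h6 := hc θ θ' hθ hθ'
    rw [norm_div, norm_ray, div_le_iff₀ (norm_pos_iff.mpr (hne θ θ' hθ hθ' t s)),
      le_inv_mul_iff₀ h6]
    exact (mul_le_mul_of_nonneg_left (by linarith [Real.exp_pos s]) h6.le).trans h5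
  have hrc : ∀ θ θ', |θ| = δ → |θ'| = δ' →
      Continuous fun p : ℝ × ℝ => ray θ p.1 / (ray θ' p.2 - ray θ p.1) := fun θ θ' hθ hθ' =>
    ((continuous_ray θ).comp continuous_fst).div
      (((continuous_ray θ').comp continuous_snd).sub ((continuous_ray θ).comp continuous_fst))
      fun p => hne θ θ' hθ hθ' _ _
  have hHc : ∀ θ, |θ| = δ' → Continuous fun t => H (ray θ t) := fun θ hθ =>
    hH.continuous_comp_ray (by rwa [hθ]) (by rw [hθ]; exact hδπ'.le)
  have hHb : ∀ θ, |θ| = δ' → ∀ t, ‖H (ray θ t)‖ ≤ M := fun θ hθ t => hM _ (by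
    rw [abs_arg_ray (by rw [hθ]; exact hδπ'.le), hθ])
  -- the remainder term in the resolvent identity
  let f : ℂ → ℂ → 𝔸 := fun z w => (e₁ z * (z / (w - z))) • (e₂ w • H w)
  have hf : ∀ θ θ', |θ| = δ → |θ'| = δ' →
      Integrable (fun p : ℝ × ℝ => f (ray θ p.1) (ray θ' p.2)) := by
    intro θ θ' hθ hθ'
    have hi := (he₁.integrable (θ := θ) (by rwa [hθ])).mul_prod
      (he₂.integrable (θ := θ') (by rwa [hθ']))
    have hi2 := (hi.mul_bdd (hrc θ θ' hθ hθ').aestronglyMeasurable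
      (Eventually.of_forall fun p => hker θ θ' hθ hθ' p.1 p.2)).smul_bdd M
      ((hHc θ' hθ').comp continuous_snd).aestronglyMeasurable
      (Eventually.of_forall fun p => hHb θ' hθ' p.2)
    refine hi2.congr (Eventually.of_forall fun p => ?_)
    simp only [f, smul_smul]
    change (e₁ (ray θ p.1) * e₂ (ray θ' p.2) * (ray θ p.1 / (ray θ' p.2 - ray θ p.1))) •
      H (ray θ' p.2) = _
    congr 1
    ring
  have hfzero : bdry δ (fun z => bdry δ' fun w => f z w) = 0 := by
    rw [bdry_swap h0 h0' hf]
    have h5 : bdry δ' (fun w => bdry δ fun z => f z w) = bdry δ' fun _ => (0 : 𝔸) := by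
      refine bdry_congr fun θ hθ s => ?_
      have hθ' := habs h0' hθ
      have hr : RayIntegrable δ fun z => e₁ z * (z / (ray θ s - z)) :=
        RayIntegrable.intro h0 fun θ₁ hθ₁ =>
          (he₁.integrable (by rwa [hθ₁])).mul_bdd
            (((hrc θ₁ θ hθ₁ hθ').comp (.prodMk_left s)).aestronglyMeasurable)
            (Eventually.of_forall fun t => hker θ₁ θ hθ₁ hθ' t s)
      rw [bdry_smul_const hr, bdry_kernel_outside hω he₁ h0 h2, zero_smul]
      rw [abs_arg_ray (by rw [hθ']; exact hδπ'.le), hθ']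
      exact h3
    rw [h5]
    simp [bdry]
  rw [hH.prim_eq_prim hω.le he₂ h1 h3.le h4, hH.prim_mul_clm hω.le he₁ h1 h2]
  have hi₁ := hH.rayIntegrable_smul h1 hδπ (he₁₂.rayIntegrable h0 h2)
  have hi₂ : RayIntegrable δ fun z => bdry δ' fun w => f z w :=
    RayIntegrable.intro h0 fun θ hθ => by
      have a1 := (hf θ (-δ') hθ (by rw [abs_neg, abs_of_nonneg h0'])).integral_prod_left
      have a2 := (hf θ δ' hθ (abs_of_nonneg h0')).integral_prod_left
      exact (a1.sub a2).smul (2 * (π : ℂ) * Complex.I)⁻¹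
  -- the resolvent identity splits the double integral; Cauchy's formula evaluates the main term
  have hkey : bdry δ (fun z => e₁ z • (H z * prim H δ' e₂)) =
      bdry δ fun z => (e₁ z * e₂ z) • H z - bdry δ' fun w => f z w := by
    refine bdry_congr fun θ hθ t => ?_
    have hθ := habs h0 hθ
    set z := ray θ t
    have hzs : z ∈ sector δ' := ray_mem_sector (by rwa [hθ]) hδπ'.le t
    have hir : ∀ θ', |θ'| = δ' → Integrable fun s =>
        (ray θ' s / (ray θ' s - z)) • e₂ (ray θ' s) := by
      intro θ' hθ'
      have h6 := (he₂.integrable (θ := θ') (by rwa [hθ'])).mul_bdd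
        (((hrc θ θ' hθ hθ').comp (.prodMk_right t)).aestronglyMeasurable)
        (Eventually.of_forall fun s => hker θ θ' hθ hθ' t s)
      refine ((he₂.integrable (θ := θ') (by rwa [hθ'])).add h6).congr
        (Eventually.of_forall fun s => ?_)
      have := hne θ θ' hθ hθ' t s
      simp only [Pi.add_apply, Function.comp, smul_eq_mul]
      change _ + _ * (z / (ray θ' s - z)) = _
      rw [show ray θ t = z from rfl] at this
      field_simp
      ring
    have hI1 : RayIntegrable δ' fun w => (w / (w - z)) • e₂ w :=
      RayIntegrable.intro h0' hir
    have hI2 : RayIntegrable δ' fun w => (z / (w - z) * e₂ w) • H w := by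
      refine hH.rayIntegrable_smul h1' hδπ' (RayIntegrable.intro h0' fun θ' hθ' => ?_)
      exact (he₂.integrable (θ := θ') (by rwa [hθ'])).bdd_mul
        (((hrc θ θ' hθ hθ').comp (.prodMk_right t)).aestronglyMeasurable)
        (Eventually.of_forall fun s => hker θ θ' hθ hθ' t s)
    obtain ⟨N, hN⟩ := he₂.1.2
    have hcf := bdry_cauchy (G := e₂) (δ := δ') (M := N) (by linarith [hH.nonneg]) hδπ'
      (fun x hx hx' => he₂.1.1.differentiableAt
        ((isOpen_sector (by linarith) hω.le).mem_nhds ⟨hx, hx'.trans_lt h4⟩))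
      (fun x hx hx' => hN x ⟨hx, hx'.trans_lt h4⟩) hzs hI1
    have h7 : H z * prim H δ' e₂ = e₂ z • H z - bdry δ' fun w => (z / (w - z) * e₂ w) • H w := by
      rw [hH.clm_mul_prim hω.le he₂ h1' h4, ← hcf, ← bdry_smul_const hI1,
        ← bdry_sub (hI1.smul_const (H z)) hI2]
      refine bdry_congr fun θ' hθ' s => ?_
      have hθ' := habs h0' hθ'
      have h8 := hne θ θ' hθ hθ' t s
      have h9 := hH.identity z (ray θ' s) (hz θ hθ t) (hw θ' hθ' s)
      rw [← eq_inv_smul_iff₀ h8] at h9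
      change _ = ((ray θ' s / (ray θ' s - z)) * e₂ (ray θ' s)) • H z - _
      rw [h9, smul_sub, smul_sub]
      simp only [smul_smul]
      congr 2 <;> · rw [div_eq_inv_mul]; ring
    rw [h7, smul_sub, smul_smul, ← bdry_smul]
    congr 2
    ext w
    simp only [f, smul_smul]
    congr 1
    ring
  rw [hkey, bdry_sub hi₁ hi₂, hfzero, sub_zero]
  rfl

end IsSectorialFamily

/-! ### The calculus on the extended elementary functions -/

section ExtCalculus

variable {X : Type*} [NormedAddCommGroup X] [NormedSpace ℂ X]

/-- The operators `z R(z, A)`. -/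
noncomputable def opH (A : X →ₗ.[ℂ] X) (z : ℂ) : X →L[ℂ] X := z • opResolvent A z

section Sectorial

variable {A : X →ₗ.[ℂ] X}

lemma isSectorialOfAngle_sectAngle (hA : IsSectorial A) : IsSectorialOfAngle A (sectAngle A) := by
  obtain ⟨ω₁, h₁⟩ := hA.2
  have hbdd : BddBelow {ω | IsSectorialOfAngle A ω} := ⟨0, fun ω h => h.1⟩
  have hne : {ω | IsSectorialOfAngle A ω}.Nonempty := ⟨ω₁, h₁⟩
  have hlt : ∀ ω, sectAngle A < ω → ∃ ω', IsSectorialOfAngle A ω' ∧ ω' < ω := fun ω hω => by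
    obtain ⟨ω', h, h'⟩ := exists_lt_of_csInf_lt hne hω
    exact ⟨ω', h, h'⟩
  refine ⟨le_csInf hne fun ω h => h.1, (csInf_le hbdd h₁).trans_lt h₁.2.1, fun z hz => ?_,
    fun ω hω hω' => ?_⟩
  · change |z.arg| ≤ sectAngle A
    by_contra hcon
    obtain ⟨ω', h, h'⟩ := hlt _ (not_le.mp hcon)
    exact absurd (h.2.2.1 hz) (not_le.mpr h')
  · obtain ⟨ω', h, h'⟩ := hlt _ hω
    exact h.2.2.2 ω h' hω'

lemma isResolventAt_opResolvent {z : ℂ} (hz : z ∉ opSpectrum A) :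
    IsResolventAt A z (opResolvent A z) := by
  have h : ∃ R, IsResolventAt A z R := not_not.mp hz
  rw [opResolvent, dif_pos h]
  exact h.choose_spec

/-- The resolvent identity. -/
lemma opResolvent_sub {z w : ℂ} (hz : z ∉ opSpectrum A) (hw : w ∉ opSpectrum A) :
    opResolvent A z - opResolvent A w = (w - z) • (opResolvent A z * opResolvent A w) := by
  ext x
  obtain ⟨h, hx⟩ := (isResolventAt_opResolvent hw).1 x
  have h2 := (isResolventAt_opResolvent hz).2 ⟨opResolvent A w x, h⟩
  simp only at h2
  have h3 : z • opResolvent A w x - A ⟨opResolvent A w x, h⟩ =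
      x + (z - w) • opResolvent A w x := by
    rw [eq_sub_iff_add_eq'.mpr (sub_eq_iff_eq_add.mp hx).symm]
    module
  rw [h3, map_add, map_smul] at h2
  change opResolvent A z x - opResolvent A w x =
    (w - z) • opResolvent A z (opResolvent A w x)
  rw [sub_eq_iff_eq_add]
  calc opResolvent A z x = opResolvent A z x + (z - w) • opResolvent A z (opResolvent A w x) +
        (w - z) • opResolvent A z (opResolvent A w x) := by module
    _ = _ := by rw [h2]; abel

lemma opResolvent_injective {z : ℂ} (hz : z ∉ opSpectrum A) {x : X} (hx : opResolvent A z x = 0) :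
    x = 0 := by
  obtain ⟨h, hx'⟩ := (isResolventAt_opResolvent hz).1 x
  rw [← hx']
  have : (⟨opResolvent A z x, h⟩ : A.domain) = 0 := Subtype.ext hx
  rw [this, hx, smul_zero, LinearPMap.map_zero, sub_zero]

lemma isSectorialFamily_opH (hA : IsSectorial A) : IsSectorialFamily (opH A) (sectAngle A) where
  nonneg := (isSectorialOfAngle_sectAngle hA).1
  lt_pi := (isSectorialOfAngle_sectAngle hA).2.1
  identity z w hz hw := by
    have h := (isSectorialOfAngle_sectAngle hA).2.2.1
    have h1 := opResolvent_sub (fun h' => hz (h h')) (fun h' => hw (h h'))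
    simp only [opH, smul_mul_smul_comm, smul_smul]
    rw [mul_comm w z, ← smul_sub, h1, smul_smul]
    congr 1
    ring
  bound := (isSectorialOfAngle_sectAngle hA).2.2.2

lemma opH_injective (hA : IsSectorial A) {z : ℂ} (hz : z ∉ closedSector (sectAngle A)) {x : X}
    (hx : opH A z x = 0) : x = 0 := by
  have hz0 := ne_zero_of_notMem_closedSector (isSectorialFamily_opH hA).nonneg hz
  refine opResolvent_injective (z := z)
    (fun h => hz ((isSectorialOfAngle_sectAngle hA).2.2.1 h)) ?_
  exact (smul_eq_zero.mp hx).resolve_left hz0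

lemma cauchyIntegral_eq_prim (A : X →ₗ.[ℂ] X) (δ : ℝ) (f : ℂ → ℂ) :
    cauchyIntegral A δ f = prim (opH A) δ f := by
  have h : ∀ θ, rayIntegral A θ f = ∫ t, f (ray θ t) • opH A (ray θ t) := by
    intro θ
    rw [rayIntegral, setIntegral_Ioi_eq]
    refine integral_congr_ae (Eventually.of_forall fun t => ?_)
    simp only [ray_eq_mul, opH, smul_smul]
    rw [← Complex.coe_smul (Real.exp t), smul_smul]
    congr 1
    ring
  rw [cauchyIntegral, h, h, prim, bdry]

end Sectorial

lemma eq_zero_of_integrable_of_tendsto {f : ℝ → ℂ} (hf : Integrable f) {a : ℂ}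
    (h : Tendsto f atTop (𝓝 a)) : a = 0 := by
  by_contra ha
  have h1 : ∀ᶠ t in atTop, ‖a‖ / 2 < ‖f t‖ :=
    h.norm.eventually_const_lt (by have := norm_pos_iff.mpr ha; linarith)
  obtain ⟨N, hN⟩ := eventually_atTop.mp h1
  have h2 : IntegrableOn (fun _ : ℝ => ‖a‖ / 2) (Ici N) :=
    Integrable.mono' hf.norm.integrableOn aestronglyMeasurable_const
      ((ae_restrict_iff' measurableSet_Ici).mpr (Eventually.of_forall fun t ht => by
        rw [Real.norm_of_nonneg (by positivity)]; exact (hN t ht).le))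
  rw [integrableOn_const_iff] at h2
  simp [ha] at h2

/-- The sum `E(S_ω) + ℂ 1 + ℂ (1 + z)⁻¹` is direct: an elementary function that has limits at `0`
and at `∞` along the positive half-line tends to `0` there. -/
lemma IsExtDecomp.unique {ω : ℝ} (h0 : 0 < ω) {f f' e e' : ℂ → ℂ} {c c' d d' : ℂ}
    (h : IsExtDecomp ω f e c d) (h' : IsExtDecomp ω f' e' c' d')
    (hf : ∀ z ∈ sector ω, f z = f' z) :
    (∀ z ∈ sector ω, e z = e' z) ∧ c = c' ∧ d = d' := by
  have heq : ∀ z ∈ sector ω, e z - e' z = (c' - c) + (d' - d) / (1 + z) := fun z hz => by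
    have h1 := h.2 z hz
    rw [hf z hz, h'.2 z hz] at h1
    rw [sub_div]
    linear_combination -h1
  have habs : |(0 : ℝ)| < ω := by simpa using h0
  have hray : ∀ t, ray 0 t = ((Real.exp t : ℝ) : ℂ) := fun t => by simp [ray]
  have hint := ((h.1.integrable habs).sub (h'.1.integrable habs)).congr
    (Eventually.of_forall fun t => heq (ray 0 t) (by
      rw [hray]; exact ofReal_mem_sector h0 (Real.exp_pos t)))
  simp only [hray] at hint
  have hlim : ∀ {l : Filter ℝ} {x : ℂ}, Tendsto (fun t : ℝ => (1 + (Real.exp t : ℝ) : ℂ)⁻¹) l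
      (𝓝 x) → Tendsto (fun t : ℝ => (c' - c) + (d' - d) / (1 + ((Real.exp t : ℝ) : ℂ))) l
        (𝓝 ((c' - c) + (d' - d) * x)) := fun hx => by
    simpa only [div_eq_mul_inv] using (hx.const_mul (d' - d)).const_add (c' - c)
  have htop : Tendsto (fun t : ℝ => (1 + (Real.exp t : ℝ) : ℂ)⁻¹) atTop (𝓝 0) := by
    have h1 : Tendsto (fun t : ℝ => (1 + Real.exp t)⁻¹) atTop (𝓝 0) :=
      tendsto_inv_atTop_zero.comp (tendsto_atTop_add_const_left _ _ Real.tendsto_exp_atTop)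
    have h2 := (Complex.continuous_ofReal.tendsto 0).comp h1
    simpa [Function.comp_def] using h2
  have hbot : Tendsto (fun t : ℝ => (1 + (Real.exp t : ℝ) : ℂ)⁻¹) atBot (𝓝 1) := by
    have h1 : Tendsto (fun t : ℝ => (1 + Real.exp t)⁻¹) atBot (𝓝 (1 + 0)⁻¹) :=
      (Real.tendsto_exp_atBot.const_add 1).inv₀ (by norm_num)
    have h2 := (Complex.continuous_ofReal.tendsto _).comp h1
    simpa [Function.comp_def] using h2
  have hc := eq_zero_of_integrable_of_tendsto hint (hlim htop)
  have hd := eq_zero_of_integrable_of_tendsto hint.comp_neg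
    ((hlim hbot).comp tendsto_neg_atTop_atBot)
  have hc' : c = c' := by linear_combination -hc
  have hd' : d = d' := by linear_combination hc - hd
  subst hc' hd'
  exact ⟨fun z hz => by simpa [sub_eq_zero] using heq z hz, rfl, rfl⟩

namespace ExtValue

variable {A : X →ₗ.[ℂ] X} {ω : ℝ} {f g e : ℂ → ℂ} {S T : X →L[ℂ] X}

lemma iff_prim : ExtValue A ω f T ↔ ∃ e c d, IsExtDecomp ω f e c d ∧
    T = prim (opH A) ((sectAngle A + ω) / 2) e + c • 1 + d • opH A (-1) := by
  simp only [ExtValue, cauchyIntegral_eq_prim, opH, neg_smul, one_smul]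
  rfl

lemma isExtElementary (h : ExtValue A ω f T) : IsExtElementary ω f := by
  obtain ⟨e, c, d, h, -⟩ := h
  exact ⟨e, c, d, h⟩

lemma _root_.SectorialCalculus.IsExtElementary.exists_value (A : X →ₗ.[ℂ] X)
    (h : IsExtElementary ω f) : ∃ T, ExtValue A ω f T := by
  obtain ⟨e, c, d, h⟩ := h
  exact ⟨_, e, c, d, h, rfl⟩

variable (hA : IsSectorial A) (h1 : sectAngle A < ω) (h2 : ω < π)

lemma congr (h : ExtValue A ω f T) (hfg : ∀ z ∈ sector ω, g z = f z) : ExtValue A ω g T := by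
  obtain ⟨e, c, d, h, hT⟩ := h
  exact ⟨e, c, d, ⟨h.1, fun z hz => (hfg z hz).trans (h.2 z hz)⟩, hT⟩

lemma const (c : ℂ) : ExtValue A ω (fun _ => c) (c • 1) := by
  refine iff_prim.mpr ⟨fun _ => 0, c, 0, ⟨IsElementary.zero, fun z _ => by simp⟩, ?_⟩
  simp [prim, bdry]

lemma inv_one_add : ExtValue A ω (fun z => (1 + z)⁻¹) (opH A (-1)) := by
  refine iff_prim.mpr ⟨fun _ => 0, 0, 1, ⟨IsElementary.zero, fun z _ => by simp⟩, ?_⟩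
  simp [prim, bdry]

include hA h1 h2

lemma unique (hS : ExtValue A ω f S) (hT : ExtValue A ω g T) (hfg : ∀ z ∈ sector ω, f z = g z) :
    S = T := by
  obtain ⟨e, c, d, h, rfl⟩ := iff_prim.mp hS
  obtain ⟨e', c', d', h', rfl⟩ := iff_prim.mp hT
  have h0 := (isSectorialFamily_opH hA).nonneg
  obtain ⟨he, rfl, rfl⟩ := h.unique (h0.trans_lt h1) h' hfg
  rw [IsSectorialFamily.prim_congr h2.le (by linarith) (by linarith) he]

variable [CompleteSpace X]

omit [CompleteSpace X] h1 in
lemma of_elementary (he : IsElementary ω e) {δ : ℝ} (h3 : sectAngle A < δ) (h4 : δ < ω) :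
    ExtValue A ω e (prim (opH A) δ e) := by
  refine iff_prim.mpr ⟨e, 0, 0, ⟨he, fun z _ => by simp⟩, ?_⟩
  rw [zero_smul, zero_smul, add_zero, add_zero]
  rcases le_total δ ((sectAngle A + ω) / 2) with h | h
  · exact (isSectorialFamily_opH hA).prim_eq_prim h2.le he h3 h (by linarith)
  · exact ((isSectorialFamily_opH hA).prim_eq_prim h2.le he (by linarith) h h4).symm

omit [CompleteSpace X] in
lemma add (hS : ExtValue A ω f S) (hT : ExtValue A ω g T) :
    ExtValue A ω (fun z => f z + g z) (S + T) := by
  obtain ⟨e, c, d, h, rfl⟩ := iff_prim.mp hS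
  obtain ⟨e', c', d', h', rfl⟩ := iff_prim.mp hT
  refine iff_prim.mpr ⟨fun z => e z + e' z, c + c', d + d', ⟨h.1.add h'.1, fun z hz => ?_⟩, ?_⟩
  · beta_reduce; rw [h.2 z hz, h'.2 z hz]; ring
  · rw [(isSectorialFamily_opH hA).prim_add h2.le h.1 h'.1 (by linarith) (by linarith)]
    module

omit [CompleteSpace X] hA h1 in
lemma mul_const (hS : ExtValue A ω f S) (a : ℂ) : ExtValue A ω (fun z => f z * a) (a • S) := by
  obtain ⟨e, c, d, h, rfl⟩ := iff_prim.mp hS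
  refine iff_prim.mpr ⟨fun z => e z * a, c * a, d * a, ⟨h.1.smul h2.le a, fun z hz => ?_⟩, ?_⟩
  · beta_reduce; rw [h.2 z hz]; ring
  · rw [IsSectorialFamily.prim_mul_const]
    module

/-- Multiplication by `(1 + z)⁻¹`. -/
lemma mul_inv_one_add (hS : ExtValue A ω f S) :
    ExtValue A ω (fun z => f z * (1 + z)⁻¹) (S * opH A (-1)) := by
  obtain ⟨e, c, d, h, rfl⟩ := iff_prim.mp hS
  have hH := isSectorialFamily_opH hA
  have h0 := hH.nonneg.trans h1.le
  have hρ := inv_one_add (A := A) (ω := ω)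
  have hb := IsHInfty.inv_one_add h0 h2 zero_le_one
  simp only [Complex.ofReal_one, one_mul] at hb
  have v1 := of_elementary hA h2 (h.1.mul_bounded h2.le hb) (δ := (sectAngle A + ω) / 2)
    (by linarith) (by linarith)
  rw [← hH.prim_mul_neg_one h2 h.1 (by linarith) (by linarith)] at v1
  have v2 := of_elementary hA h2 (IsElementary.basic h0 h2 one_pos) (δ := (sectAngle A + ω) / 2)
    (by linarith) (by linarith)
  rw [hH.prim_basic h2 (by linarith) (by linarith) one_pos] at v2
  have v3 := hρ.add hA h1 h2 (v2.mul_const h2 (-1))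
  have v := (v1.add hA h1 h2 (hρ.mul_const h2 c)).add hA h1 h2 (v3.mul_const h2 d)
  have hop : (prim (opH A) ((sectAngle A + ω) / 2) e + c • 1 + d • opH A (-1)) * opH A (-1) =
      prim (opH A) ((sectAngle A + ω) / 2) e * opH A (-1) + c • opH A (-1) +
        d • (opH A (-1) + (-1 : ℂ) •
          (opH A (-((1 : ℝ) : ℂ)⁻¹) - opH A (-1) * opH A (-((1 : ℝ) : ℂ)⁻¹))) := by
    rw [add_mul, add_mul, smul_mul_assoc, smul_mul_assoc, one_mul, Complex.ofReal_one, inv_one]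
    module
  rw [hop]
  refine v.congr fun z hz => ?_
  have hne := one_add_mul_ne_zero h2.le hz zero_le_one
  simp only [Complex.ofReal_one, one_mul] at hne ⊢
  rw [h.2 z hz]
  field_simp
  ring

/-- Multiplication by an elementary function. -/
lemma mul_elementary (hS : ExtValue A ω f S) (he : IsElementary ω e) :
    ExtValue A ω (fun z => f z * e z) (S * prim (opH A) ((sectAngle A + ω) / 2) e) := by
  obtain ⟨e', c, d, h, rfl⟩ := iff_prim.mp hS
  have hH := isSectorialFamily_opH hA
  have h0 := hH.nonneg.trans h1.le
  have hb := IsHInfty.inv_one_add h0 h2 zero_le_one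
  simp only [Complex.ofReal_one, one_mul] at hb
  have h3 : sectAngle A < (sectAngle A + ω) / 2 := by linarith
  have h4 : (sectAngle A + ω) / 2 < ω := by linarith
  have v1 := of_elementary hA h2 (h.1.mul_bounded h2.le he.1) h3 h4
  rw [← hH.prim_mul h2 h.1 he h3 h4] at v1
  have v2 := of_elementary hA h2 he h3 h4
  have v3 := of_elementary hA h2 (he.mul_bounded h2.le hb) h3 h4
  rw [← hH.prim_mul_neg_one h2 he h3 h4,
    ← hH.prim_commute h2.le he h3 h4 hH.neg_one_notMem] at v3
  have v := (v1.add hA h1 h2 (v2.mul_const h2 c)).add hA h1 h2 (v3.mul_const h2 d)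
  rw [add_mul, add_mul, smul_mul_assoc, smul_mul_assoc, one_mul]
  refine v.congr fun z hz => ?_
  rw [h.2 z hz, div_eq_mul_inv]
  ring

/-- The calculus on the extended elementary functions is multiplicative. -/
theorem mul (hS : ExtValue A ω f S) (hT : ExtValue A ω g T) :
    ExtValue A ω (fun z => f z * g z) (S * T) := by
  obtain ⟨e, c, d, h, rfl⟩ := iff_prim.mp hT
  have v := ((hS.mul_elementary hA h1 h2 h.1).add hA h1 h2 (hS.mul_const h2 c)).add hA h1 h2
    ((hS.mul_inv_one_add hA h1 h2).mul_const h2 d)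
  rw [mul_add, mul_add, mul_smul_comm, mul_smul_comm, mul_one]
  refine v.congr fun z hz => ?_
  rw [h.2 z hz, div_eq_mul_inv]
  ring

lemma commute (hS : ExtValue A ω f S) (hT : ExtValue A ω g T) : S * T = T * S :=
  (hS.mul hA h1 h2 hT).unique hA h1 h2 (hT.mul hA h1 h2 hS) fun _ _ => mul_comm _ _

/-- The value at `(1 + t z)⁻¹`, the operator `(1 + t A)⁻¹`. -/
lemma inv_one_add_mul {t : ℝ} (ht : 0 < t) :
    ExtValue A ω (fun z => (1 + t * z)⁻¹) (opH A (-(t : ℂ)⁻¹)) := by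
  have hH := isSectorialFamily_opH hA
  have h0 := hH.nonneg.trans h1.le
  have v2 := of_elementary hA h2 (IsElementary.basic h0 h2 ht) (δ := (sectAngle A + ω) / 2)
    (by linarith) (by linarith)
  rw [hH.prim_basic h2 (by linarith) (by linarith) ht] at v2
  have v := (inv_one_add (A := A) (ω := ω)).add hA h1 h2 (v2.mul_const h2 (1 - t))
  have hop : opH A (-1) + (1 - (t : ℂ)) •
      (opH A (-(t : ℂ)⁻¹) - opH A (-1) * opH A (-(t : ℂ)⁻¹)) = opH A (-(t : ℂ)⁻¹) := by
    have h3 := hH.mul_neg_inv ht hH.neg_one_notMem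
    rw [show (1 + (t : ℂ) * -1) = 1 - t by ring] at h3
    rw [smul_sub, h3]
    module
  rw [hop] at v
  refine v.congr fun z hz => ?_
  have hne := one_add_mul_ne_zero h2.le hz zero_le_one
  have hne' := one_add_mul_ne_zero h2.le hz ht.le
  simp only [Complex.ofReal_one, one_mul] at hne
  field_simp
  ring

omit [CompleteSpace X] h1 in
/-- Restriction to a smaller sector. -/
lemma mono {ω' : ℝ} (h3 : sectAngle A < ω') (h4 : ω' ≤ ω) (hT : ExtValue A ω f T) :
    ExtValue A ω' f T := by
  obtain ⟨e, c, d, h, rfl⟩ := iff_prim.mp hT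
  refine iff_prim.mpr ⟨e, c, d, ⟨h.1.mono h4, fun z hz => h.2 z (sector_mono h4 hz)⟩, ?_⟩
  rw [← (isSectorialFamily_opH hA).prim_eq_prim h2.le h.1 (δ := (sectAngle A + ω') / 2)
    (by linarith) (by linarith) (by linarith)]

end ExtValue

end ExtCalculus

/-! ### The algebraic extension -/

lemma eqOn_of_codiscreteWithin {U : Set ℂ} (hU : IsOpen U) {f g : ℂ → ℂ} (hf : ContinuousOn f U)
    (hg : ContinuousOn g U) (h : f =ᶠ[codiscreteWithin U] g) : EqOn f g U := by
  intro x hx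
  have h1 := mem_codiscreteWithin.mp h x hx
  rw [disjoint_principal_right] at h1
  have h2 : ∀ᶠ y in 𝓝[≠] x, f y = g y := by
    filter_upwards [h1, nhdsWithin_le_nhds (hU.mem_nhds hx)] with y hy hyU
    by_contra hne
    exact hy ⟨hyU, hne⟩
  have hfx := ((hf.continuousAt (hU.mem_nhds hx)).tendsto).mono_left
    (nhdsWithin_le_nhds (s := {x}ᶜ))
  have hgx := ((hg.continuousAt (hU.mem_nhds hx)).tendsto).mono_left
    (nhdsWithin_le_nhds (s := {x}ᶜ))
  exact tendsto_nhds_unique_of_eventuallyEq hfx hgx h2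

lemma IsExtElementary.isHInfty {ω : ℝ} (h0 : 0 ≤ ω) (h1 : ω < π) {f : ℂ → ℂ}
    (hf : IsExtElementary ω f) : IsHInfty ω f := by
  obtain ⟨e, c, d, he, hf⟩ := hf
  have hb := IsHInfty.inv_one_add h0 h1 zero_le_one
  simp only [Complex.ofReal_one, one_mul] at hb
  exact ((he.1.add (IsHInfty.const c)).add ((IsHInfty.const d).mul hb)).congr fun z hz => by
    rw [hf z hz, div_eq_mul_inv]

/-- The identity `e f = g` of meromorphic functions, multiplied with `r`, holds pointwise if
`f r` is holomorphic. -/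
lemma Regularizes.mul_eq {ω ω' : ℝ} (h0 : 0 ≤ ω') (h1 : ω < π) (h2 : ω' ≤ ω) {f e g p r : ℂ → ℂ}
    (h : Regularizes ω f e g) (hp : IsHInfty ω' p) (hr : IsHInfty ω' r)
    (hpr : ∀ z ∈ sector ω', p z = f z * r z) : ∀ z ∈ sector ω', e z * p z = g z * r z := by
  have hU := isOpen_sector h0 (h2.trans h1.le)
  have he := ((h.1.isHInfty (h0.trans h2) h1).mono h2).1.continuousOn
  have hg := ((h.2.1.isHInfty (h0.trans h2) h1).mono h2).1.continuousOn
  refine eqOn_of_codiscreteWithin hU (he.mul hp.1.continuousOn) (hg.mul hr.1.continuousOn) ?_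
  have h3 := h.2.2.filter_mono (codiscreteWithin_mono (sector_mono h2))
  filter_upwards [h3, self_mem_codiscreteWithin (sector ω')] with z hz hzs
  rw [hpr z hzs, ← hz]
  ring

section SectCalc

variable {X : Type*} [NormedAddCommGroup X] [NormedSpace ℂ X] {A : X →ₗ.[ℂ] X}
  {ω : ℝ} {f h p r : ℂ → ℂ} {S T : X →L[ℂ] X} {x y : X}

/-- The kernels of the regularizers of a function in the domain have trivial intersection. -/
lemma MemDom.eq_zero (hf : MemDom A ω f)
    (hx : ∀ e g, Regularizes ω f e g → ∀ T, ExtValue A ω e T → T x = 0) : x = 0 := by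
  have h1 := hf.2 (fun _ => 1) (ExtValue.const (A := A) 1).isExtElementary
  refine h1.2 x fun e he T hT => ?_
  obtain ⟨g, hg⟩ := he
  simp only [one_mul] at hg
  exact hx e g hg T hT

variable [CompleteSpace X] (hA : IsSectorial A) (h1 : sectAngle A < ω) (h2 : ω < π)

include hA h1 h2

/-- If `f h` is extended elementary, then `Φ(f)` maps `Φ(h) x` at most to `Φ(f h) x`, whichever
sector is used to define `Φ(f)`. -/
theorem SectCalc.eq_of_mul (hS : ExtValue A ω h S) (hT : ExtValue A ω p T)
    (hp : ∀ z ∈ sector ω, p z = f z * h z) (hc : SectCalc A f (S x) y) : y = T x := by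
  obtain ⟨ω₁, h3, h4, hdom, hc⟩ := hc
  have h0 := (isSectorialFamily_opH hA).nonneg
  have h5 : sectAngle A < min ω₁ ω := lt_min h3 h1
  have h6 : min ω₁ ω < π := (min_le_left _ _).trans_lt h4
  rw [← sub_eq_zero]
  refine hdom.eq_zero fun e g hreg Te hTe => ?_
  obtain ⟨Tg, hTg⟩ := hreg.2.1.exists_value A
  have hS' := hS.mono hA h2 h5 (min_le_right _ _)
  have hT' := hT.mono hA h2 h5 (min_le_right _ _)
  have hTe' := hTe.mono hA h4 h5 (min_le_left _ _)
  have hTg' := hTg.mono hA h4 h5 (min_le_left _ _)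
  have hm : min ω₁ ω ≤ ω := min_le_right _ _
  have heq := (hTe'.mul hA h5 h6 hT').unique hA h5 h6 (hTg'.mul hA h5 h6 hS')
    (hreg.mul_eq (by linarith) h4 (min_le_left _ _)
      ((hT.isExtElementary.isHInfty (by linarith) h2).mono hm)
      ((hS.isExtElementary.isHInfty (by linarith) h2).mono hm)
      fun z hz => hp z (sector_mono hm hz))
  have h7 := hc e g hreg Te Tg hTe hTg
  have h8 : Te (T x) = Tg (S x) := congrArg (fun L : X →L[ℂ] X => L x) heq
  rw [map_sub, h8, h7, sub_self]

/-- If `r` and `r f` are extended elementary, then `Φ(f) x = y` implies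
`Φ(r) y = Φ(r f) x`. -/
theorem SectCalc.apply_eq (hS : ExtValue A ω r S) (hT : ExtValue A ω p T)
    (hp : ∀ z ∈ sector ω, p z = f z * r z) (hc : SectCalc A f x y) : S y = T x := by
  obtain ⟨ω₁, h3, h4, hdom, hc⟩ := hc
  have h0 := (isSectorialFamily_opH hA).nonneg
  have h5 : sectAngle A < min ω₁ ω := lt_min h3 h1
  have h6 : min ω₁ ω < π := (min_le_left _ _).trans_lt h4
  rw [← sub_eq_zero]
  refine hdom.eq_zero fun e g hreg Te hTe => ?_
  obtain ⟨Tg, hTg⟩ := hreg.2.1.exists_value A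
  have hS' := hS.mono hA h2 h5 (min_le_right _ _)
  have hT' := hT.mono hA h2 h5 (min_le_right _ _)
  have hTe' := hTe.mono hA h4 h5 (min_le_left _ _)
  have hTg' := hTg.mono hA h4 h5 (min_le_left _ _)
  have hm : min ω₁ ω ≤ ω := min_le_right _ _
  have heq := (hTe'.mul hA h5 h6 hT').unique hA h5 h6 (hTg'.mul hA h5 h6 hS')
    (hreg.mul_eq (by linarith) h4 (min_le_left _ _)
      ((hT.isExtElementary.isHInfty (by linarith) h2).mono hm)
      ((hS.isExtElementary.isHInfty (by linarith) h2).mono hm)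
      fun z hz => hp z (sector_mono hm hz))
  have h7 := hc e g hreg Te Tg hTe hTg
  have h8 : Te (T x) = S (Tg x) := by
    rw [hTg'.commute hA h5 h6 hS'] at heq
    exact congrArg (fun L : X →L[ℂ] X => L x) heq
  have h9 : Te (S y) = S (Te y) :=
    congrArg (fun L : X →L[ℂ] X => L y) (hTe'.commute hA h5 h6 hS')
  rw [map_sub, h8, h9, h7, sub_self]

/-- A holomorphic function that is regularized by `r` with `Φ(r)` injective is in the domain of the
calculus. -/
theorem memDom_of_injective (hf : DifferentiableOn ℂ f (sector ω)) (hS : ExtValue A ω r S)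
    (hinj : ∀ x, S x = 0 → x = 0) (hrf : IsExtElementary ω fun z => r z * f z) :
    MemDom A ω f := by
  have h0 := (isSectorialFamily_opH hA).nonneg
  refine ⟨(hf.analyticOnNhd (isOpen_sector (by linarith) h2.le)).meromorphicOn, fun e he => ?_⟩
  have hreg : r ∈ regularizers ω fun z => e z * f z := by
    obtain ⟨Te, hTe⟩ := he.exists_value A
    obtain ⟨T, hT⟩ := hrf.exists_value A
    refine ⟨fun z => e z * (r z * f z), hS.isExtElementary,
      (hTe.mul hA h1 h2 hT).isExtElementary, Eventually.of_forall fun z => ?_⟩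
    change r z * (e z * f z) = e z * (r z * f z)
    ring
  exact ⟨⟨r, hreg⟩, fun x hx => hinj x (hx r hreg S hS)⟩

/-- If `f h` is extended elementary, then `Φ(f)` maps `Φ(h) x` to `Φ(f h) x`. -/
theorem sectCalc_of_mul (hf : MemDom A ω f) (hS : ExtValue A ω h S) (hT : ExtValue A ω p T)
    (hp : ∀ z ∈ sector ω, p z = f z * h z) : SectCalc A f (S x) (T x) := by
  have h0 := (isSectorialFamily_opH hA).nonneg
  refine ⟨ω, h1, h2, hf, fun e g hreg Te Tg hTe hTg => ?_⟩
  have heq := (hTe.mul hA h1 h2 hT).unique hA h1 h2 (hTg.mul hA h1 h2 hS)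
    (hreg.mul_eq (by linarith) h2 le_rfl (hT.isExtElementary.isHInfty (by linarith) h2)
      (hS.isExtElementary.isHInfty (by linarith) h2) hp)
  exact (congrArg (fun L : X →L[ℂ] X => L x) heq).symm

/-- The sectorial calculus extends the primary calculus. -/
theorem ExtValue.hasBoundedValue (hT : ExtValue A ω f T) : HasBoundedValue A f T := by
  have h0 := (isSectorialFamily_opH hA).nonneg
  have hone : ExtValue A ω (fun _ => 1) ((1 : ℂ) • (1 : X →L[ℂ] X)) := ExtValue.const 1
  rw [one_smul] at hone
  have hdom : MemDom A ω f := memDom_of_injective hA h1 h2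
    (hT.isExtElementary.isHInfty (by linarith) h2).1 hone (fun x hx => hx)
    (by simpa using hT.isExtElementary)
  intro x y
  constructor
  · exact fun hc => SectCalc.eq_of_mul hA h1 h2 hone hT (fun z _ => by simp) hc
  · rintro rfl
    exact sectCalc_of_mul hA h1 h2 hdom hone hT (fun z _ => by simp) (x := x)

/-- The composition of `Φ(f)` with the bounded operator `Φ(h)`, when `f h` is extended
elementary. -/
theorem sectCalc_comp_iff (hf : MemDom A ω f) (hS : ExtValue A ω h S) (hT : ExtValue A ω p T)
    (hp : ∀ z ∈ sector ω, p z = f z * h z) :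
    (∃ u, SectCalc A h x u ∧ SectCalc A f u y) ↔ y = T x := by
  constructor
  · rintro ⟨u, hu, hy⟩
    rw [(hS.hasBoundedValue hA h1 h2 x u).mp hu] at hy
    exact SectCalc.eq_of_mul hA h1 h2 hS hT hp hy
  · rintro rfl
    exact ⟨S x, (hS.hasBoundedValue hA h1 h2 x _).mpr rfl, sectCalc_of_mul hA h1 h2 hf hS hT hp⟩

/-- The powers of `(1 + A)⁻¹` are injective and belong to the functions `(1 + z)⁻ⁿ`. -/
lemma exists_value_inv_one_add_pow (n : ℕ) :
    ∃ S : X →L[ℂ] X, ExtValue A ω (fun z => (1 + z)⁻¹ ^ n) S ∧ ∀ x, S x = 0 → x = 0 := by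
  induction n with
  | zero =>
    have hone : ExtValue A ω (fun _ => 1) ((1 : ℂ) • (1 : X →L[ℂ] X)) := ExtValue.const 1
    rw [one_smul] at hone
    exact ⟨1, by simpa using hone, fun x hx => hx⟩
  | succ n ih =>
    obtain ⟨S, hS, hinj⟩ := ih
    refine ⟨S * opH A (-1), ?_, fun x hx => opH_injective hA
      (isSectorialFamily_opH hA).neg_one_notMem (hinj _ hx)⟩
    simpa only [pow_succ] using hS.mul_inv_one_add hA h1 h2

end SectCalc

/-! ### Uniqueness of the values of the uniform extension -/

lemma tendsto_bdry {E ι : Type*} [NormedAddCommGroup E] [NormedSpace ℂ E] {l : Filter ι}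
    [l.IsCountablyGenerated] {δ : ℝ} {u : ι → ℂ → E} {v : ℂ → E} {g : ℝ → ℝ} (hg : Integrable g)
    (hu : ∀ᶠ i in l, ∀ θ, |θ| = |δ| → Continuous fun t => u i (ray θ t))
    (hb : ∀ᶠ i in l, ∀ θ, |θ| = |δ| → ∀ t, ‖u i (ray θ t)‖ ≤ g t)
    (hlim : ∀ θ, |θ| = |δ| → ∀ t, Tendsto (fun i => u i (ray θ t)) l (𝓝 (v (ray θ t)))) :
    Tendsto (fun i => bdry δ (u i)) l (𝓝 (bdry δ v)) := by
  have h : ∀ θ, |θ| = |δ| →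
      Tendsto (fun i => ∫ t, u i (ray θ t)) l (𝓝 (∫ t, v (ray θ t))) := fun θ hθ =>
    tendsto_integral_filter_of_dominated_convergence g
      (hu.mono fun i hi => (hi θ hθ).aestronglyMeasurable)
      (hb.mono fun i hi => Eventually.of_forall (hi θ hθ)) hg
      (Eventually.of_forall (hlim θ hθ))
  exact ((h _ (abs_neg δ)).sub (h _ rfl)).const_smul _

namespace IsSectorialFamily

variable {𝔸 : Type*} [NormedRing 𝔸] [NormedAlgebra ℂ 𝔸] {H : ℂ → 𝔸} {ω₀ : ℝ}

lemma tendsto_prim {ι : Type*} {l : Filter ι} [l.IsCountablyGenerated]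
    (hH : IsSectorialFamily H ω₀) {δ : ℝ} (h1 : ω₀ < δ) (h2 : δ < π) {u : ι → ℂ → ℂ} {v : ℂ → ℂ}
    {g : ℝ → ℝ} (hg : Integrable g)
    (hu : ∀ᶠ i in l, ∀ θ, |θ| = δ → Continuous fun t => u i (ray θ t))
    (hb : ∀ᶠ i in l, ∀ θ, |θ| = δ → ∀ t, ‖u i (ray θ t)‖ ≤ g t)
    (hlim : ∀ θ, |θ| = δ → ∀ t, Tendsto (fun i => u i (ray θ t)) l (𝓝 (v (ray θ t)))) :
    Tendsto (fun i => prim H δ (u i)) l (𝓝 (prim H δ v)) := by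
  obtain ⟨M, hM0, hM⟩ := hH.exists_bound h1
  have hδ : |δ| = δ := abs_of_nonneg (hH.nonneg.trans h1.le)
  refine tendsto_bdry (hg.mul_const M) ?_ ?_ fun θ hθ t => ?_
  · rw [hδ]
    filter_upwards [hu] with i hi θ hθ
    exact (hi θ hθ).smul (hH.continuous_comp_ray (by rwa [hθ]) (by rw [hθ]; exact h2.le))
  · rw [hδ]
    filter_upwards [hb] with i hi θ hθ t
    rw [norm_smul]
    have h3 := hi θ hθ t
    refine mul_le_mul h3 (hM _ ?_) (norm_nonneg _) ((norm_nonneg _).trans h3)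
    rw [abs_arg_ray (by rw [hθ]; exact h2.le), hθ]
  · exact (hlim θ (hθ.trans hδ) t).smul_const _

/-- A dominating function on both boundary rays. -/
lemma exists_dominating {ω δ : ℝ} {e : ℂ → ℂ} (he : IsElementary ω e) (h0 : 0 ≤ δ)
    (h1 : δ < ω) : ∃ g : ℝ → ℝ, Integrable g ∧ ∀ θ, |θ| = δ → ∀ t, ‖e (ray θ t)‖ ≤ g t := by
  have hr := he.rayIntegrable h0 h1
  refine ⟨fun t => ‖e (ray (-δ) t)‖ + ‖e (ray δ t)‖, hr.1.norm.add hr.2.norm, fun θ hθ t => ?_⟩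
  rcases eq_or_eq_neg_of_abs_eq hθ with rfl | rfl
  · linarith [norm_nonneg (e (ray (-θ) t))]
  · linarith [norm_nonneg (e (ray δ t))]

/-- Multiplication with a uniformly convergent sequence of bounded functions. -/
lemma tendsto_prim_mul (hH : IsSectorialFamily H ω₀) {ω δ : ℝ} (hω : ω < π) (h1 : ω₀ < δ)
    (h2 : δ < ω) {e f : ℂ → ℂ} {F : ℕ → ℂ → ℂ} (he : IsElementary ω e) {M : ℝ}
    (hF : ∀ᶠ n in atTop, ContinuousOn (F n) (sector ω))
    (hM : ∀ᶠ n in atTop, ∀ z ∈ sector ω, ‖F n z‖ ≤ M)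
    (hlim : ∀ z ∈ sector ω, Tendsto (fun n => F n z) atTop (𝓝 (f z))) :
    Tendsto (fun n => prim H δ fun z => e z * F n z) atTop (𝓝 (prim H δ fun z => e z * f z)) := by
  obtain ⟨g, hg, hge⟩ := exists_dominating he (hH.nonneg.trans h1.le) h2
  have hs : ∀ θ, |θ| = δ → ∀ t, ray θ t ∈ sector ω := fun θ hθ =>
    ray_mem_sector (by rwa [hθ]) hω.le
  refine hH.tendsto_prim h1 (h2.trans hω) (hg.mul_const M) ?_ ?_ fun θ hθ t => ?_
  · filter_upwards [hF] with n hn θ hθ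
    exact SectorialCalculus.continuous_comp_ray hω.le (he.1.1.continuousOn.mul hn) (by rwa [hθ])
  · filter_upwards [hM] with n hn θ hθ t
    rw [norm_mul]
    exact mul_le_mul (hge θ hθ t) (hn _ (hs θ hθ t)) (norm_nonneg _)
      ((norm_nonneg _).trans (hge θ hθ t))
  · exact (hlim _ (hs θ hθ t)).const_mul _

end IsSectorialFamily

lemma extendZero_of_ne {f : ℂ → ℂ} {z : ℂ} (hz : z ≠ 0) : extendZero f z = f z :=
  Function.update_of_ne hz _ _

lemma extendZero_zero {f : ℂ → ℂ} {a : ℂ} (h : Tendsto (fun t : ℝ => f t) (𝓝[>] 0) (𝓝 a)) :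
    extendZero f 0 = a := by
  rw [extendZero, Function.update_self, h.limUnder_eq]

section Uniqueness

variable {X : Type*} [NormedAddCommGroup X] [NormedSpace ℂ X] {A : X →ₗ.[ℂ] X}
  {f : ℂ → ℂ} {T : X →L[ℂ] X}

/-- A vector in the kernel of `A`, that is, a fixed vector of `(1 + A)⁻¹`. -/
lemma opH_apply_of_fixed (hA : IsSectorial A) {y : X} (hy : opH A (-1) y = y) {z : ℂ}
    (hz : z ∉ closedSector (sectAngle A)) : opH A z y = y := by
  have hH := isSectorialFamily_opH hA
  have hz0 := ne_zero_of_notMem_closedSector hH.nonneg hz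
  have h := congrArg (fun L : X →L[ℂ] X => L y) (hH.mul_neg_inv one_pos hz)
  simp only [Complex.ofReal_one, one_mul, inv_one] at h
  change (1 + z) • opH A z (opH A (-1) y) = opH A z y + z • opH A (-1) y at h
  rw [hy, add_smul, one_smul, add_right_inj] at h
  exact smul_right_injective X hz0 h

/-- On the kernel of `A` the primary calculus acts by the value `c + d` of the function at `0`. -/
lemma IsExtDecomp.apply_of_fixed [CompleteSpace X] (hA : IsSectorial A) {ω : ℝ}
    (h1 : sectAngle A < ω) (h2 : ω < π) {e : ℂ → ℂ} {c d : ℂ} (hf : IsExtDecomp ω f e c d)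
    {y : X} (hy : opH A (-1) y = y) (hT : ExtValue A ω f T) : T y = (c + d) • y := by
  have hH := isSectorialFamily_opH hA
  have h0 := hH.nonneg
  have hT' : T = prim (opH A) ((sectAngle A + ω) / 2) e + c • 1 + d • opH A (-1) :=
    hT.unique hA h1 h2 (ExtValue.iff_prim.mpr ⟨e, c, d, hf, rfl⟩) fun _ _ => rfl
  have hr := hf.1.rayIntegrable (δ := (sectAngle A + ω) / 2) (by linarith) (by linarith)
  have h3 : prim (opH A) ((sectAngle A + ω) / 2) e y = 0 := by
    have h4 := bdry_clm (hH.rayIntegrable_smul (by linarith) (by linarith) hr)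
      (ContinuousLinearMap.apply ℂ X y)
    change _ = prim (opH A) ((sectAngle A + ω) / 2) e y at h4
    rw [← h4]
    have h5 : bdry ((sectAngle A + ω) / 2) (fun z => ContinuousLinearMap.apply ℂ X y
        (e z • opH A z)) = bdry ((sectAngle A + ω) / 2) fun z => e z • y := by
      refine bdry_congr fun θ hθ t => ?_
      rw [abs_of_nonneg (show 0 ≤ (sectAngle A + ω) / 2 by linarith)] at hθ
      change e _ • opH A _ y = _
      rw [opH_apply_of_fixed hA hy (ray_notMem_closedSector (by linarith) (by linarith) t)]
    rw [h5, bdry_smul_const hr, IsSectorialFamily.bdry_elementary h2.le hf.1 (by linarith)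
      (by linarith), zero_smul]
  rw [hT']
  change prim (opH A) ((sectAngle A + ω) / 2) e y + c • y + d • opH A (-1) y = _
  rw [h3, hy, zero_add, add_smul]

variable [CompleteSpace X]

/-- After multiplication with `A (1 + A)⁻²`, the value of the uniform extension is determined by
the primary calculus. -/
lemma UniValue.basic_mul (hA : IsSectorial A) (hT : UniValue A f T) :
    ∃ ω, sectAngle A < ω ∧ ω < π ∧ ExtValue A ω (fun z => z / (1 + z) * (1 + z)⁻¹ * f z)
      ((opH A (-1) - opH A (-1) * opH A (-1)) * T) := by
  obtain ⟨ω, h1, h2, hf, F, S, hF, hunif, hS⟩ := hT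
  have hH := isSectorialFamily_opH hA
  have h0 : 0 ≤ ω := hH.nonneg.trans h1.le
  have hb := IsElementary.basic h0 h2 one_pos
  have h3 : sectAngle A < (sectAngle A + ω) / 2 := by linarith
  have h4 : (sectAngle A + ω) / 2 < ω := by linarith
  have hbv := ExtValue.of_elementary hA h2 hb h3 h4
  rw [hH.prim_basic h2 h3 h4 one_pos] at hbv
  simp only [Complex.ofReal_one, one_mul, inv_one] at hb hbv
  refine ⟨ω, h1, h2, ?_⟩
  have hfe := ExtValue.of_elementary hA h2 (hb.mul_bounded h2.le hf.1) h3 h4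
  have hFe := fun n => ExtValue.of_elementary hA h2 (hb.mul_bounded h2.le (hF n).1.1) h3 h4
  have hval : ∀ n, (opH A (-1) - opH A (-1) * opH A (-1)) * S n =
      prim (opH A) ((sectAngle A + ω) / 2) fun z => z / (1 + z) * (1 + z)⁻¹ * F n z := by
    intro n
    ext x
    have h := SectCalc.apply_eq hA h1 h2 hbv (hFe n) (fun z _ => mul_comm _ _)
      (((hF n).2 x (S n x)).mpr rfl)
    exact h
  obtain ⟨M, hM⟩ := hf.1.2
  have hlim := hH.tendsto_prim_mul (f := f) (F := F) (M := 1 + M) h2 h3 h4 hb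
    (Eventually.of_forall fun n => (hF n).1.1.1.continuousOn)
    (by
      filter_upwards [Metric.tendstoUniformlyOn_iff.mp hunif 1 one_pos] with n hn z hz
      have h5 := hn z (mem_insert_of_mem _ hz)
      rw [extendZero_of_ne hz.1, extendZero_of_ne hz.1, dist_comm, dist_eq_norm] at h5
      have h6 := norm_le_norm_add_norm_sub' (F n z) (f z)
      linarith [hM z hz])
    (fun z hz => by
      have h5 := hunif.tendsto_at (mem_insert_of_mem _ hz)
      simpa only [extendZero_of_ne hz.1] using h5)
  simp_rw [← hval] at hlim
  rw [tendsto_nhds_unique (hS.const_mul _) hlim]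
  exact hfe

/-- If `A` is not injective, then the regularizability of a function forces an integrable
approach to its limit at `0`. -/
lemma HasBoundedValue.isElementary_sub (hA : IsSectorial A) {ω : ℝ} (h1 : sectAngle A < ω)
    {y : X} (hy : opH A (-1) y = y) (hy0 : y ≠ 0) (hf : IsHInfty ω f) {a : ℂ}
    (ha : Tendsto (fun t : ℝ => f t) (𝓝[>] 0) (𝓝 a)) (hT : HasBoundedValue A f T) :
    ∃ ω', sectAngle A < ω' ∧ ω' ≤ ω ∧ IsElementary ω' fun z => (1 + z)⁻¹ * (f z - a) := by
  obtain ⟨ω₁, h3, h4, hdom, -⟩ := (hT y (T y)).mpr rfl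
  have h0 := (isSectorialFamily_opH hA).nonneg
  have h5 : sectAngle A < min ω₁ ω := lt_min h3 h1
  have h6 : min ω₁ ω < π := (min_le_left _ _).trans_lt h4
  set ω' := min ω₁ ω
  have hω1 : ω' ≤ ω₁ := min_le_left _ _
  have hω : ω' ≤ ω := min_le_right _ _
  obtain ⟨e, g, hreg, Te, hTe, hne⟩ : ∃ e g, Regularizes ω₁ f e g ∧
      ∃ Te, ExtValue A ω₁ e Te ∧ Te y ≠ 0 := by
    by_contra hcon
    push Not at hcon
    exact hy0 (hdom.eq_zero fun e g hreg T hT => hcon e g hreg T hT)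
  have heq := hreg.mul_eq (p := f) (r := fun _ => 1) (by linarith) h4 hω1 (hf.mono hω)
    (IsHInfty.const 1) fun z _ => (mul_one _).symm
  obtain ⟨e₀, c, d, he⟩ := hreg.1
  obtain ⟨g₀, c', d', hg⟩ := hreg.2.1
  rw [he.apply_of_fixed hA h3 h4 hy hTe] at hne
  have hcd : c + d ≠ 0 := fun h => hne (by rw [h, zero_smul])
  refine ⟨ω', h5, hω, ?_⟩
  -- solve `e f = g` for `f`, with `e = e₀ + (c + d) - d z / (1 + z)`
  have hρ := IsHInfty.inv_one_add (ω := ω') (by linarith) h6 zero_le_one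
  have hb := IsElementary.basic (ω := ω') (by linarith) h6 one_pos
  simp only [Complex.ofReal_one, one_mul] at hb hρ
  have hE1 := ((hg.1.mono hω1).mul_bounded h6.le hρ).add (hb.smul h6.le (-d'))
  have hE2 := ((((he.1.mono hω1).mul_bounded h6.le hρ).smul h6.le (-1)).add
    (hb.smul h6.le d)).mul_bounded h6.le (hf.mono hω)
  have hE := (hE1.add hE2).smul h6.le (c + d)⁻¹
  have hE' : IsElementary ω' fun z => (1 + z)⁻¹ * (f z - (c' + d') / (c + d)) := by
    refine hE.congr h6.le fun z hz => ?_
    have h7 := heq z hz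
    have hz1 := one_add_mul_ne_zero h6.le hz zero_le_one
    simp only [Complex.ofReal_one, one_mul] at hz1
    rw [he.2 z (sector_mono hω1 hz), hg.2 z (sector_mono hω1 hz)] at h7
    field_simp at h7 ⊢
    linear_combination h7
  -- the limit is the right one, since the difference is integrable at `0`
  have hint := hE'.integrable (θ := 0) (by rw [abs_zero]; linarith)
  have hray : ∀ t, ray 0 t = ((Real.exp t : ℝ) : ℂ) := fun t => by simp [ray]
  have hexp : Tendsto (fun t : ℝ => Real.exp (-t)) atTop (𝓝[>] 0) :=
    tendsto_nhdsWithin_iff.mpr ⟨Real.tendsto_exp_neg_atTop_nhds_zero,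
      Eventually.of_forall fun t => Real.exp_pos _⟩
  have hlim1 : Tendsto (fun t : ℝ => (1 + ((Real.exp (-t) : ℝ) : ℂ))⁻¹) atTop (𝓝 1) := by
    have h8 := (Complex.continuous_ofReal.tendsto 0).comp Real.tendsto_exp_neg_atTop_nhds_zero
    have h9 := (h8.const_add 1).inv₀ (by simp)
    simpa [Function.comp_def] using h9
  have hlim := hlim1.mul ((ha.comp hexp).sub_const ((c' + d') / (c + d)))
  rw [one_mul] at hlim
  have h10 := eq_zero_of_integrable_of_tendsto hint.comp_neg (by
    refine hlim.congr fun t => ?_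
    rw [hray]; rfl)
  rw [sub_eq_zero.mp h10]
  exact hE'

/-- If `A` is not injective and `f` has the limit `a` at `0`, then `(1 + t A)⁻¹ (Φ(f) - a)` tends to
`0` for `t → ∞`: this is the value at `(f(z) - a) / (1 + t z)`. -/
lemma tendsto_opH_mul_sub (hA : IsSectorial A) {ω : ℝ} (h1 : sectAngle A < ω)
    (h2 : ω < π) {y : X} (hy : opH A (-1) y = y) (hy0 : y ≠ 0) (hf : IsHInfty ω f) {a : ℂ}
    (ha : Tendsto (fun t : ℝ => f t) (𝓝[>] 0) (𝓝 a)) (hT : HasBoundedValue A f T) :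
    Tendsto (fun n : ℕ => opH A (-(((n : ℝ) + 1 : ℝ) : ℂ)⁻¹) * (T - a • 1)) atTop (𝓝 0) := by
  obtain ⟨ω', h3, h4, hE⟩ := hT.isElementary_sub hA h1 hy hy0 hf ha
  have hH := isSectorialFamily_opH hA
  have h5 : ω' < π := h4.trans_lt h2
  have h0 : 0 ≤ ω' := hH.nonneg.trans h3.le
  have h6 : sectAngle A < (sectAngle A + ω') / 2 := by linarith
  have h7 : (sectAngle A + ω') / 2 < ω' := by linarith
  -- the factor `(1 + z) / (1 + t z)` is bounded for `t ≥ 1`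
  let q : ℕ → ℂ → ℂ := fun n z => (1 + z) * (1 + (((n : ℝ) + 1 : ℝ) : ℂ) * z)⁻¹
  have hn : ∀ n : ℕ, (1 : ℝ) ≤ (n : ℝ) + 1 := fun n => by linarith [n.cast_nonneg (α := ℝ)]
  have hn0 : ∀ n : ℕ, (0 : ℝ) < (n : ℝ) + 1 := fun n => by linarith [hn n]
  obtain ⟨c, hc, hcb⟩ := exists_norm_add_le h0 h5
  have hqd : ∀ n, DifferentiableOn ℂ (q n) (sector ω') := fun n z hz => by
    have h8 : DifferentiableAt ℂ (fun z : ℂ => 1 + (((n : ℝ) + 1 : ℝ) : ℂ) * z) z := by fun_prop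
    have h9 : DifferentiableAt ℂ (fun z : ℂ => 1 + z) z := by fun_prop
    exact (h9.mul (h8.inv (one_add_mul_ne_zero h5.le hz (hn0 n).le))).differentiableWithinAt
  have hqb : ∀ n, ∀ z ∈ sector ω', ‖q n z‖ ≤ c⁻¹ := fun n z hz => by
    have h8 := hcb z hz _ (hn0 n).le
    have h9 : 0 < ‖1 + (((n : ℝ) + 1 : ℝ) : ℂ) * z‖ :=
      norm_pos_iff.mpr (one_add_mul_ne_zero h5.le hz (hn0 n).le)
    rw [norm_mul, norm_inv, ← div_eq_mul_inv, div_le_iff₀ h9, le_inv_mul_iff₀ hc]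
    refine le_trans (mul_le_mul_of_nonneg_left ?_ hc.le) h8
    have h10 := norm_add_le 1 z
    rw [norm_one] at h10
    nlinarith [hn n, norm_nonneg z]
  have hqlim : ∀ z ∈ sector ω', Tendsto (fun n => q n z) atTop (𝓝 0) := fun z hz => by
    have hz0 : 0 < ‖z‖ := norm_pos_iff.mpr hz.1
    have h8 : Tendsto (fun n : ℕ => ‖1 + z‖ / (c * ‖z‖) * (1 / ((n : ℝ) + 1))) atTop (𝓝 0) := by
      simpa using tendsto_one_div_add_atTop_nhds_zero_nat.const_mul (‖1 + z‖ / (c * ‖z‖))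
    refine squeeze_zero_norm (fun n => ?_) h8
    have h9 := hcb z hz _ (hn0 n).le
    have h10 := hn0 n
    rw [norm_mul, norm_inv, ← div_eq_mul_inv, div_mul_div_comm, mul_one]
    gcongr
    refine le_trans ?_ h9
    nlinarith
  have hlim := hH.tendsto_prim_mul (f := fun _ => 0) h5 h6 h7 hE
    (Eventually.of_forall fun n => (hqd n).continuousOn) (Eventually.of_forall hqb) hqlim
  have hzero : prim (opH A) ((sectAngle A + ω') / 2)
      (fun z => (1 + z)⁻¹ * (f z - a) * 0) = 0 := by
    simp [prim, bdry]
  rw [hzero] at hlim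
  refine hlim.congr fun n => ?_
  have hv1 := ExtValue.inv_one_add_mul hA h3 h5 (hn0 n)
  have hv2 := ExtValue.of_elementary hA h5 (hE.mul_bounded h5.le ⟨hqd n, _, hqb n⟩) h6 h7
  have hv := (hv1.mul_const h5 a).add hA h3 h5 hv2
  ext x
  have h8 := SectCalc.apply_eq hA h3 h5 hv1 hv (fun z hz => ?_) ((hT x (T x)).mpr rfl)
  · change _ = opH A _ (T x - a • x)
    rw [map_sub, h8, map_smul]
    change _ = a • opH A _ x + (prim (opH A) ((sectAngle A + ω') / 2) _ : X →L[ℂ] X) x - _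
    rw [add_sub_cancel_left]
  · have h9 := one_add_mul_ne_zero h5.le hz zero_le_one
    simp only [Complex.ofReal_one, one_mul] at h9
    simp only [q]
    have h10 : (1 + z)⁻¹ * (f z - a) * ((1 + z) * (1 + (((n : ℝ) + 1 : ℝ) : ℂ) * z)⁻¹) =
        (f z - a) * (1 + (((n : ℝ) + 1 : ℝ) : ℂ) * z)⁻¹ := by
      field_simp
    rw [h10]
    ring

/-- The resolvents `(1 + t A)⁻¹` are bounded and annihilate `T - f(0)` in the limit `t → ∞`. -/
lemma UniValue.tendsto_opH_mul_sub (hA : IsSectorial A) {y : X} (hy : opH A (-1) y = y)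
    (hy0 : y ≠ 0) (hT : UniValue A f T) :
    Tendsto (fun n : ℕ => opH A (-(((n : ℝ) + 1 : ℝ) : ℂ)⁻¹) * (T - extendZero f 0 • 1))
      atTop (𝓝 0) := by
  obtain ⟨ω, h1, h2, hf, F, S, hF, hunif, hS⟩ := hT
  have hH := isSectorialFamily_opH hA
  have hn0 : ∀ n : ℕ, (0 : ℝ) < (n : ℝ) + 1 := fun n => by linarith [n.cast_nonneg (α := ℝ)]
  obtain ⟨M, hM0, hM⟩ := hH.exists_bound hH.lt_pi
  have hHb : ∀ n : ℕ, ‖opH A (-(((n : ℝ) + 1 : ℝ) : ℂ)⁻¹)‖ ≤ M := fun n => hM _ (by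
    rw [← Complex.ofReal_inv, abs_arg_neg (by exact_mod_cast (inv_pos.mpr (hn0 n)).ne'),
      Complex.arg_ofReal_of_nonneg (inv_pos.mpr (hn0 n)).le]
    simp)
  have ha : ∀ m, Tendsto (fun t : ℝ => F m t) (𝓝[>] 0) (𝓝 (extendZero (F m) 0)) := fun m => by
    obtain ⟨a, ha⟩ := (hF m).1.2
    rwa [extendZero_zero ha]
  have hlim0 : Tendsto (fun m => extendZero (F m) 0) atTop (𝓝 (extendZero f 0)) :=
    hunif.tendsto_at (mem_insert _ _)
  have hlim1 : Tendsto (fun m => S m - extendZero (F m) 0 • (1 : X →L[ℂ] X)) atTop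
      (𝓝 (T - extendZero f 0 • 1)) := hS.sub (hlim0.smul_const _)
  rw [Metric.tendsto_atTop]
  intro ε hε
  obtain ⟨m, hm⟩ := (Metric.tendsto_atTop.mp hlim1 (ε / (2 * (M + 1))) (by positivity))
  have hm := hm m le_rfl
  have h3 := SectorialCalculus.tendsto_opH_mul_sub hA h1 h2 hy hy0 (hF m).1.1 (ha m) (hF m).2
  obtain ⟨N, hN⟩ := Metric.tendsto_atTop.mp h3 (ε / 2) (by positivity)
  refine ⟨N, fun n hn => ?_⟩
  have h4 := hN n hn
  rw [dist_zero_right] at h4 ⊢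
  rw [dist_comm, dist_eq_norm] at hm
  have h5 : opH A (-(((n : ℝ) + 1 : ℝ) : ℂ)⁻¹) * (T - extendZero f 0 • 1) =
      opH A (-(((n : ℝ) + 1 : ℝ) : ℂ)⁻¹) *
        (T - extendZero f 0 • 1 - (S m - extendZero (F m) 0 • 1)) +
      opH A (-(((n : ℝ) + 1 : ℝ) : ℂ)⁻¹) * (S m - extendZero (F m) 0 • 1) := by
    rw [← mul_add, sub_add_cancel]
  rw [h5]
  have h6 : ‖opH A (-(((n : ℝ) + 1 : ℝ) : ℂ)⁻¹) *
      (T - extendZero f 0 • 1 - (S m - extendZero (F m) 0 • 1))‖ ≤ ε / 2 := by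
    refine (norm_mul_le _ _).trans ((mul_le_mul ((hHb n).trans (by linarith : M ≤ M + 1)) hm.le
      (norm_nonneg _) (by positivity)).trans_eq ?_)
    field_simp
  calc _ ≤ _ := norm_add_le _ _
    _ < ε / 2 + ε / 2 := add_lt_add_of_le_of_lt h6 h4
    _ = ε := by ring

/-- **The uniform extension is single-valued.** -/
theorem UniValue.unique (hA : IsSectorial A) {T' : X →L[ℂ] X} (hT : UniValue A f T)
    (hT' : UniValue A f T') : T = T' := by
  have hH := isSectorialFamily_opH hA
  ext x
  obtain ⟨ω, h1, h2, hv⟩ := hT.basic_mul hA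
  obtain ⟨ω', h1', h2', hv'⟩ := hT'.basic_mul hA
  have heq := (hv.mono hA h2 (lt_min h1 h1') (min_le_left _ _)).unique hA (lt_min h1 h1')
    ((min_le_left _ _).trans_lt h2) (hv'.mono hA h2' (lt_min h1 h1') (min_le_right _ _))
    fun _ _ => rfl
  rw [← sub_eq_zero, ← mul_sub] at heq
  -- the difference of the two values has range in the kernel of `A`
  set y := T x - T' x
  have hfix : opH A (-1) y = y := by
    have h3 : opH A (-1) y - opH A (-1) (opH A (-1) y) = 0 :=
      congrArg (fun L : X →L[ℂ] X => L x) heq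
    rw [← map_sub] at h3
    exact (sub_eq_zero.mp (opH_injective hA hH.neg_one_notMem h3)).symm
  -- on the kernel of `A` the operators `(1 + t A)⁻¹` are the identity
  by_contra hne
  have hy0 : y ≠ 0 := fun h => hne (sub_eq_zero.mp h)
  have hlim := (hT.tendsto_opH_mul_sub hA hfix hy0).sub (hT'.tendsto_opH_mul_sub hA hfix hy0)
  have hlim' := ((ContinuousLinearMap.apply ℂ X x).continuous.tendsto _).comp hlim
  have hconst : ∀ n : ℕ, (ContinuousLinearMap.apply ℂ X x)
      (opH A (-(((n : ℝ) + 1 : ℝ) : ℂ)⁻¹) * (T - extendZero f 0 • 1) -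
        opH A (-(((n : ℝ) + 1 : ℝ) : ℂ)⁻¹) * (T' - extendZero f 0 • 1)) = y := by
    intro n
    have hn0 : (0 : ℝ) < (n : ℝ) + 1 := by linarith [n.cast_nonneg (α := ℝ)]
    rw [← mul_sub, sub_sub_sub_cancel_right]
    exact opH_apply_of_fixed hA hfix (hH.neg_inv_notMem hn0)
  simp only [Function.comp_def, hconst] at hlim'
  have := tendsto_nhds_unique tendsto_const_nhds hlim'
  simp only [sub_zero, map_zero] at this
  exact hy0 this

end Uniqueness

/-! ### Integration against complex measures -/

section ComplexMeasure

variable {S E F : Type*} [MeasurableSpace S] [NormedAddCommGroup E] [NormedSpace ℂ E]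
  [NormedAddCommGroup F] [NormedSpace ℂ F]

/-- The variation of a complex measure is dominated by the sum of the variations of its real and
imaginary parts, which are finite. -/
instance isFiniteMeasure_variation (μ : ComplexMeasure S) : IsFiniteMeasure μ.variation := by
  have h : ∀ ν : SignedMeasure S, IsFiniteMeasure ν.variation := fun ν => by
    rw [← SignedMeasure.totalVariation_eq_variation]
    unfold SignedMeasure.totalVariation
    infer_instance
  have := h (ComplexMeasure.re μ)
  have := h (ComplexMeasure.im μ)
  refine isFiniteMeasure_of_le ((ComplexMeasure.re μ).variation + (ComplexMeasure.im μ).variation)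
    (VectorMeasure.variation_le_of_forall_enorm_le fun s _ => ?_)
  have h1 : ‖μ s‖ₑ ≤ ‖(μ s).re‖ₑ + ‖(μ s).im‖ₑ := by
    rw [← ofReal_norm, ← ofReal_norm, ← ofReal_norm,
      ← ENNReal.ofReal_add (norm_nonneg _) (norm_nonneg _)]
    exact ENNReal.ofReal_le_ofReal (Complex.norm_le_abs_re_add_abs_im _)
  refine h1.trans (add_le_add ?_ ?_)
  · exact VectorMeasure.enorm_measure_le_variation (ComplexMeasure.re μ) s
  · exact VectorMeasure.enorm_measure_le_variation (ComplexMeasure.im μ) s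

variable {μ : ComplexMeasure S} {f g : S → E}

lemma cintegral_add (hf : Integrable f μ.variation) (hg : Integrable g μ.variation) :
    cintegral μ (f + g) = cintegral μ f + cintegral μ g :=
  VectorMeasure.integral_add hf hg

lemma cintegral_congr_ae (h : f =ᵐ[μ.variation] g) : cintegral μ f = cintegral μ g :=
  VectorMeasure.integral_congr_ae h

lemma cintegral_indicator_const [CompleteSpace E] {s : Set S} (hs : MeasurableSet s) (c : E) :
    cintegral μ (s.indicator fun _ => c) = μ s • c :=
  setToFun_indicator_const _ hs (measure_ne_top _ _) c

lemma continuous_cintegral : Continuous fun f : S →₁[μ.variation] E => cintegral μ f :=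
  VectorMeasure.continuous_integral

lemma exists_norm_cintegral_le (μ : ComplexMeasure S) (E : Type*) [NormedAddCommGroup E]
    [NormedSpace ℂ E] : ∃ N : ℝ, ∀ (f : S → E) (C : ℝ), (∀ s, ‖f s‖ ≤ C) →
      ‖cintegral μ f‖ ≤ C * N :=
  ⟨_, fun _ _ h => (VectorMeasure.norm_integral_le_of_norm_le_const
    (Eventually.of_forall h)).trans_eq (mul_assoc _ _ _)⟩

lemma clm_cintegral [CompleteSpace E] [CompleteSpace F] (L : E →L[ℂ] F)
    (hf : Integrable f μ.variation) : L (cintegral μ f) = cintegral μ fun s => L (f s) := by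
  refine Integrable.induction (P := fun f => L (cintegral μ f) = cintegral μ fun s => L (f s))
    (fun c s hs _ => ?_) (fun f g _ hf hg ihf ihg => ?_) ?_ (fun f g h _ ih => ?_) hf
  · have h : (fun x => L (s.indicator (fun _ => c) x)) = s.indicator fun _ => L c :=
      (indicator_comp_of_zero L.map_zero).symm
    rw [cintegral_indicator_const hs, h, cintegral_indicator_const hs, map_smul]
  · rw [cintegral_add hf hg, map_add, ihf, ihg, ← cintegral_add (L.integrable_comp hf)
      (L.integrable_comp hg)]
    congr 1
    ext s
    simp
  · have h : ∀ f : S →₁[μ.variation] E,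
        cintegral μ (fun s => L (f s)) = cintegral μ (L.compLpL 1 μ.variation f) := fun f =>
      cintegral_congr_ae (L.coeFn_compLpL f).symm
    simp_rw [h]
    exact isClosed_eq (L.continuous.comp continuous_cintegral)
      (continuous_cintegral.comp (L.compLpL 1 μ.variation).continuous)
  · rw [← cintegral_congr_ae h, ih]
    exact cintegral_congr_ae (h.mono fun s hs => congrArg L hs)

/-- The integral of a function with values in a subspace lies in the closure of the subspace:
the quotient map annihilates it. -/
lemma cintegral_mem_topologicalClosure [CompleteSpace E] {Q : Submodule ℂ E}
    (hf : Integrable f μ.variation) (h : ∀ s, f s ∈ Q) :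
    cintegral μ f ∈ Q.topologicalClosure := by
  have hc : IsClosed (Q.topologicalClosure : Set E) := Q.isClosed_topologicalClosure
  have : IsClosed (Q.topologicalClosure.toAddSubgroup : Set E) := hc
  rw [← Submodule.Quotient.mk_eq_zero]
  have h1 := clm_cintegral (Q.topologicalClosure.mkQL) hf
  have h2 : (fun s => Q.topologicalClosure.mkQL (f s)) = fun _ => 0 :=
    funext fun s => (Submodule.Quotient.mk_eq_zero _).mpr (Q.le_topologicalClosure (h s))
  rw [h2] at h1
  exact h1.trans VectorMeasure.integral_zero

end ComplexMeasure

/-- On a closed sector, a bounded function that is continuous outside the vertex is integrable with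
respect to every complex measure. -/
lemma integrable_of_continuousAt {φ : ℝ} (μ : ComplexMeasure (closedSector φ)) {E : Type*}
    [NormedAddCommGroup E] {W : closedSector φ → E} {C : ℝ}
    (hc : ∀ s : closedSector φ, (s : ℂ) ≠ 0 → ContinuousAt W s) (hb : ∀ s, ‖W s‖ ≤ C) :
    Integrable W μ.variation := by
  refine Integrable.of_bound ?_ C (Eventually.of_forall hb)
  let U : Set (closedSector φ) := {s | (s : ℂ) ≠ 0}
  have hU : MeasurableSet U :=
    ((isOpen_ne (x := (0 : ℂ))).preimage continuous_subtype_val).measurableSet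
  have h1 : AEStronglyMeasurable W (μ.variation.restrict U) :=
    (ContinuousOn.aestronglyMeasurable (fun s hs => (hc s hs).continuousWithinAt) hU)
  have h2 : AEStronglyMeasurable W (μ.variation.restrict Uᶜ) := by
    have hs : Uᶜ.Subsingleton := fun s hs t ht => by
      simp only [U, mem_compl_iff, mem_ofPred_eq, not_not] at hs ht
      exact Subtype.ext (hs.trans ht.symm)
    rcases hs.eq_empty_or_singleton with h | ⟨a, h⟩
    · rw [h, Measure.restrict_empty]; exact aestronglyMeasurable_zero_measure _
    · refine (aestronglyMeasurable_const (b := W a)).congr ?_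
      refine (ae_restrict_iff' hU.compl).mpr (Eventually.of_forall fun s hs => ?_)
      rw [h] at hs
      rw [mem_singleton_iff.mp hs]
  have h3 := aestronglyMeasurable_union_iff.mpr ⟨h1, h2⟩
  rwa [union_compl_self, Measure.restrict_univ] at h3

/-! ### The kernel `w ^ α * exp (-w)` -/

/-- The function `w ^ α e^{-w}`, with the principal branch of the power. -/
noncomputable def kernel (α w : ℂ) : ℂ := w ^ α * Complex.exp (-w)

lemma exp_neg_mul_abs_log {a x : ℝ} (hx : 0 < x) (hx1 : x ≤ 1) :
    Real.exp (-a * |Real.log x|) = x ^ a := by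
  rw [abs_of_nonpos (Real.log_nonpos hx.le hx1), Real.rpow_def_of_pos hx]
  ring_nf

lemma exp_neg_mul_abs_log' {a x : ℝ} (hx1 : 1 ≤ x) :
    Real.exp (-a * |Real.log x|) = x ^ (-a) := by
  rw [abs_of_nonneg (Real.log_nonneg hx1), Real.rpow_def_of_pos (by linarith)]
  ring_nf

lemma exists_rpow_mul_exp_le (a : ℝ) {c : ℝ} (hc : 0 < c) :
    ∃ C : ℝ, 0 ≤ C ∧ ∀ x : ℝ, 0 < x →
      x ^ a * Real.exp (-(c * x)) ≤ C * Real.exp (-a * |Real.log x|) := by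
  obtain ⟨n, hn⟩ := exists_nat_ge (2 * a)
  refine ⟨max 1 (n.factorial / c ^ n), le_max_of_le_left zero_le_one, fun x hx => ?_⟩
  rcases le_total x 1 with h | h
  · rw [exp_neg_mul_abs_log hx h, mul_comm]
    gcongr
    refine le_max_of_le_left (Real.exp_le_one_iff.mpr ?_)
    have := mul_pos hc hx
    linarith
  · rw [exp_neg_mul_abs_log' h]
    refine le_trans ?_ (mul_le_mul_of_nonneg_right (le_max_right _ _) (by positivity))
    have h1 : x ^ (2 * a) ≤ x ^ n := by
      rw [← Real.rpow_natCast]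
      exact Real.rpow_le_rpow_of_exponent_le h hn
    have h2 := Real.pow_div_factorial_le_exp (c * x) (by positivity) n
    have h3 : x ^ a = x ^ (2 * a) * x ^ (-a) := by rw [← Real.rpow_add hx]; ring_nf
    rw [h3, mul_right_comm]
    gcongr
    rw [Real.exp_neg, ← div_eq_mul_inv, div_le_div_iff₀ (Real.exp_pos _) (by positivity)]
    rw [div_le_iff₀ (by positivity), mul_pow] at h2
    calc x ^ (2 * a) * c ^ n ≤ x ^ n * c ^ n := by gcongr
      _ = c ^ n * x ^ n := mul_comm _ _
      _ ≤ _ := by rw [mul_comm (n.factorial : ℝ)]; exact h2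

lemma norm_le_norm_one_add {v : ℂ} (hv : 0 ≤ v.re) : ‖v‖ ≤ ‖1 + v‖ ∧ 1 ≤ ‖1 + v‖ := by
  have h : ‖1 + v‖ ^ 2 = 1 + 2 * v.re + ‖v‖ ^ 2 := by
    rw [Complex.sq_norm, Complex.sq_norm, Complex.normSq_apply, Complex.normSq_apply]
    simp; ring
  constructor
  · exact le_of_sq_le_sq (by linarith) (norm_nonneg _)
  · exact le_of_sq_le_sq (by nlinarith [norm_nonneg v]) (norm_nonneg _)

lemma norm_exp_neg_le {θ : ℝ} (h0 : 0 ≤ θ) (h1 : θ < π / 2) {w : ℂ} (hw : w ∈ sector θ) :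
    ‖Complex.exp (-w)‖ ≤ Real.exp (-(Real.cos θ * ‖w‖)) := by
  have h := (abs_arg_lt_iff hw.1 h0 (by linarith [pi_pos])).mp hw.2
  rw [Complex.norm_exp, Complex.neg_re]
  exact Real.exp_le_exp.mpr (by linarith)

lemma exists_norm_exp_sub_le {θ : ℝ} (h0 : 0 ≤ θ) (h1 : θ < π / 2) :
    ∃ C : ℝ, 0 ≤ C ∧ ∀ w ∈ sector θ, ∀ v : ℂ, ‖v‖ = ‖w‖ → 0 ≤ v.re →
      ‖Complex.exp (-w) - (1 + v)⁻¹‖ ≤ C * Real.exp (-1 * |Real.log ‖w‖|) := by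
  have hc : 0 < Real.cos θ := Real.cos_pos_of_mem_Ioo ⟨by linarith [pi_pos], h1⟩
  refine ⟨3 + 1 / Real.cos θ, by positivity, fun w hw v hv hre => ?_⟩
  have hx : 0 < ‖w‖ := norm_pos_iff.mpr hw.1
  obtain ⟨h2, h3⟩ := norm_le_norm_one_add hre
  rw [hv] at h2
  have h4 : (1 + v) ≠ 0 := norm_pos_iff.mp (by linarith)
  rcases le_total ‖w‖ 1 with h | h
  · rw [exp_neg_mul_abs_log hx h, Real.rpow_one]
    have h5 := Complex.norm_exp_sub_one_le (x := -w) (by rwa [norm_neg])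
    rw [norm_neg] at h5
    have h6 : ‖1 - (1 + v)⁻¹‖ ≤ ‖w‖ := by
      have : 1 - (1 + v)⁻¹ = v / (1 + v) := by field_simp; ring
      rw [this, norm_div, hv]
      exact div_le_self hx.le h3
    calc _ = ‖(Complex.exp (-w) - 1) + (1 - (1 + v)⁻¹)‖ := by rw [sub_add_sub_cancel]
      _ ≤ 2 * ‖w‖ + ‖w‖ := (norm_add_le _ _).trans (add_le_add h5 h6)
      _ = 3 * ‖w‖ := by ring
      _ ≤ _ := by gcongr; linarith [one_div_pos.mpr hc]
  · rw [exp_neg_mul_abs_log' h, Real.rpow_neg_one]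
    have h5 : Real.exp (-(Real.cos θ * ‖w‖)) ≤ 1 / Real.cos θ * ‖w‖⁻¹ := by
      rw [Real.exp_neg, one_div, ← mul_inv]
      exact inv_anti₀ (by positivity) (by linarith [Real.add_one_le_exp (Real.cos θ * ‖w‖)])
    have h6 : ‖(1 + v)⁻¹‖ ≤ ‖w‖⁻¹ := by rw [norm_inv]; exact inv_anti₀ hx h2
    calc _ ≤ 1 / Real.cos θ * ‖w‖⁻¹ + ‖w‖⁻¹ := (norm_sub_le _ _).trans
          (add_le_add ((norm_exp_neg_le h0 h1 hw).trans h5) h6)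
      _ = (1 + 1 / Real.cos θ) * ‖w‖⁻¹ := by ring
      _ ≤ _ := by gcongr; norm_num

lemma norm_cpow_le_mul (α : ℂ) {w : ℂ} (hw : w ≠ 0) :
    ‖w ^ α‖ ≤ Real.exp (π * |α.im|) * ‖w‖ ^ α.re := by
  rw [Complex.norm_cpow_of_ne_zero hw, div_eq_mul_inv, ← Real.exp_neg, mul_comm]
  gcongr
  rw [← neg_mul]
  refine (le_abs_self _).trans ?_
  rw [abs_mul, abs_neg]
  gcongr
  exact Complex.abs_arg_le_pi w

/-- The difference of the kernel and a multiple of `(1 + v)⁻¹` decays polynomially at `0` and at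
`∞`. The factor is `0 ^ α`, the value of the kernel at `0`. -/
lemma exists_norm_kernel_sub_le {α : ℂ} (hα : α = 0 ∨ 0 < α.re) {θ : ℝ} (h0 : 0 ≤ θ)
    (h1 : θ < π / 2) : ∃ a C : ℝ, 0 < a ∧ 0 ≤ C ∧ ∀ w ∈ sector θ, ∀ v : ℂ, ‖v‖ = ‖w‖ → 0 ≤ v.re →
      ‖kernel α w - 0 ^ α * (1 + v)⁻¹‖ ≤ C * Real.exp (-a * |Real.log ‖w‖|) := by
  rcases hα with rfl | hα
  · obtain ⟨C, hC, h⟩ := exists_norm_exp_sub_le h0 h1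
    refine ⟨1, C, one_pos, hC, fun w hw v hv hre => ?_⟩
    simpa [kernel] using h w hw v hv hre
  · have hc : 0 < Real.cos θ := Real.cos_pos_of_mem_Ioo ⟨by linarith [pi_pos], h1⟩
    obtain ⟨C, hC, h⟩ := exists_rpow_mul_exp_le α.re hc
    refine ⟨α.re, Real.exp (π * |α.im|) * C, hα, by positivity, fun w hw v _ _ => ?_⟩
    have hα0 : α ≠ 0 := fun h => by rw [h, Complex.zero_re] at hα; exact hα.false
    rw [Complex.zero_cpow hα0, zero_mul, sub_zero, kernel, norm_mul]
    calc _ ≤ (Real.exp (π * |α.im|) * ‖w‖ ^ α.re) * Real.exp (-(Real.cos θ * ‖w‖)) := by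
          gcongr
          · exact norm_cpow_le_mul α hw.1
          · exact norm_exp_neg_le h0 h1 hw
      _ ≤ _ := by
        rw [mul_assoc, mul_assoc _ C]
        exact mul_le_mul_of_nonneg_left (h _ (norm_pos_iff.mpr hw.1)) (Real.exp_pos _).le

lemma differentiableAt_kernel (α : ℂ) {w : ℂ} (hw : w ∈ Complex.slitPlane) :
    DifferentiableAt ℂ (kernel α) w :=
  (differentiableAt_id.cpow_const hw).mul (by fun_prop)

lemma sector_subset_slitPlane {θ : ℝ} (h : θ ≤ π) : sector θ ⊆ Complex.slitPlane := fun w hw =>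
  Complex.mem_slitPlane_iff_arg.mpr
    ⟨fun h' => by have := hw.2; rw [h', abs_of_pos pi_pos] at this; linarith, hw.1⟩

lemma kernel_zero (α : ℂ) : kernel α 0 = 0 ^ α := by simp [kernel]

lemma continuousAt_kernel_zero {α : ℂ} (hα : α = 0 ∨ 0 < α.re) : ContinuousAt (kernel α) 0 := by
  have h : ContinuousAt (fun w : ℂ => w ^ α) 0 := by
    rcases hα with rfl | hα
    · simp only [Complex.cpow_zero]; exact continuousAt_const
    · exact Complex.continuousAt_cpow_const_of_re_pos (by simp) hα
  exact h.mul (by fun_prop)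

lemma isHInfty_kernel {α : ℂ} (hα : α = 0 ∨ 0 < α.re) {θ : ℝ} (h0 : 0 ≤ θ) (h1 : θ < π / 2) :
    IsHInfty θ (kernel α) := by
  have hpi := pi_pos
  refine ⟨fun w hw => (differentiableAt_kernel α (sector_subset_slitPlane (by linarith)
    hw)).differentiableWithinAt, ?_⟩
  obtain ⟨a, C, ha, hC, h⟩ := exists_norm_kernel_sub_le hα h0 h1
  refine ⟨C + ‖(0 : ℂ) ^ α‖, fun w hw => ?_⟩
  have h2 := h w hw (‖w‖ : ℂ) (by simp) (by simp)
  have h3 : Real.exp (-a * |Real.log ‖w‖|) ≤ 1 :=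
    Real.exp_le_one_iff.mpr (by nlinarith [abs_nonneg (Real.log ‖w‖)])
  have h4 : ‖(0 : ℂ) ^ α * (1 + (‖w‖ : ℂ))⁻¹‖ ≤ ‖(0 : ℂ) ^ α‖ := by
    rw [norm_mul, norm_inv]
    exact mul_le_of_le_one_right (norm_nonneg _)
      (inv_le_one_of_one_le₀ (norm_le_norm_one_add (by simp)).2)
  have h5 := norm_le_norm_add_norm_sub' (kernel α w) ((0 : ℂ) ^ α * (1 + (‖w‖ : ℂ))⁻¹)
  nlinarith [mul_le_of_le_one_right hC h3]

lemma mul_mem_sector {φ ω θ : ℝ} (hθ : φ + ω ≤ θ) (hπ : θ ≤ π) {s z : ℂ} (hs : |s.arg| ≤ φ)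
    (hs0 : s ≠ 0) (hz : z ∈ sector ω) : s * z ∈ sector θ := by
  have h : |s.arg + z.arg| < θ := (abs_add_le _ _).trans_lt (by linarith [hz.2])
  refine ⟨mul_ne_zero hs0 hz.1, ?_⟩
  rwa [Complex.arg_mul hs0 hz.1 ⟨by linarith [neg_abs_le (s.arg + z.arg)],
    (le_abs_self _).trans (by linarith)⟩]

/-- Bounded holomorphic functions on a sector are uniformly continuous with respect to dilations
on every smaller sector. -/
lemma IsHInfty.exists_norm_mul_sub_le {f : ℂ → ℂ} {θ θ' : ℝ} (hf : IsHInfty θ' f) (h : θ < θ')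
    (hπ : θ' ≤ π) : ∃ ε > 0, ∃ L : ℝ, ∀ w ∈ sector θ, ∀ u : ℂ, ‖u - 1‖ < ε →
      ‖f (u * w) - f w‖ ≤ L * ‖u - 1‖ := by
  obtain ⟨M, hM⟩ := hf.2
  have h1 : ∀ᶠ u : ℂ in 𝓝 1, |u.arg| ≤ θ' - θ ∧ u ≠ 0 := by
    have hc : ContinuousAt (fun u : ℂ => |u.arg|) 1 :=
      (Complex.continuousAt_arg Complex.one_mem_slitPlane).abs
    have h2 := hc.eventually_lt_const (show |(1 : ℂ).arg| < θ' - θ by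
      rw [Complex.arg_one, abs_zero]; linarith)
    filter_upwards [h2, isOpen_ne.mem_nhds (one_ne_zero (α := ℂ))] with u h3 h4
    exact ⟨h3.le, h4⟩
  obtain ⟨ε, hε, hball⟩ := Metric.eventually_nhds_iff.mp h1
  refine ⟨ε, hε, 2 * M / ε, fun w hw u hu => ?_⟩
  have hw0 : 0 < ‖w‖ := norm_pos_iff.mpr hw.1
  have hsub : ∀ x ∈ Metric.ball w (ε * ‖w‖), x ∈ sector θ' := fun x hx => by
    have h2 : dist (x / w) 1 < ε := by
      rw [dist_eq_norm, div_sub_one hw.1, norm_div, div_lt_iff₀ hw0, ← dist_eq_norm]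
      exact hx
    have h3 := mul_mem_sector (by linarith) hπ (hball h2).1 (hball h2).2 hw
    rwa [div_mul_cancel₀ _ hw.1] at h3
  have hmem : u * w ∈ Metric.ball w (ε * ‖w‖) := by
    rw [Metric.mem_ball, dist_eq_norm, ← sub_one_mul, norm_mul]
    gcongr
  have hself := hM w (sector_mono h.le hw)
  have h4 := Complex.dist_le_div_mul_dist_of_mapsTo_ball (R₂ := 2 * M)
    (hf.1.mono hsub) (fun x hx => by
      rw [mem_closedBall_iff_norm]
      linarith [norm_sub_le (f x) (f w), hM x (hsub x hx)]) hmem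
  rw [dist_eq_norm, dist_eq_norm, ← sub_one_mul, norm_mul] at h4
  refine h4.trans_eq ?_
  field_simp

/-! ### The operators `(sA)^α e^{-sA}` -/

/-- The elementary part of `z ↦ kernel α (s * z)`. The remaining part is a multiple of
`(1 + ‖s‖ z)⁻¹` instead of `(1 + z)⁻¹`, to have estimates that are uniform in `s`. -/
noncomputable def kernelRem (α s z : ℂ) : ℂ :=
  kernel α (s * z) - 0 ^ α * (1 + ((‖s‖ : ℝ) : ℂ) * z)⁻¹

/-- The operator `(sA)^α e^{-sA}`, in terms of the primary calculus. -/
noncomputable def kernelOp {X : Type*} [NormedAddCommGroup X] [NormedSpace ℂ X] (A : X →ₗ.[ℂ] X)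
    (δ : ℝ) (α s : ℂ) : X →L[ℂ] X :=
  open Classical in
  if s = 0 then (0 : ℂ) ^ α • 1
  else prim (opH A) δ (kernelRem α s) + (0 : ℂ) ^ α • opH A (-((‖s‖ : ℝ) : ℂ)⁻¹)

section Kernel

variable {α : ℂ} (hα : α = 0 ∨ 0 < α.re) {φ ω : ℝ} (hφ : 0 ≤ φ) (h0 : 0 ≤ ω) (h1 : φ + ω < π / 2)

include hφ in
lemma re_nonneg_of_mem_sector (h1 : φ + ω < π / 2) (h0 : 0 ≤ ω) {z : ℂ} (hz : z ∈ sector ω) :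
    0 ≤ z.re := by
  have hpi := pi_pos
  have h := (abs_arg_lt_iff hz.1 h0 (by linarith)).mp hz.2
  have h2 := Real.cos_nonneg_of_mem_Icc (x := ω) ⟨by linarith, by linarith⟩
  exact (mul_nonneg (norm_nonneg _) h2).trans h.le

include hφ h1 in
lemma isHInfty_kernel_mul (hα : α = 0 ∨ 0 < α.re) (h0 : 0 ≤ ω) :
    ∃ M : ℝ, 0 ≤ M ∧ ∀ s : ℂ, |s.arg| ≤ φ →
      DifferentiableOn ℂ (fun z => kernel α (s * z)) (sector ω) ∧
      ∀ z ∈ sector ω, ‖kernel α (s * z)‖ ≤ M := by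
  have hpi := pi_pos
  have hk := isHInfty_kernel hα (θ := φ + ω) (by linarith) h1
  obtain ⟨M, hM⟩ := hk.2
  refine ⟨max M ‖(0 : ℂ) ^ α‖, le_max_of_le_right (norm_nonneg _), fun s hs => ?_⟩
  rcases eq_or_ne s 0 with rfl | hs0
  · simp [kernel_zero, differentiableOn_const]
  · have h2 : ∀ z ∈ sector ω, s * z ∈ sector (φ + ω) := fun z hz =>
      mul_mem_sector le_rfl (by linarith) hs hs0 hz
    exact ⟨hk.1.comp (by fun_prop) h2, fun z hz => (hM _ (h2 z hz)).trans (le_max_left _ _)⟩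

include hα hφ h0 h1

lemma exists_norm_kernelRem_le : ∃ a C : ℝ, 0 < a ∧ 0 ≤ C ∧ ∀ s : ℂ, |s.arg| ≤ φ → s ≠ 0 →
    ∀ z ∈ sector ω,
      ‖kernelRem α s z‖ ≤ C * Real.exp (-a * |Real.log ‖s‖ + Real.log ‖z‖|) := by
  have hpi := pi_pos
  obtain ⟨a, C, ha, hC, h⟩ := exists_norm_kernel_sub_le hα (θ := φ + ω) (by linarith) h1
  refine ⟨a, C, ha, hC, fun s hs hs0 z hz => ?_⟩
  have h2 := h (s * z) (mul_mem_sector le_rfl (by linarith) hs hs0 hz) ((‖s‖ : ℝ) * z) (by simp)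
    (by rw [Complex.re_ofReal_mul]
        exact mul_nonneg (norm_nonneg _) (re_nonneg_of_mem_sector hφ h1 h0 hz))
  rwa [norm_mul, Real.log_mul (norm_ne_zero_iff.mpr hs0) (norm_ne_zero_iff.mpr hz.1)] at h2

lemma isElementary_kernelRem {s : ℂ} (hs : |s.arg| ≤ φ) (hs0 : s ≠ 0) :
    IsElementary ω (kernelRem α s) := by
  have hpi := pi_pos
  obtain ⟨a, C, ha, hC, h⟩ := exists_norm_kernelRem_le hα hφ h0 h1
  obtain ⟨M, -, hM⟩ := isHInfty_kernel_mul hφ h1 hα h0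
  have hd := (IsHInfty.inv_one_add h0 (ω := ω) (by linarith) (norm_nonneg s)).1
  refine IsElementary.of_bound (by linarith) ((hM s hs).1.sub (hd.const_mul _))
    (C := C * Real.exp (a * |Real.log ‖s‖|)) ha fun z hz => (h s hs hs0 z hz).trans ?_
  rw [mul_assoc, ← Real.exp_add]
  gcongr
  have h2 : |Real.log ‖z‖| ≤ |Real.log ‖s‖ + Real.log ‖z‖| + |Real.log ‖s‖| := by
    have := abs_sub (Real.log ‖s‖ + Real.log ‖z‖) (Real.log ‖s‖)
    rwa [add_sub_cancel_left] at this
  nlinarith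

variable {X : Type*} [NormedAddCommGroup X] [NormedSpace ℂ X] {A : X →ₗ.[ℂ] X}
  (hA : IsSectorial A) (h3 : sectAngle A < ω)

include hA h3

lemma extValue_kernel [CompleteSpace X] {s : ℂ} (hs : |s.arg| ≤ φ) :
    ExtValue A ω (fun z => kernel α (s * z)) (kernelOp A ((sectAngle A + ω) / 2) α s) := by
  have hpi := pi_pos
  have h2 : ω < π := by linarith
  rcases eq_or_ne s 0 with rfl | hs0
  · simp only [zero_mul, kernel_zero, kernelOp, if_true]
    exact ExtValue.const _
  · rw [kernelOp, if_neg hs0]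
    have h4 := ExtValue.of_elementary hA h2 (isElementary_kernelRem hα hφ h0 h1 hs hs0)
      (δ := (sectAngle A + ω) / 2) (by linarith) (by linarith)
    refine (h4.add hA h3 h2 ((ExtValue.inv_one_add_mul hA h3 h2
      (norm_pos_iff.mpr hs0)).mul_const h2 (0 ^ α))).congr fun z _ => ?_
    rw [kernelRem]
    ring

lemma exists_norm_kernelOp_le : ∃ C : ℝ, ∀ s : ℂ, |s.arg| ≤ φ →
    ‖kernelOp A ((sectAngle A + ω) / 2) α s‖ ≤ C := by
  have hpi := pi_pos
  have hH := isSectorialFamily_opH hA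
  set δ := (sectAngle A + ω) / 2 with hδ
  have hδ0 : |δ| = δ := abs_of_nonneg (by linarith [hH.nonneg])
  obtain ⟨a, C, ha, hC, h⟩ := exists_norm_kernelRem_le hα hφ h0 h1
  obtain ⟨M, hM0, hM⟩ := hH.exists_bound (δ := δ) (by linarith)
  obtain ⟨N, hN0, hN⟩ := hH.exists_bound hH.lt_pi
  refine ⟨max (‖(0 : ℂ) ^ α • (1 : X →L[ℂ] X)‖)
    ((∫ t, C * Real.exp (-a * |t|) * M) + ‖(0 : ℂ) ^ α‖ * N), fun s hs => ?_⟩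
  rw [kernelOp]
  split_ifs with hs0
  · exact le_max_left _ _
  · refine le_max_of_le_right ((norm_add_le _ _).trans (add_le_add ?_ ?_))
    · have hg : Integrable fun t : ℝ => C * Real.exp (-a * |t|) * M :=
        ((integrable_exp_neg_mul_abs ha).const_mul C).mul_const M
      rw [← integral_add_left_eq_self (fun t : ℝ => C * Real.exp (-a * |t|) * M)
        (Real.log ‖s‖)]
      refine norm_bdry_le (hg.comp_add_left (Real.log ‖s‖)) fun θ hθ t => ?_
      rw [hδ0] at hθ
      rw [norm_smul]
      have h5 := h s hs hs0 (ray θ t) (ray_mem_sector (by linarith) (by linarith) t)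
      rw [norm_ray, Real.log_exp] at h5
      exact mul_le_mul h5 (hM _ (by rw [abs_arg_ray (by linarith), hθ])) (norm_nonneg _)
        (by positivity)
    · rw [norm_smul]
      gcongr
      refine hN _ ?_
      have hs' : 0 < ‖s‖ := norm_pos_iff.mpr hs0
      rw [← Complex.ofReal_inv, abs_arg_neg (by exact_mod_cast (inv_pos.mpr hs').ne'),
        Complex.arg_ofReal_of_nonneg (inv_pos.mpr hs').le]
      simp

lemma continuousAt_kernelOp (s₀ : closedSector φ) (hs₀ : (s₀ : ℂ) ≠ 0) :
    ContinuousAt (fun s : closedSector φ => kernelOp A ((sectAngle A + ω) / 2) α (s : ℂ)) s₀ := by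
  have hpi := pi_pos
  have hH := isSectorialFamily_opH hA
  have hδ : 0 ≤ (sectAngle A + ω) / 2 := by linarith [hH.nonneg]
  obtain ⟨a, C, ha, hC, h⟩ := exists_norm_kernelRem_le hα hφ h0 h1
  have hne : ∀ᶠ s : closedSector φ in 𝓝 s₀, (s : ℂ) ≠ 0 :=
    continuous_subtype_val.continuousAt.eventually_ne hs₀
  have hray : ∀ θ, |θ| = (sectAngle A + ω) / 2 → ∀ t, ray θ t ∈ sector ω := fun θ hθ =>
    ray_mem_sector (by linarith) (by linarith)
  have hlog : ∀ᶠ s : closedSector φ in 𝓝 s₀, |Real.log ‖(s : ℂ)‖| < |Real.log ‖(s₀ : ℂ)‖| + 1 := by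
    have hc : ContinuousAt (fun s : closedSector φ => |Real.log ‖(s : ℂ)‖|) s₀ :=
      (continuous_subtype_val.norm.continuousAt.log (norm_ne_zero_iff.mpr hs₀)).abs
    exact hc.eventually_lt_const (lt_add_one _)
  -- dominated convergence in the contour integral
  have hlim1 : Tendsto (fun s : closedSector φ =>
      prim (opH A) ((sectAngle A + ω) / 2) (kernelRem α s)) (𝓝 s₀)
      (𝓝 (prim (opH A) ((sectAngle A + ω) / 2) (kernelRem α s₀))) := by
    refine hH.tendsto_prim (g := fun t => C * Real.exp (a * (|Real.log ‖(s₀ : ℂ)‖| + 1)) *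
      Real.exp (-a * |t|)) (by linarith) (by linarith)
      ((integrable_exp_neg_mul_abs ha).const_mul _) ?_ ?_ fun θ hθ t => ?_
    · filter_upwards [hne] with s hs θ hθ
      exact SectorialCalculus.continuous_comp_ray (by linarith)
        (isElementary_kernelRem hα hφ h0 h1 s.2 hs).1.1.continuousOn (by linarith : |θ| < ω)
    · filter_upwards [hne, hlog] with s hs hl θ hθ t
      have h5 := h s s.2 hs (ray θ t) (hray θ hθ t)
      rw [norm_ray, Real.log_exp] at h5
      refine h5.trans ?_
      rw [mul_assoc, ← Real.exp_add]
      gcongr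
      have h6 : |t| ≤ |Real.log ‖(s : ℂ)‖ + t| + |Real.log ‖(s : ℂ)‖| := by
        have := abs_sub (Real.log ‖(s : ℂ)‖ + t) (Real.log ‖(s : ℂ)‖)
        rwa [add_sub_cancel_left] at this
      nlinarith
    · have hz := hray θ hθ t
      have hsz := mul_mem_sector le_rfl (by linarith) s₀.2 hs₀ hz
      have hk := (differentiableAt_kernel α (sector_subset_slitPlane (by linarith)
        hsz)).continuousAt
      have h5 : 1 + ((‖(s₀ : ℂ)‖ : ℝ) : ℂ) * ray θ t ≠ 0 :=
        one_add_mul_ne_zero (by linarith : ω ≤ π) hz (norm_nonneg _)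
      have hc1 : ContinuousAt (fun s : closedSector φ => (s : ℂ) * ray θ t) s₀ := by fun_prop
      have hc2 : ContinuousAt (fun s : closedSector φ => 1 + ((‖(s : ℂ)‖ : ℝ) : ℂ) * ray θ t)
        s₀ := by fun_prop
      exact (ContinuousAt.comp (f := fun s : closedSector φ => (s : ℂ) * ray θ t) hk hc1).sub
        ((hc2.inv₀ h5).const_mul _)
  have hs' : 0 < ‖(s₀ : ℂ)‖ := norm_pos_iff.mpr hs₀
  have hlim2 : ContinuousAt (fun s : closedSector φ => opH A (-((‖(s : ℂ)‖ : ℝ) : ℂ)⁻¹)) s₀ := by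
    have hd := (hH.differentiableAt (w := -((‖(s₀ : ℂ)‖ : ℝ) : ℂ)⁻¹) (by
      rw [← Complex.ofReal_inv]
      exact neg_ofReal_notMem_closedSector hH.lt_pi (inv_pos.mpr hs'))).continuousAt
    have hc : ContinuousAt (fun s : closedSector φ => -((‖(s : ℂ)‖ : ℝ) : ℂ)⁻¹) s₀ := by
      refine (ContinuousAt.inv₀ (by fun_prop) ?_).neg
      exact_mod_cast hs'.ne'
    exact ContinuousAt.comp (f := fun s : closedSector φ => -((‖(s : ℂ)‖ : ℝ) : ℂ)⁻¹) hd hc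
  refine ((ContinuousAt.add hlim1 (hlim2.const_smul ((0 : ℂ) ^ α)))).congr ?_
  filter_upwards [hne] with s hs
  rw [kernelOp, if_neg hs]
  rfl

end Kernel

/-! ### The composition of powers and exponentials -/

section PowExp

variable {X : Type*} [NormedAddCommGroup X] [NormedSpace ℂ X] [CompleteSpace X] {A : X →ₗ.[ℂ] X}
  {α : ℂ} {φ ω : ℝ}

lemma memDom_const (hA : IsSectorial A) (h3 : sectAngle A < ω) (h2 : ω < π) (c : ℂ) :
    MemDom A ω fun _ => c := by
  have hone : ExtValue A ω (fun _ => 1) ((1 : ℂ) • (1 : X →L[ℂ] X)) := ExtValue.const 1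
  rw [one_smul] at hone
  refine memDom_of_injective hA h3 h2 (differentiableOn_const c) hone (fun x hx => hx) ?_
  simpa using (ExtValue.const (A := A) (ω := ω) c).isExtElementary

/-- A power of positive order, multiplied with a large power of `(1 + z)⁻¹`, is elementary. -/
lemma isElementary_inv_one_add_pow_mul_cpow (hα : 0 < α.re) (hφ : 0 ≤ φ) (h0 : 0 ≤ ω)
    (h1 : φ + ω < π) {s : ℂ} (hs : |s.arg| ≤ φ) (hs0 : s ≠ 0) {n : ℕ} (hn : α.re < n) :
    IsElementary ω fun z => (1 + z)⁻¹ ^ n * (s * z) ^ α := by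
  have h2 : ω < π := by linarith
  obtain ⟨c, hc, hcb⟩ := exists_norm_add_le h0 h2
  have hmem : ∀ z ∈ sector ω, s * z ∈ sector (φ + ω) := fun z hz =>
    mul_mem_sector le_rfl h1.le hs hs0 hz
  have hd := (IsHInfty.inv_one_add h0 h2 zero_le_one).1
  simp only [Complex.ofReal_one, one_mul] at hd
  refine IsElementary.of_bound (a := min α.re (n - α.re))
    (C := c⁻¹ ^ n * (Real.exp (π * |α.im|) * ‖s‖ ^ α.re)) h2.le
    ((hd.pow n).mul fun z hz => ?_) (lt_min hα (by linarith)) fun z hz => ?_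
  · have h3 : DifferentiableAt ℂ (fun z : ℂ => s * z) z := by fun_prop
    exact (h3.cpow_const (sector_subset_slitPlane h1.le (hmem z hz))).differentiableWithinAt
  · have hz0 : 0 < ‖z‖ := norm_pos_iff.mpr hz.1
    have h3 := hcb z hz 1 zero_le_one
    rw [Complex.ofReal_one, one_mul, one_mul] at h3
    have h4 : ‖(1 + z)⁻¹‖ ≤ c⁻¹ * (1 + ‖z‖)⁻¹ := by
      rw [norm_inv, ← mul_inv]
      exact inv_anti₀ (by positivity) h3
    have h5 := norm_cpow_le_mul α (hmem z hz).1
    rw [norm_mul, Real.mul_rpow (norm_nonneg _) (norm_nonneg _)] at h5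
    have h6 : (1 + ‖z‖)⁻¹ ^ n * ‖z‖ ^ α.re ≤
        Real.exp (-min α.re (n - α.re) * |Real.log ‖z‖|) := by
      have h7 : (1 + ‖z‖)⁻¹ ^ n ≤ 1 :=
        pow_le_one₀ (by positivity) (inv_le_one_of_one_le₀ (by linarith))
      rcases le_total ‖z‖ 1 with h | h
      · rw [exp_neg_mul_abs_log hz0 h]
        calc _ ≤ 1 * ‖z‖ ^ α.re := by gcongr
          _ ≤ _ := by
            rw [one_mul]
            exact Real.rpow_le_rpow_of_exponent_ge hz0 h (min_le_left _ _)
      · rw [exp_neg_mul_abs_log' h]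
        calc (1 + ‖z‖)⁻¹ ^ n * ‖z‖ ^ α.re ≤ ‖z‖⁻¹ ^ n * ‖z‖ ^ α.re := by gcongr; linarith
          _ = ‖z‖ ^ (-(n - α.re)) := by
            rw [inv_pow, ← Real.rpow_natCast, ← Real.rpow_neg hz0.le, ← Real.rpow_add hz0]
            ring_nf
          _ ≤ _ := Real.rpow_le_rpow_of_exponent_le h (neg_le_neg (min_le_right _ _))
    rw [norm_mul, norm_pow]
    calc _ ≤ (c⁻¹ * (1 + ‖z‖)⁻¹) ^ n * (Real.exp (π * |α.im|) * (‖s‖ ^ α.re * ‖z‖ ^ α.re)) := by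
          gcongr
      _ = c⁻¹ ^ n * (Real.exp (π * |α.im|) * ‖s‖ ^ α.re) * ((1 + ‖z‖)⁻¹ ^ n * ‖z‖ ^ α.re) := by
          rw [mul_pow]; ring
      _ ≤ _ := by gcongr

/-- The power `(s z)^α` is regularized by a power of `(1 + z)⁻¹`; for `s = 0` or `α = 0` it is
constant on the sector. -/
lemma memDom_cpow (hα : α = 0 ∨ 0 < α.re) (hφ : 0 ≤ φ) (h1 : φ + ω < π) (hA : IsSectorial A)
    (h3 : sectAngle A < ω) {s : ℂ} (hs : |s.arg| ≤ φ) : MemDom A ω fun z => (s * z) ^ α := by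
  have h2 : ω < π := by linarith
  have h0 := (isSectorialFamily_opH hA).nonneg
  rcases hα with rfl | hα
  · simpa using memDom_const hA h3 h2 1
  rcases eq_or_ne s 0 with rfl | hs0
  · simpa using memDom_const hA h3 h2 (0 ^ α)
  obtain ⟨n, hn⟩ := exists_nat_gt α.re
  obtain ⟨S, hS, hinj⟩ := exists_value_inv_one_add_pow hA h3 h2 n
  refine memDom_of_injective hA h3 h2 (fun z hz => ?_) hS hinj
    (ExtValue.of_elementary hA h2 (isElementary_inv_one_add_pow_mul_cpow hα hφ (by linarith) h1 hs
      hs0 hn) (δ := (sectAngle A + ω) / 2) (by linarith) (by linarith)).isExtElementary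
  have h4 : DifferentiableAt ℂ (fun z : ℂ => s * z) z := by fun_prop
  exact (h4.cpow_const (sector_subset_slitPlane h1.le
    (mul_mem_sector le_rfl h1.le hs hs0 hz))).differentiableWithinAt

/-- The composition of `(sA)^α` and `e^{-sA}` is the bounded operator given by the primary calculus
for the product of the two functions. -/
theorem powExp_iff (hα : α = 0 ∨ 0 < α.re) (hφ : 0 ≤ φ) (h1 : φ + ω < π / 2) (hA : IsSectorial A)
    (h3 : sectAngle A < ω) {s : ℂ} (hs : |s.arg| ≤ φ) (x y : X) :
    PowExp A α s x y ↔ y = kernelOp A ((sectAngle A + ω) / 2) α s x := by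
  have hpi := pi_pos
  have h0 := (isSectorialFamily_opH hA).nonneg
  have h2 : ω < π := by linarith
  have hexp := (extValue_kernel (α := 0) (Or.inl rfl) hφ (by linarith) h1 hA h3 hs).congr
    (g := fun z => Complex.exp (-(s * z))) fun z _ => by simp [kernel]
  exact sectCalc_comp_iff hA h3 h2 (memDom_cpow hα hφ (by linarith) hA h3 hs) hexp
    (extValue_kernel hα hφ (by linarith) h1 hA h3 hs) fun z _ => rfl

end PowExp

/-! ### Integrals of the kernels -/

section Transform

variable {α : ℂ} {φ ω : ℝ}

/-- A bounded holomorphic function on a sector as a bounded continuous function. -/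
noncomputable def IsHInfty.toBCF {f : ℂ → ℂ} (hf : IsHInfty ω f) :
    BoundedContinuousFunction (sector ω) ℂ :=
  BoundedContinuousFunction.ofNormedAddCommGroup (fun z : sector ω => f z)
    (continuousOn_iff_continuous_domRestrict.mp hf.1.continuousOn) hf.2.choose
    fun z => hf.2.choose_spec z z.2

lemma isHInfty_kernel_mul_left (hα : α = 0 ∨ 0 < α.re) (hφ : 0 ≤ φ) (h0 : 0 ≤ ω)
    (h1 : φ + ω < π / 2) {s : ℂ} (hs : |s.arg| ≤ φ) : IsHInfty ω fun z => kernel α (s * z) := by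
  obtain ⟨M, -, hM⟩ := isHInfty_kernel_mul hφ h1 hα h0
  exact ⟨(hM s hs).1, M, (hM s hs).2⟩

/-- The bounded continuous function `z ↦ kernel α (s * z)`. -/
noncomputable def kernelBCF (hα : α = 0 ∨ 0 < α.re) (hφ : 0 ≤ φ) (h0 : 0 ≤ ω)
    (h1 : φ + ω < π / 2) (s : closedSector φ) : BoundedContinuousFunction (sector ω) ℂ :=
  (isHInfty_kernel_mul_left hα hφ h0 h1 s.2).toBCF

variable (hα : α = 0 ∨ 0 < α.re) (hφ : 0 ≤ φ) (h0 : 0 ≤ ω) (h1 : φ + ω < π / 2)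

lemma exists_norm_kernelBCF_le : ∃ C : ℝ, ∀ s, ‖kernelBCF hα hφ h0 h1 s‖ ≤ C := by
  obtain ⟨M, hM0, hM⟩ := isHInfty_kernel_mul hφ h1 hα h0
  exact ⟨M, fun s => (BoundedContinuousFunction.norm_le hM0).mpr fun z => (hM s s.2).2 z z.2⟩

/-- Continuity in the supremum norm; it fails at `s = 0`, since `z` ranges over an unbounded
sector. -/
lemma continuousAt_kernelBCF (s₀ : closedSector φ) (hs₀ : (s₀ : ℂ) ≠ 0) :
    ContinuousAt (kernelBCF hα hφ h0 h1) s₀ := by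
  have hpi := pi_pos
  obtain ⟨θ, h2, h3⟩ := exists_between h1
  obtain ⟨ε, hε, L, hL⟩ := (isHInfty_kernel hα (θ := θ) (by linarith) h3).exists_norm_mul_sub_le
    h2 (by linarith)
  have hlim : Tendsto (fun s : closedSector φ => ‖(s : ℂ) / s₀ - 1‖) (𝓝 s₀) (𝓝 0) := by
    have hc : ContinuousAt (fun s : closedSector φ => ‖(s : ℂ) / s₀ - 1‖) s₀ := by fun_prop
    have := hc.tendsto
    rwa [div_self hs₀, sub_self, norm_zero] at this
  have hlim' : Tendsto (fun s : closedSector φ => |L| * ‖(s : ℂ) / s₀ - 1‖) (𝓝 s₀) (𝓝 0) := by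
    simpa using hlim.const_mul |L|
  rw [ContinuousAt, tendsto_iff_dist_tendsto_zero]
  refine squeeze_zero' (Eventually.of_forall fun _ => dist_nonneg) ?_ hlim'
  filter_upwards [hlim.eventually_lt_const hε] with s hs
  refine (BoundedContinuousFunction.dist_le (by positivity)).mpr fun z => ?_
  have h4 := hL (s₀ * z) (mul_mem_sector le_rfl (by linarith) s₀.2 hs₀ z.2) (s / s₀) hs
  rw [← mul_assoc, div_mul_cancel₀ _ hs₀] at h4
  rw [dist_eq_norm]
  exact h4.trans (mul_le_mul_of_nonneg_right (le_abs_self L) (norm_nonneg _))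

variable (μ : ComplexMeasure (closedSector φ))

include hα hφ in
lemma integrable_kernel_mul {z : ℂ} (hz : z ∈ sector (π / 2 - φ)) :
    Integrable (fun s : closedSector φ => kernel α (s * z)) μ.variation := by
  obtain ⟨ω, h2, h3⟩ := exists_between hz.2
  have h0 : 0 ≤ ω := (abs_nonneg _).trans h2.le
  have h1 : φ + ω < π / 2 := by linarith
  have hz' : z ∈ sector ω := ⟨hz.1, h2⟩
  obtain ⟨C, hC⟩ := exists_norm_kernelBCF_le hα hφ h0 h1
  refine integrable_of_continuousAt μ (C := C) (fun s hs => ?_) fun s =>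
    ((kernelBCF hα hφ h0 h1 s).norm_coe_le_norm ⟨z, hz'⟩).trans (hC s)
  exact ContinuousAt.comp (f := kernelBCF hα hφ h0 h1)
    (BoundedContinuousFunction.evalCLM ℂ (⟨z, hz'⟩ : sector ω)).continuous.continuousAt
    (continuousAt_kernelBCF hα hφ h0 h1 s hs)

include hα hφ in
lemma exists_norm_sectorTransform_le (h1 : φ + ω < π / 2) :
    ∃ M : ℝ, ∀ z ∈ sector ω, ‖sectorTransform μ α z‖ ≤ M := by
  obtain ⟨N, hN⟩ := exists_norm_cintegral_le μ ℂ
  rcases le_total 0 ω with h0 | h0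
  · obtain ⟨C, hC⟩ := exists_norm_kernelBCF_le hα hφ h0 h1
    exact ⟨C * N, fun z hz => hN _ C fun s =>
      ((kernelBCF hα hφ h0 h1 s).norm_coe_le_norm ⟨z, hz⟩).trans (hC s)⟩
  · exact ⟨0, fun z hz => absurd (hz.2.trans_le h0) (not_lt.mpr (abs_nonneg _))⟩

/-- The functions `sectorTransform μ α`, together with the integrals of operators `V s` that are
associated with the kernels, are uniform limits of members of any subspace containing the
kernels. -/
lemma exists_seq_tendstoUniformlyOn {E : Type*} [NormedAddCommGroup E] [NormedSpace ℂ E]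
    [CompleteSpace E] {V : closedSector φ → E} {C : ℝ}
    (hV : ∀ s : closedSector φ, (s : ℂ) ≠ 0 → ContinuousAt V s)
    (hVb : ∀ s, ‖V s‖ ≤ C) {Q : Submodule ℂ (E × BoundedContinuousFunction (sector ω) ℂ)}
    (hQ : ∀ s, (V s, kernelBCF hα hφ h0 h1 s) ∈ Q) :
    ∃ q : ℕ → E × BoundedContinuousFunction (sector ω) ℂ, (∀ n, q n ∈ Q) ∧
      Tendsto (fun n => (q n).1) atTop (𝓝 (cintegral μ V)) ∧
      ∀ F : ℕ → ℂ → ℂ, (∀ n, ∀ z : sector ω, F n z = (q n).2 z) →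
        TendstoUniformlyOn F (sectorTransform μ α) atTop (sector ω) := by
  let W : closedSector φ → E × BoundedContinuousFunction (sector ω) ℂ := fun s =>
    (V s, kernelBCF hα hφ h0 h1 s)
  obtain ⟨C', hC'⟩ := exists_norm_kernelBCF_le hα hφ h0 h1
  have hW : Integrable W μ.variation := integrable_of_continuousAt μ (C := max C C')
    (fun s hs => (hV s hs).prodMk (continuousAt_kernelBCF hα hφ h0 h1 s hs))
    fun s => max_le_max (hVb s) (hC' s)
  obtain ⟨q, hq, hlim⟩ := mem_closure_iff_seq_limit.mp (cintegral_mem_topologicalClosure hW hQ)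
  refine ⟨q, hq, ?_, fun F hF => ?_⟩
  · have h2 := clm_cintegral
      (ContinuousLinearMap.fst ℂ E (BoundedContinuousFunction (sector ω) ℂ)) hW
    simp only [ContinuousLinearMap.coe_fst', W] at h2
    rw [← h2]
    exact (continuous_fst.tendsto _).comp hlim
  · have h2 : ∀ z : sector ω, sectorTransform μ α z = (cintegral μ W).2 z := fun z => by
      have h3 := clm_cintegral ((BoundedContinuousFunction.evalCLM ℂ z).comp
        (ContinuousLinearMap.snd ℂ E (BoundedContinuousFunction (sector ω) ℂ))) hW
      simp only [ContinuousLinearMap.comp_apply, ContinuousLinearMap.coe_snd',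
        BoundedContinuousFunction.evalCLM_apply] at h3
      rw [h3]
      rfl
    have h3 := BoundedContinuousFunction.tendsto_iff_tendstoUniformly.mp
      ((continuous_snd.tendsto _).comp hlim)
    rw [tendstoUniformlyOn_iff_tendstoUniformly_comp_coe]
    have h4 : (sectorTransform μ α ∘ ((↑) : sector ω → ℂ)) = (cintegral μ W).2 := funext h2
    rw [h4]
    have h5 : (fun n (z : sector ω) => F n z) = fun n z => (q n).2 z :=
      funext fun n => funext (hF n)
    change TendstoUniformly (fun n (z : sector ω) => F n z) _ _
    rw [h5]
    exact h3

include hα hφ in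
lemma differentiableOn_sectorTransform :
    DifferentiableOn ℂ (sectorTransform μ α) (sector (π / 2 - φ)) := by
  intro z hz
  have hpi := pi_pos
  obtain ⟨ω, h2, h3⟩ := exists_between hz.2
  have h0 : 0 ≤ ω := (abs_nonneg _).trans h2.le
  have h1 : φ + ω < π / 2 := by linarith
  -- only the component of bounded functions matters, so the operators are replaced by `0 : ℂ`
  let Q : Submodule ℂ (ℂ × BoundedContinuousFunction (sector ω) ℂ) :=
    { carrier := {q | ∃ F : ℂ → ℂ, DifferentiableOn ℂ F (sector ω) ∧ ∀ z : sector ω, F z = q.2 z}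
      add_mem' := fun {p q} ⟨F, hF, hF'⟩ ⟨G, hG, hG'⟩ =>
        ⟨fun z => F z + G z, hF.add hG, fun z => congrArg₂ (· + ·) (hF' z) (hG' z)⟩
      zero_mem' := ⟨fun _ => 0, differentiableOn_const 0, fun z => rfl⟩
      smul_mem' := fun c q ⟨F, hF, hF'⟩ =>
        ⟨fun z => c * F z, hF.const_mul c, fun z => congrArg (c * ·) (hF' z)⟩ }
  obtain ⟨q, hq, -, h4⟩ := exists_seq_tendstoUniformlyOn hα hφ h0 h1 μ (V := fun _ => (0 : ℂ))
    (Q := Q) (C := 0) (fun _ _ => continuousAt_const) (fun _ => norm_zero.le) fun s =>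
      ⟨_, (isHInfty_kernel_mul_left hα hφ h0 h1 s.2).1, fun _ => rfl⟩
  choose F hF hF' using hq
  have hopen := isOpen_sector h0 (by linarith : ω ≤ π)
  have h5 := (h4 F hF').tendstoLocallyUniformlyOn.differentiableOn
    (Eventually.of_forall hF) hopen
  exact (h5.differentiableAt (hopen.mem_nhds ⟨hz.1, h2⟩)).differentiableWithinAt

include hα in
lemma tendsto_kernel_mul_ofReal (s : ℂ) :
    Tendsto (fun t : ℝ => kernel α (s * t)) (𝓝[>] 0) (𝓝 (0 ^ α)) := by
  have h2 : Tendsto (fun t : ℝ => s * (t : ℂ)) (𝓝[>] 0) (𝓝 0) := by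
    have hc : Continuous fun t : ℝ => s * (t : ℂ) := by fun_prop
    simpa using (hc.tendsto 0).mono_left nhdsWithin_le_nhds
  have h3 := (continuousAt_kernel_zero hα).tendsto
  rw [kernel_zero] at h3
  exact h3.comp h2

include hα hφ in
lemma tendsto_sectorTransform (h : φ < π / 2) :
    Tendsto (fun t : ℝ => sectorTransform μ α t) (𝓝[>] 0)
      (𝓝 (cintegral μ fun _ => (0 : ℂ) ^ α)) := by
  obtain ⟨ω, h2, h3⟩ := exists_between (sub_pos.mpr h)
  have h1 : φ + ω < π / 2 := by linarith
  obtain ⟨M, -, hM⟩ := isHInfty_kernel_mul hφ h1 hα h2.le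
  refine VectorMeasure.tendsto_integral_filter_of_dominated_convergence (fun _ => M) ?_ ?_
    (integrable_const M) (Eventually.of_forall fun s => tendsto_kernel_mul_ofReal hα (s : ℂ))
  · filter_upwards [self_mem_nhdsWithin] with t ht
    exact (integrable_kernel_mul hα hφ μ (ofReal_mem_sector (by linarith) ht)).aestronglyMeasurable
  · filter_upwards [self_mem_nhdsWithin] with t ht
    exact Eventually.of_forall fun s => (hM s s.2).2 _ (ofReal_mem_sector h2 ht)

end Transform

/-- Uniform convergence on a sector extends to the vertex. -/
lemma tendstoUniformlyOn_extendZero {ω : ℝ} (h0 : 0 < ω) {f : ℂ → ℂ} {F : ℕ → ℂ → ℂ}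
    (h : TendstoUniformlyOn F f atTop (sector ω))
    {a : ℂ} (hf : Tendsto (fun t : ℝ => f t) (𝓝[>] 0) (𝓝 a))
    (hF : ∀ n, ∃ b : ℂ, Tendsto (fun t : ℝ => F n t) (𝓝[>] 0) (𝓝 b)) :
    TendstoUniformlyOn (fun n => extendZero (F n)) (extendZero f) atTop (insert 0 (sector ω)) := by
  rw [Metric.tendstoUniformlyOn_iff] at h ⊢
  intro ε hε
  filter_upwards [h (ε / 2) (by linarith)] with n hn z hz
  rcases hz with rfl | hz
  · obtain ⟨b, hb⟩ := hF n
    rw [extendZero_zero hf, extendZero_zero hb]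
    refine lt_of_le_of_lt (le_of_tendsto (hf.dist hb) ?_) (half_lt_self hε)
    filter_upwards [self_mem_nhdsWithin] with t ht
    exact (hn t (ofReal_mem_sector h0 ht)).le
  · rw [extendZero_of_ne hz.1, extendZero_of_ne hz.1]
    exact (hn z hz).trans (half_lt_self hε)

/-- The transform lies in the domain of the uniform extension, and its value is the integral of
the operators `(sA)^α e^{-sA}`. -/
theorem uniValue_sectorTransform {X : Type*} [NormedAddCommGroup X] [NormedSpace ℂ X]
    [CompleteSpace X] {A : X →ₗ.[ℂ] X} {α : ℂ} {φ ω : ℝ} (hα : α = 0 ∨ 0 < α.re) (hφ : 0 ≤ φ)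
    (h1 : φ + ω < π / 2) (hA : IsSectorial A) (h3 : sectAngle A < ω)
    (μ : ComplexMeasure (closedSector φ)) :
    UniValue A (sectorTransform μ α) (cintegral μ fun s : closedSector φ =>
      kernelOp A ((sectAngle A + ω) / 2) α (s : ℂ)) := by
  have hpi := pi_pos
  have hpos : 0 < ω := (isSectorialFamily_opH hA).nonneg.trans_lt h3
  have h2 : ω < π := by linarith
  let Q : Submodule ℂ ((X →L[ℂ] X) × BoundedContinuousFunction (sector ω) ℂ) :=
    { carrier := {q | ∃ F : ℂ → ℂ, (ExtValue A ω F q.1 ∧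
        ∃ b : ℂ, Tendsto (fun t : ℝ => F t) (𝓝[>] 0) (𝓝 b)) ∧ ∀ z : sector ω, F z = q.2 z}
      add_mem' := fun {p q} ⟨F, ⟨hF, b, hb⟩, hF'⟩ ⟨G, ⟨hG, c, hc⟩, hG'⟩ =>
        ⟨fun z => F z + G z, ⟨hF.add hA h3 h2 hG, b + c, hb.add hc⟩,
          fun z => congrArg₂ (· + ·) (hF' z) (hG' z)⟩
      zero_mem' := ⟨fun _ => 0, ⟨by simpa using ExtValue.const (A := A) (ω := ω) 0, 0,
        tendsto_const_nhds⟩, fun z => rfl⟩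
      smul_mem' := fun c q ⟨F, ⟨hF, b, hb⟩, hF'⟩ =>
        ⟨fun z => F z * c, ⟨hF.mul_const h2 c, b * c, hb.mul_const c⟩,
          fun z => (congrArg (· * c) (hF' z)).trans (mul_comm _ _)⟩ }
  obtain ⟨C, hC⟩ := exists_norm_kernelOp_le hα hφ hpos.le h1 hA h3
  obtain ⟨q, hq, hlim, h4⟩ := exists_seq_tendstoUniformlyOn hα hφ hpos.le h1 μ (Q := Q)
    (continuousAt_kernelOp hα hφ hpos.le h1 hA h3) (fun s => hC s s.2) fun s =>
      ⟨_, ⟨extValue_kernel hα hφ hpos.le h1 hA h3 s.2, _, tendsto_kernel_mul_ofReal hα (s : ℂ)⟩,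
        fun _ => rfl⟩
  choose F hF hF' using hq
  have hf := tendsto_sectorTransform hα hφ μ (by linarith)
  refine ⟨ω, h3, h2, ⟨⟨(differentiableOn_sectorTransform hα hφ μ).mono (sector_mono (by linarith)),
    exists_norm_sectorTransform_le hα hφ μ h1⟩, _, hf⟩, F, fun n => (q n).1, fun n => ⟨⟨?_,
      (hF n).2⟩, (hF n).1.hasBoundedValue hA h3 h2⟩,
    tendstoUniformlyOn_extendZero hpos (h4 F hF') hf fun n => (hF n).2, hlim⟩
  exact (hF n).1.isExtElementary.isHInfty hpos.le h2

end SectorialCalculus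

theorem proposition11p2 (φ : ℝ) (hφ₀ : 0 ≤ φ) (hφ : φ < π / 2)
    (μ : ComplexMeasure (SectorialCalculus.closedSector φ)) (α : ℂ) (hα : α = 0 ∨ 0 < α.re) :
    -- the integral defining `f` converges, `f` is holomorphic, and bounded on smaller sectors
    (∀ z ∈ SectorialCalculus.sector (π / 2 - φ), VectorMeasure.Integrable μ
      (fun s : SectorialCalculus.closedSector φ =>
        ((s : ℂ) * z) ^ α * Complex.exp (-((s : ℂ) * z)))) ∧
    DifferentiableOn ℂ (SectorialCalculus.sectorTransform μ α)
      (SectorialCalculus.sector (π / 2 - φ)) ∧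
    (∀ ψ < π / 2 - φ, ∃ M : ℝ, ∀ z ∈ SectorialCalculus.sector ψ,
      ‖SectorialCalculus.sectorTransform μ α z‖ ≤ M) ∧
    -- the operators `V s = (sA)^α e^{-sA}` are bounded, their integral converges in operator norm,
    -- `f` belongs to the uniform extension, and its value (which is unique) is that integral
    ∀ (X : Type*) [NormedAddCommGroup X] [NormedSpace ℂ X] [CompleteSpace X] (A : X →ₗ.[ℂ] X),
      SectorialCalculus.IsSectorial A → SectorialCalculus.sectAngle A + φ < π / 2 →
      ∃ V : SectorialCalculus.closedSector φ → X →L[ℂ] X,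
        (∀ (s : SectorialCalculus.closedSector φ) (x y : X),
          SectorialCalculus.PowExp A α (s : ℂ) x y ↔ y = V s x) ∧
        VectorMeasure.Integrable μ V ∧
        ∀ T : X →L[ℂ] X,
          SectorialCalculus.UniValue A (SectorialCalculus.sectorTransform μ α) T ↔
            T = SectorialCalculus.cintegral μ V := by
  open SectorialCalculus in
  refine ⟨fun z hz => integrable_kernel_mul hα hφ₀ μ hz, differentiableOn_sectorTransform hα hφ₀ μ,
    fun ψ hψ => exists_norm_sectorTransform_le hα hφ₀ μ (by linarith), fun X _ _ _ A hA hAφ => ?_⟩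
  obtain ⟨ω, h3, h4⟩ := exists_between (lt_sub_iff_add_lt.mpr hAφ)
  have h1 : φ + ω < π / 2 := by linarith
  have h0 : 0 ≤ ω := (isSectorialFamily_opH hA).nonneg.trans h3.le
  obtain ⟨C, hC⟩ := exists_norm_kernelOp_le hα hφ₀ h0 h1 hA h3
  have hval := uniValue_sectorTransform hα hφ₀ h1 hA h3 μ
  exact ⟨fun s => kernelOp A ((sectAngle A + ω) / 2) α (s : ℂ),
    fun s x y => powExp_iff hα hφ₀ h1 hA h3 s.2 x y,
    integrable_of_continuousAt μ (continuousAt_kernelOp hα hφ₀ h0 h1 hA h3) fun s => hC s s.2,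
    fun T => ⟨fun hT => hT.unique hA hval, fun hT => hT ▸ hval⟩⟩
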